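/- Let $k=\mathbf F_q$ be a finite field and let $X$ be a normal surface over $k$ (an integral normal separated $k$-scheme of finite type of dimension $2$), with function field $k(X)$. A Cartier divisor $D=(U_i,f_i)_i$ on $X$ is given by an open covering $(U_i)$ and $f_i\in k(X)^\times$ with $f_i/f_j\in\mathcal O_X(U_i\cap U_j)^\times$; put $H^0(X,D)=\{s\in k(X) : sf_i\in\mathcal O_X(U_i)\ \text{for all } i\}$. For a set $\mathcal P$ of rational points of $X$, the evaluation code $\mathcal C_X(D,\mathcal P)\subseteq k^{\mathcal P}$ is the set of the words $\big((sf_{i_x})(x)\big)_{x\in\mathcal P}$, $s\in H^0(X,D)$, where $i_x$ is a fixed index with $x\in U_{i_x}$. A section $s\in H^0(X,D)$ has multiplicity at least $n$ at a point $p$ if its local equation $sf_i$ at $p$ lies in $\mathfrak m_p^n\subseteq\mathcal O_{X,p}$. Two codes are equivalent if one is obtained from the other by a bijection of the coordinates followed by the multiplication of each coordinate by a nonzero scalar. Let $p$ be a closed point of $X$, let $\pi:Y\to X$ be the blowing-up of $X$ at $p$, and let $D$ be a Cartier divisor on $X$, with pullback $\pi^*D=(\pi^{-1}U_i,f_i\circ\pi)_i$.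 If $p$ is a regular point of $X$, then the sum $\mathcal E$ of the exceptional curves of $\pi$, that is, the reduced divisor with support $\pi^{-1}(p)$, is a Cartier divisor of $Y$. 1. Suppose that $p$ has degree $[\kappa(p):k]>1$. Then $\pi$ induces a bijection $Y(k)\to X(k)$, and by means of it the codes $\mathcal C_X(D,X(k))$ and $\mathcal C_Y(\pi^*D,Y(k))$ are equivalent. If moreover $p$ is a regular point of $X$, then for every integer $n\ge 0$ the code $\mathcal C_Y(\pi^*D-n\mathcal E,Y(k))$ is equivalent, by means of the same bijection, to the subcode of $\mathcal C_X(D,X(k))$ obtained by evaluating only the sections $s\in H^0(X,D)$ of multiplicity at least $n$ at $p$. 2. Suppose that $p$ is rational and is a regular point of $X$, and let $u,v$ be generators of $\mathfrak m_p$. Then there is a bijection of $Y(k)$ with $(X(k)\setminus\{p\})\sqcup\mathbf P^1(k)$, under which a point $x\in X(k)\setminus\{p\}$ corresponds to a point of $Y(k)$ above $x$ and the points of $\mathbf P^1(k)$ correspond to the points of $Y(k)$ above $p$, and by means of which, for every integer $n\ge 0$, the code $\mathcal C_Y(\pi^*D-n\mathcal E,Y(k))$ is equivalent to the code of the following words,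 where $s$ runs through the sections in $H^0(X,D)$ of multiplicity at least $n$ at $p$: the evaluations of $s$ at the points of $X(k)\setminus\{p\}$, followed by the $q+1$ evaluations, at (fixed representatives of) the points of $\mathbf P^1(k)$, of the homogeneous component of degree $n$ of the local equation of $s$ at $p$, that is, of the homogeneous polynomial $F\in k[U,V]$ of degree $n$ with $sf_{i_p}\equiv F(u,v)\bmod \mathfrak m_p^{n+1}$. -/

import Mathlib

open AlgebraicGeometry CategoryTheory

universe u

noncomputable section

namespace BlowUpCode

/-! ### The structure of a `k`-algebra on local rings and residue fields -/

section OverField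

variable (k : Type u) [Field k] (X : Scheme.{u}) [X.Over (Spec (CommRingCat.of k))]

/-- The constants of a `k`-scheme, as germs at a point. -/
def constantGerm (x : X) : k →+* X.presheaf.stalk x :=
  ((Scheme.ΓSpecIso (CommRingCat.of k)).inv ≫ (X ↘ Spec (CommRingCat.of k)).appTop ≫
    X.presheaf.germ ⊤ x trivial).hom

instance algebraStalk (x : X) : Algebra k (X.presheaf.stalk x) :=
  (constantGerm k X x).toAlgebra

instance algebraResidueField (x : X) : Algebra k (X.residueField x) :=
  ((X.residue x).hom.comp (constantGerm k X x)).toAlgebra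

/-- The set `X(k)` of rational points: the points whose residue field is `k`. -/
def RationalPoint : Type u :=
  {x : X // Function.Bijective (algebraMap k (X.residueField x))}

/-- The degree `[κ(x) : k]` of a closed point. -/
def degree (x : X) : ℕ := Module.finrank k (X.residueField x)

/-- `X`, an integral scheme over `k`, is a normal surface: it is separated and of finite type
over `k`, of dimension two, and its local rings are integrally closed. -/
structure IsNormalSurface [IsIntegral X] : Prop where
  separated : IsSeparated (X ↘ Spec (CommRingCat.of k))
  locallyOfFiniteType : LocallyOfFiniteType (X ↘ Spec (CommRingCat.of k))
  quasiCompact : QuasiCompact (X ↘ Spec (CommRingCat.of k))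
  dim_eq_two : topologicalKrullDim X = 2
  normal : ∀ x : X, IsIntegrallyClosed (X.presheaf.stalk x)

variable {k X} in
theorem algebraMap_stalk_functionField [IsIntegral X] (x : X) (c : k) :
    algebraMap (X.presheaf.stalk x) X.functionField (algebraMap k (X.presheaf.stalk x) c) =
      algebraMap k X.functionField c := by
  have h : X.presheaf.germ ⊤ x trivial ≫
      X.presheaf.stalkSpecializes ((genericPoint_spec X).specializes trivial) =
      X.presheaf.germ ⊤ (genericPoint X) trivial := X.presheaf.germ_stalkSpecializes _ _
  exact congr($(h).hom ((X ↘ Spec (CommRingCat.of k)).appTop.hom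
    ((Scheme.ΓSpecIso (CommRingCat.of k)).inv.hom c)))

end OverField

/-! ### Regular functions and Cartier divisors on an integral scheme -/

section Cartier

variable {X Y : Scheme.{u}} [IsIntegral X] [IsIntegral Y]

/-- The section `a` of the structure sheaf over `U` is the rational function `g`. -/
def Represents {U : X.Opens} (a : Γ(X, U)) (g : X.functionField) : Prop :=
  ∀ (x : X) (hx : x ∈ U),
    algebraMap (X.presheaf.stalk x) X.functionField (X.presheaf.germ U x hx a) = g

/-- The rational function `g` is regular on `U`. -/
def IsRegularOn (U : X.Opens) (g : X.functionField) : Prop :=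
  ∃ a : Γ(X, U), Represents a g

theorem IsRegularOn.mul {U : X.Opens} {g h : X.functionField} (hg : IsRegularOn U g)
    (hh : IsRegularOn U h) : IsRegularOn U (g * h) := by
  obtain ⟨a, ha⟩ := hg
  obtain ⟨b, hb⟩ := hh
  exact ⟨a * b, fun x hx => by rw [map_mul, map_mul, ha x hx, hb x hx]⟩

theorem IsRegularOn.add {U : X.Opens} {g h : X.functionField} (hg : IsRegularOn U g)
    (hh : IsRegularOn U h) : IsRegularOn U (g + h) := by
  obtain ⟨a, ha⟩ := hg
  obtain ⟨b, hb⟩ := hh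
  exact ⟨a + b, fun x hx => by rw [map_add, map_add, ha x hx, hb x hx]⟩

theorem isRegularOn_zero (U : X.Opens) : IsRegularOn U (0 : X.functionField) :=
  ⟨0, fun x hx => by rw [map_zero, map_zero]⟩

theorem IsRegularOn.pow {U : X.Opens} {g : X.functionField} (hg : IsRegularOn U g) (n : ℕ) :
    IsRegularOn U (g ^ n) := by
  obtain ⟨a, ha⟩ := hg
  exact ⟨a ^ n, fun x hx => by rw [map_pow, map_pow, ha x hx]⟩

theorem IsRegularOn.mono {U V : X.Opens} (hVU : V ≤ U) {g : X.functionField}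
    (hg : IsRegularOn U g) : IsRegularOn V g := by
  obtain ⟨a, ha⟩ := hg
  refine ⟨X.presheaf.map (homOfLE hVU).op a, fun x hx => ?_⟩
  rw [X.presheaf.germ_res_apply (homOfLE hVU) x hx a]
  exact ha x (hVU hx)

theorem isRegularOn_const (k : Type u) [Field k] [X.Over (Spec (CommRingCat.of k))]
    (U : X.Opens) (c : k) : IsRegularOn U (algebraMap k X.functionField c) := by
  refine IsRegularOn.mono le_top ⟨(X ↘ Spec (CommRingCat.of k)).appTop.hom
    ((Scheme.ΓSpecIso (CommRingCat.of k)).inv.hom c), fun x hx => ?_⟩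
  exact algebraMap_stalk_functionField x c

variable (X) in
/-- A Cartier divisor `(U i, f i)`: an open covering with nonzero rational functions whose
quotients `f i / f j` (and so, exchanging `i` and `j`, their inverses) are regular on
`U i ∩ U j`. -/
structure CartierDivisor where
  ι : Type u
  U : ι → X.Opens
  f : ι → X.functionField
  cover : ∀ x : X, ∃ i, x ∈ U i
  ne_zero : ∀ i, f i ≠ 0
  compat : ∀ i j, IsRegularOn (U i ⊓ U j) (f i / f j)

namespace CartierDivisor

/-- A choice, for each point, of a member of the covering which contains it. -/
def index (D : CartierDivisor X) (x : X) : D.ι := (D.cover x).choose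

theorem mem_index (D : CartierDivisor X) (x : X) : x ∈ D.U (D.index x) :=
  (D.cover x).choose_spec

/-- The difference `(U i ∩ V j, f i / g j)` of `(U i, f i)` and `(V j, g j)`. -/
def sub (D E : CartierDivisor X) : CartierDivisor X where
  ι := D.ι × E.ι
  U i := D.U i.1 ⊓ E.U i.2
  f i := D.f i.1 / E.f i.2
  cover x := ⟨(D.index x, E.index x), D.mem_index x, E.mem_index x⟩
  ne_zero i := div_ne_zero (D.ne_zero _) (E.ne_zero _)
  compat i j := by
    have h := ((D.compat i.1 j.1).mono (V := (D.U i.1 ⊓ E.U i.2) ⊓ (D.U j.1 ⊓ E.U j.2))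
      (inf_le_inf inf_le_left inf_le_left)).mul ((E.compat j.2 i.2).mono
      (V := (D.U i.1 ⊓ E.U i.2) ⊓ (D.U j.1 ⊓ E.U j.2))
      (le_inf (inf_le_right.trans inf_le_right) (inf_le_left.trans inf_le_right)))
    convert h using 1
    have := D.ne_zero j.1
    have := E.ne_zero i.2
    have := E.ne_zero j.2
    field_simp

instance : Sub (CartierDivisor X) := ⟨sub⟩

/-- The multiple `(U i, f i ^ n)` of `(U i, f i)`. -/
def nsmul (n : ℕ) (D : CartierDivisor X) : CartierDivisor X where
  ι := D.ι
  U := D.U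
  f i := D.f i ^ n
  cover := D.cover
  ne_zero i := pow_ne_zero _ (D.ne_zero i)
  compat i j := by
    rw [← div_pow]
    exact (D.compat i j).pow n

instance : SMul ℕ (CartierDivisor X) := ⟨nsmul⟩

end CartierDivisor

theorem specializes_genericPoint (π : Y ⟶ X) (hπ : IsDominant π) :
    π (genericPoint Y) ⤳ genericPoint X := by
  have h : IsGenericPoint (π (genericPoint Y)) (Set.univ : Set X) := by
    have h1 := (genericPoint_spec Y).image π.continuous
    rwa [Set.image_univ, hπ.denseRange.closure_range] at h1
  exact h.specializes trivial

/-- The composition `g ↦ g ∘ π` of a rational function with a dominant morphism. -/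
def functionFieldMap (π : Y ⟶ X) (hπ : IsDominant π) : X.functionField →+* Y.functionField :=
  (X.presheaf.stalkSpecializes (specializes_genericPoint π hπ) ≫
    π.stalkMap (genericPoint Y)).hom

theorem IsRegularOn.comp {U : X.Opens} {g : X.functionField} (hg : IsRegularOn U g) (π : Y ⟶ X)
    (hπ : IsDominant π) : IsRegularOn (π ⁻¹ᵁ U) (functionFieldMap π hπ g) := by
  obtain ⟨a, ha⟩ := hg
  refine ⟨π.app U a, fun y hy => ?_⟩
  have hy' : π y ∈ U := hy
  have hU : genericPoint X ∈ U :=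
    ((genericPoint_spec X).mem_open_set_iff U.isOpen).mpr ⟨_, trivial, hy'⟩
  have hV : genericPoint Y ∈ π ⁻¹ᵁ U :=
    ((genericPoint_spec Y).mem_open_set_iff (π ⁻¹ᵁ U).isOpen).mpr ⟨_, trivial, hy⟩
  have h1 : X.presheaf.germ U (genericPoint X) hU a = g := by
    rw [← ha (π y) hy']
    exact (congr($(X.presheaf.germ_stalkSpecializes hy'
      ((genericPoint_spec X).specializes trivial)).hom a)).symm
  have h2 : algebraMap (Y.presheaf.stalk y) Y.functionField
      (Y.presheaf.germ (π ⁻¹ᵁ U) y hy (π.app U a)) =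
      Y.presheaf.germ (π ⁻¹ᵁ U) (genericPoint Y) hV (π.app U a) :=
    congr($(Y.presheaf.germ_stalkSpecializes hy
      ((genericPoint_spec Y).specializes trivial)).hom (π.app U a))
  have h3 : X.presheaf.germ U (genericPoint X) hU ≫
      X.presheaf.stalkSpecializes (specializes_genericPoint π hπ) ≫ π.stalkMap (genericPoint Y) =
      π.app U ≫ Y.presheaf.germ (π ⁻¹ᵁ U) (genericPoint Y) hV := by
    rw [← Category.assoc, X.presheaf.germ_stalkSpecializes, Scheme.Hom.germ_stalkMap]
  rw [h2, ← h1]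
  exact (congr($(h3).hom a)).symm

/-- The pullback `(π⁻¹ (U i), f i ∘ π)` of `(U i, f i)` by a dominant morphism. -/
def CartierDivisor.pullback (D : CartierDivisor X) (π : Y ⟶ X) (hπ : IsDominant π) :
    CartierDivisor Y where
  ι := D.ι
  U i := π ⁻¹ᵁ D.U i
  f i := functionFieldMap π hπ (D.f i)
  cover y := D.cover (π y)
  ne_zero i := (map_ne_zero _).mpr (D.ne_zero i)
  compat i j := by
    have h := (D.compat i j).comp π hπ
    rwa [map_div₀] at h

end Cartier

/-! ### Global sections, multiplicities and evaluation codes -/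

section Codes

variable (k : Type u) [Field k] {X : Scheme.{u}} [IsIntegral X]
  [X.Over (Spec (CommRingCat.of k))]

/-- The space `H⁰(X, D)`: the rational functions `s` such that every `s * f i` is regular
on `U i`. -/
def globalSections (D : CartierDivisor X) : Submodule k X.functionField where
  carrier := {s | ∀ i, IsRegularOn (D.U i) (s * D.f i)}
  zero_mem' i := by
    rw [zero_mul]
    exact isRegularOn_zero _
  add_mem' {s t} hs ht i := by
    rw [add_mul]
    exact (hs i).add (ht i)
  smul_mem' c s hs i := by
    rw [Algebra.smul_def, mul_assoc]
    exact (isRegularOn_const k _ c).mul (hs i)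

/-- The rational function `g` is the germ at `p` of an element of `𝔪_p ^ n`. -/
def VanishesToOrder (p : X) (n : ℕ) (g : X.functionField) : Prop :=
  ∃ a ∈ IsLocalRing.maximalIdeal (X.presheaf.stalk p) ^ n,
    algebraMap (X.presheaf.stalk p) X.functionField a = g

/-- The global sections of `D` which have multiplicity at least `n` at `p`: the local equation
`s * f i` belongs to `𝔪_p ^ n`. -/
def sectionsOfMultiplicity (D : CartierDivisor X) (p : X) (n : ℕ) :
    Submodule k X.functionField where
  carrier := {s | s ∈ globalSections k D ∧ ∀ i, p ∈ D.U i → VanishesToOrder p n (s * D.f i)}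
  zero_mem' := ⟨zero_mem _, fun i _ => ⟨0, zero_mem _, by rw [map_zero, zero_mul]⟩⟩
  add_mem' := by
    rintro s t ⟨hs, hs'⟩ ⟨ht, ht'⟩
    refine ⟨add_mem hs ht, fun i hi => ?_⟩
    obtain ⟨a, ha, ha'⟩ := hs' i hi
    obtain ⟨b, hb, hb'⟩ := ht' i hi
    exact ⟨a + b, add_mem ha hb, by rw [map_add, ha', hb', add_mul]⟩
  smul_mem' := by
    rintro c s ⟨hs, hs'⟩
    refine ⟨Submodule.smul_mem _ c hs, fun i hi => ?_⟩
    obtain ⟨a, ha, ha'⟩ := hs' i hi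
    refine ⟨algebraMap k _ c * a, Ideal.mul_mem_left _ _ ha, ?_⟩
    rw [map_mul, ha', Algebra.smul_def, mul_assoc, algebraMap_stalk_functionField]

/-- The rational function `g` is regular at the point `x`, with value `c ∈ k` there. -/
def HasValueAt (x : X) (g : X.functionField) (c : k) : Prop :=
  ∃ a : X.presheaf.stalk x, algebraMap (X.presheaf.stalk x) X.functionField a = g ∧
    (X.residue x).hom a = algebraMap k (X.residueField x) c

variable {k} in
theorem HasValueAt.add {x : X} {g h : X.functionField} {c d : k} (hg : HasValueAt k x g c)
    (hh : HasValueAt k x h d) : HasValueAt k x (g + h) (c + d) := by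
  obtain ⟨a, ha, ha'⟩ := hg
  obtain ⟨b, hb, hb'⟩ := hh
  exact ⟨a + b, by rw [map_add, ha, hb], by rw [map_add, map_add, ha', hb']⟩

variable {k} in
theorem HasValueAt.smul {x : X} {g : X.functionField} {c : k} (d : k)
    (hg : HasValueAt k x g c) : HasValueAt k x (d • g) (d * c) := by
  obtain ⟨a, ha, ha'⟩ := hg
  refine ⟨algebraMap k _ d * a, ?_, ?_⟩
  · rw [map_mul, ha, Algebra.smul_def, algebraMap_stalk_functionField]
  · rw [map_mul, map_mul, ha']
    rfl

theorem hasValueAt_zero (x : X) : HasValueAt k x (0 : X.functionField) 0 :=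
  ⟨0, by rw [map_zero], by rw [map_zero, map_zero]⟩

/-- The words obtained by evaluating the sections in `V ⊆ H⁰(X, D)` at the rational points
`P j`: the coordinate of `s` at a point `x` is `(s * f i)(x)`, where `i` is the chosen index with
`x ∈ U i`. -/
def codeOfSections (D : CartierDivisor X) {J : Type u} (P : J → RationalPoint k X)
    (V : Submodule k X.functionField) : Submodule k (J → k) where
  carrier := {w | ∃ s ∈ V, ∀ j, HasValueAt k (P j).1 (s * D.f (D.index (P j).1)) (w j)}
  zero_mem' := ⟨0, zero_mem _, fun j => by
    rw [zero_mul]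
    exact hasValueAt_zero k _⟩
  add_mem' := by
    rintro v w ⟨s, hs, hs'⟩ ⟨t, ht, ht'⟩
    refine ⟨s + t, add_mem hs ht, fun j => ?_⟩
    rw [add_mul]
    exact (hs' j).add (ht' j)
  smul_mem' := by
    rintro c w ⟨s, hs, hs'⟩
    refine ⟨c • s, Submodule.smul_mem _ c hs, fun j => ?_⟩
    rw [smul_mul_assoc]
    exact (hs' j).smul c

/-- The evaluation code `C_X(D, P)`. -/
def evaluationCode (D : CartierDivisor X) {J : Type u} (P : J → RationalPoint k X) :
    Submodule k (J → k) :=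
  codeOfSections k D P (globalSections k D)

/-- `F` is a homogeneous component of degree `n` of `g`, a rational function which belongs to
`𝔪_p ^ n`, in the coordinates `u, v` at `p`: it is homogeneous of degree `n` and
`g ≡ F(u, v)` modulo `𝔪_p ^ (n + 1)`. -/
def IsHomogeneousComponent (p : X) (u v : X.presheaf.stalk p) (n : ℕ) (g : X.functionField)
    (F : MvPolynomial (Fin 2) k) : Prop :=
  F.IsHomogeneous n ∧ ∃ a : X.presheaf.stalk p,
    algebraMap (X.presheaf.stalk p) X.functionField a = g ∧
    a - MvPolynomial.aeval ![u, v] F ∈ IsLocalRing.maximalIdeal (X.presheaf.stalk p) ^ (n + 1)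

/-- The evaluations, at the rational points different from `p`, of the global sections `s` of `D`
of multiplicity at least `n` at `p`, to which one adds the evaluations at the points of `ℙ¹(k)` of
the homogeneous component of degree `n` of the local equation of `s` at `p`. -/
def extendedCode (D : CartierDivisor X) (p : X) (u v : X.presheaf.stalk p) (n : ℕ) :
    Submodule k ({x : RationalPoint k X // x.1 ≠ p} ⊕ Projectivization k (Fin 2 → k) → k) where
  carrier := {w | ∃ s ∈ sectionsOfMultiplicity k D p n,
    (∀ x : {x : RationalPoint k X // x.1 ≠ p},
      HasValueAt k x.1.1 (s * D.f (D.index x.1.1)) (w (Sum.inl x))) ∧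
    ∃ F : MvPolynomial (Fin 2) k,
      IsHomogeneousComponent k p u v n (s * D.f (D.index p)) F ∧
      ∀ t : Projectivization k (Fin 2 → k), w (Sum.inr t) = MvPolynomial.eval t.rep F}
  zero_mem' := by
    refine ⟨0, zero_mem _, fun x => ?_, 0, ⟨MvPolynomial.isHomogeneous_zero _ _ _, 0, ?_, ?_⟩,
      fun t => ?_⟩
    · rw [zero_mul]
      exact hasValueAt_zero k _
    · rw [map_zero, zero_mul]
    · rw [map_zero, sub_zero]
      exact zero_mem _
    · rw [map_zero]
      rfl
  add_mem' := by
    rintro w w' ⟨s, hs, hw, F, ⟨hF, a, ha, ha'⟩, hwF⟩ ⟨t, ht, hw', G, ⟨hG, b, hb, hb'⟩, hwG⟩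
    refine ⟨s + t, add_mem hs ht, fun x => ?_, F + G, ⟨hF.add hG, a + b, ?_, ?_⟩, fun t => ?_⟩
    · rw [add_mul]
      exact (hw x).add (hw' x)
    · rw [map_add, ha, hb, add_mul]
    · rw [map_add, add_sub_add_comm]
      exact add_mem ha' hb'
    · rw [Pi.add_apply, hwF, hwG, map_add]
  smul_mem' := by
    rintro c w ⟨s, hs, hw, F, ⟨hF, a, ha, ha'⟩, hwF⟩
    refine ⟨c • s, Submodule.smul_mem _ c hs, fun x => ?_, c • F,
      ⟨Submodule.smul_mem (MvPolynomial.homogeneousSubmodule _ _ n) c hF, algebraMap k _ c * a, ?_, ?_⟩,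
      fun t => ?_⟩
    · rw [smul_mul_assoc]
      exact (hw x).smul c
    · rw [map_mul, ha, algebraMap_stalk_functionField, smul_mul_assoc, Algebra.smul_def]
    · rw [map_smul, Algebra.smul_def, ← mul_sub]
      exact Ideal.mul_mem_left _ _ ha'
    · rw [Pi.smul_apply, hwF, MvPolynomial.smul_eval, smul_eq_mul]

variable {k} in
/-- Two linear codes are equivalent by means of the bijection `e` of the coordinates: they
correspond to each other up to the multiplication of each coordinate by a nonzero scalar. -/
def EquivalentVia {J J' : Type u} (e : J ≃ J') (C : Submodule k (J → k))
    (C' : Submodule k (J' → k)) : Prop :=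
  ∃ a : J → kˣ, ∀ w : J' → k, w ∈ C' ↔ (fun j => (a j : k) * w (e j)) ∈ C

end Codes

/-! ### Blowing up a closed point -/

section BlowUp

/-- The inverse image ideal sheaf by `g : T ⟶ X` of a quasi-coherent ideal sheaf of `X` is
invertible: locally it is generated by a nonzerodivisor. -/
def InverseImageInvertible {T X : Scheme.{u}} (I : X.IdealSheafData) (g : T ⟶ X) : Prop :=
  ∀ t : T, ∃ (U : X.affineOpens) (W : T.affineOpens) (h : W.1 ≤ g ⁻¹ᵁ U.1), t ∈ W.1 ∧
    ∃ a ∈ nonZeroDivisors Γ(T, W.1),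
      (I.ideal U).map (g.appLE U.1 W.1 h).hom = Ideal.span {a}

/-- The ideal sheaf of the (reduced) closed point `p`. -/
def pointIdeal {X : Scheme.{u}} (p : X) (hp : IsClosed {p}) : X.IdealSheafData :=
  Scheme.IdealSheafData.vanishingIdeal ⟨{p}, hp⟩

/-- `π : Y ⟶ X` is the blowing-up of `X` at the closed point `p`: the final object among the
schemes over `X` on which the inverse image of the ideal sheaf of `p` is invertible. -/
structure IsBlowUpAt {X Y : Scheme.{u}} (π : Y ⟶ X) (p : X) (hp : IsClosed {p}) : Prop where
  invertible : InverseImageInvertible (pointIdeal p hp) π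
  existsUnique_lift : ∀ (T : Scheme.{u}) (g : T ⟶ X),
    InverseImageInvertible (pointIdeal p hp) g → ∃! h : T ⟶ Y, h ≫ π = g

/-- The Cartier divisor `E` of `Y` is the sum of the exceptional curves of `π : Y ⟶ X` above `p`:
its local equations are regular and generate the ideal of the functions which vanish on
`π⁻¹(p)`, that is, `E` is the reduced divisor with support `π⁻¹(p)`. -/
def IsSumOfExceptionalCurves {X Y : Scheme.{u}} [IsIntegral Y] (π : Y ⟶ X) (p : X)
    (hp : IsClosed {p}) (E : CartierDivisor Y) : Prop :=
  ∀ (j : E.ι) (W : Y.affineOpens), W.1 ≤ E.U j → ∃ a : Γ(Y, W.1), Represents a (E.f j) ∧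
    (Scheme.IdealSheafData.vanishingIdeal ⟨π ⁻¹' {p}, hp.preimage π.continuous⟩).ideal W =
      Ideal.span {a}

theorem IsBlowUpAt.isDominant {X Y : Scheme.{u}} [IsIntegral X] {π : Y ⟶ X} {p : X}
    {hp : IsClosed {p}} (hπ : IsBlowUpAt π p hp) (hX : topologicalKrullDim X = 2) :
    IsDominant π := by
  have hgen : genericPoint X ≠ p := by
    intro h
    have h1 : closure {genericPoint X} = (Set.univ : Set X) := genericPoint_spec X
    rw [h, hp.closure_eq] at h1
    have : Subsingleton X := ⟨fun x y => by
      have hx : x ∈ ({p} : Set X) := h1 ▸ trivial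
      have hy : y ∈ ({p} : Set X) := h1 ▸ trivial
      rw [hx, hy]⟩
    have h2 := topologicalKrullDim_zero_of_discreteTopology X
    rw [hX] at h2
    exact absurd h2 (by decide)
  let V : X.Opens := ⟨{p}ᶜ, hp.isOpen_compl⟩
  have hV : InverseImageInvertible (pointIdeal p hp) V.ι := by
    intro t
    obtain ⟨_, ⟨U, hU', rfl⟩, htU, hUV⟩ :=
      X.isBasis_affineOpens.exists_subset_of_mem_open t.2 V.isOpen
    have hU : IsAffineOpen U := hU'
    have hW : IsAffineOpen (V.ι ⁻¹ᵁ U) := hU.preimage_of_isOpenImmersion V.ι (by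
      rw [Scheme.Opens.opensRange_ι]
      exact hUV)
    refine ⟨⟨U, hU⟩, ⟨V.ι ⁻¹ᵁ U, hW⟩, le_rfl, htU, 1, one_mem _, ?_⟩
    have h1 : (pointIdeal p hp).ideal ⟨U, hU⟩ = ⊤ := by
      have h2 : hU.fromSpec ⁻¹' {p} = ∅ := by
        ext x
        simp only [Set.mem_preimage, Set.mem_singleton_iff, Set.mem_empty_iff_false, iff_false]
        intro hx
        have h3 : hU.fromSpec x ∈ (U : Set X) := by
          rw [← hU.range_fromSpec]
          exact ⟨x, rfl⟩
        exact hUV h3 hx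
      exact (congrArg PrimeSpectrum.vanishingIdeal h2).trans PrimeSpectrum.vanishingIdeal_empty
    rw [h1, Ideal.map_top, Ideal.span_singleton_one]
  obtain ⟨h, hh, -⟩ := hπ.existsUnique_lift _ V.ι hV
  refine ⟨fun x => ?_⟩
  have hgenV : genericPoint X ∈ V := hgen
  let z : V.toScheme := ⟨genericPoint X, hgenV⟩
  have h1 : genericPoint X ∈ Set.range π :=
    ⟨h z, (Scheme.Hom.comp_apply h π z).symm.trans
      (congrArg (fun f : V.toScheme ⟶ X => f z) hh)⟩
  have h2 : closure {genericPoint X} = (Set.univ : Set X) := genericPoint_spec X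
  exact closure_mono (Set.singleton_subset_iff.mpr h1) (h2 ▸ trivial)

end BlowUp

end BlowUpCode

end

open BlowUpCode

/-!
Write `R` for the local ring of `X` at `p`, with maximal ideal `𝔪`. By the universal property, the
points of `Y` above `p` are determined by their local rings in the function field, and every local
subring which dominates `R` and in which `𝔪` becomes principal dominates one of these. In a
valuation ring dominating `R`, the ideal `𝔪` becomes principal, and an integrally closed `R` is the
intersection of the valuation rings dominating it; hence functions which are regular above `p` are
regular at `p`, and `π^* D` has the same sections as `D`.

If `𝔪 = (u, v)` is generated by a regular sequence, the local rings above `p` are localizations of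
`R[v/u]` and `R[u/v]`, where `𝓔` has the equations `u` and `v`. Since `R[v/u]/(u)` is a polynomial
ring over `R/𝔪`, an element of `R` divisible by `u ^ n` at the generic point of the exceptional
curve lies in `𝔪 ^ n`, so that the sections of `π^* D - n 𝓔` are those of `D` of multiplicity at
least `n`. Moreover `F(u, v) / u ^ n = F(1, v/u)` for a form `F` of degree `n`, while `𝔪 ^ (n + 1)`
is contained in `u ^ n (u)`: the values of such a section at the points above `p` are those of its
homogeneous component of degree `n`.
-/

namespace BlowUpCode

open IsLocalRing

/-! ### Local subrings of a field -/

section LocalSubrings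

variable {L : Type*} [Field L]

theorem isUnit_subring_iff {A : Subring L} {x : L} (hx : x ∈ A) :
    IsUnit (⟨x, hx⟩ : A) ↔ x ≠ 0 ∧ x⁻¹ ∈ A := by
  constructor
  · intro h
    obtain ⟨⟨b, hb⟩, hab⟩ := isUnit_iff_exists_inv.mp h
    have hab' : x * b = 1 := congrArg Subtype.val hab
    exact ⟨left_ne_zero_of_mul_eq_one hab', by rwa [inv_eq_of_mul_eq_one_right hab']⟩
  · rintro ⟨h0, h⟩
    exact isUnit_iff_exists_inv.mpr ⟨⟨x⁻¹, h⟩, Subtype.ext (mul_inv_cancel₀ h0)⟩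

theorem localSubring_le_iff {A B : LocalSubring L} :
    A ≤ B ↔ A.toSubring ≤ B.toSubring ∧
      ∀ x ∈ A.toSubring, x⁻¹ ∈ B.toSubring → x⁻¹ ∈ A.toSubring := by
  constructor
  · rintro ⟨hAB, hlocal⟩
    refine ⟨hAB, fun x hx hxB => ?_⟩
    rcases eq_or_ne x 0 with rfl | h0
    · rw [inv_zero]
      exact zero_mem _
    · have hunit : IsUnit (Subring.inclusion hAB ⟨x, hx⟩) :=
        (isUnit_subring_iff (hAB hx)).mpr ⟨h0, hxB⟩
      exact ((isUnit_subring_iff hx).mp (hlocal.map_nonunit _ hunit)).2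
  · rintro ⟨hAB, hinv⟩
    refine ⟨hAB, ⟨fun ⟨x, hx⟩ hunit => ?_⟩⟩
    obtain ⟨h0, hxB⟩ := (isUnit_subring_iff (hAB hx)).mp hunit
    exact (isUnit_subring_iff hx).mpr ⟨h0, hinv x hx hxB⟩

theorem coe_ne_zero_of_notMem {A : Subring L} {q : Ideal A} {s : A} (hs : s ∉ q) :
    (s : L) ≠ 0 := fun h => hs <| by
  rw [show s = 0 from Subtype.ext h]
  exact zero_mem q

section OfPrime

variable {A : Subring L} {q : Ideal A} [q.IsPrime]

theorem inv_mem_ofPrime {s : A} (hs : s ∉ q) :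
    (s : L)⁻¹ ∈ (LocalSubring.ofPrime A q).toSubring :=
  ((isUnit_subring_iff (LocalSubring.le_ofPrime A q s.2)).mp
    (IsLocalization.map_units (LocalSubring.ofPrime A q).toSubring
      (⟨s, hs⟩ : q.primeCompl))).2

theorem mem_ofPrime_iff {x : L} :
    x ∈ (LocalSubring.ofPrime A q).toSubring ↔ ∃ a s : A, s ∉ q ∧ x = a / s := by
  constructor
  · intro hx
    obtain ⟨⟨a, s⟩, h⟩ := IsLocalization.surj q.primeCompl
      (⟨x, hx⟩ : (LocalSubring.ofPrime A q).toSubring)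
    have hxs : x * (s : A) = a := congrArg Subtype.val h
    exact ⟨a, s, s.2, (eq_div_iff (coe_ne_zero_of_notMem s.2)).mpr hxs⟩
  · rintro ⟨a, s, hs, rfl⟩
    rw [div_eq_mul_inv]
    exact mul_mem (LocalSubring.le_ofPrime A q a.2) (inv_mem_ofPrime hs)

theorem inv_mem_ofPrime_iff {a : A} (h0 : a ≠ 0) :
    (a : L)⁻¹ ∈ (LocalSubring.ofPrime A q).toSubring ↔ a ∉ q := by
  refine ⟨fun h ha => ?_, inv_mem_ofPrime⟩
  obtain ⟨b, s, hs, h⟩ := mem_ofPrime_iff.mp h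
  have hs0 := coe_ne_zero_of_notMem hs
  have ha0 : (a : L) ≠ 0 := fun h => h0 (Subtype.ext h)
  rw [inv_eq_one_div, div_eq_div_iff ha0 hs0, one_mul] at h
  exact hs ((show s = b * a from Subtype.ext h) ▸ Ideal.mul_mem_left _ _ ha)

theorem ofPrime_le_of_inv_mem {O : LocalSubring L}
    (hA : A ≤ O.toSubring) (hq : ∀ s : A, s ≠ 0 → ((s : L)⁻¹ ∈ O.toSubring ↔ s ∉ q)) :
    LocalSubring.ofPrime A q ≤ O := by
  have hinv {s : A} (hs : s ∉ q) : (s : L)⁻¹ ∈ O.toSubring :=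
    (hq s fun h => hs (h ▸ zero_mem q)).mpr hs
  rw [localSubring_le_iff]
  refine ⟨fun x hx => ?_, fun x hx hxO => ?_⟩
  · obtain ⟨a, s, hs, rfl⟩ := mem_ofPrime_iff.mp hx
    rw [div_eq_mul_inv]
    exact mul_mem (hA a.2) (hinv hs)
  · obtain ⟨a, s, hs, rfl⟩ := mem_ofPrime_iff.mp hx
    rw [inv_div] at hxO ⊢
    rcases eq_or_ne a 0 with rfl | h0
    · simp
    · have haO : (a : L)⁻¹ ∈ O.toSubring := by
        have := mul_mem hxO (hinv hs)
        rwa [div_mul_eq_mul_div, mul_inv_cancel₀ (coe_ne_zero_of_notMem hs), one_div] at this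
      exact mem_ofPrime_iff.mpr ⟨s, a, (hq a h0).mp haO, rfl⟩

end OfPrime

theorem exists_ofPrime_le {A : Subring L} (O : LocalSubring L) (h : A ≤ O.toSubring) :
    ∃ (q : Ideal A) (_ : q.IsPrime), LocalSubring.ofPrime A q ≤ O ∧
      ∀ a : A, a ∈ q ↔ ¬ IsUnit (⟨a, h a.2⟩ : O.toSubring) := by
  refine ⟨(maximalIdeal O.toSubring).comap (Subring.inclusion h), inferInstance, ?_,
    fun a => Iff.rfl⟩
  refine ofPrime_le_of_inv_mem h fun s hs => ?_
  have hs0 : (s : L) ≠ 0 := fun h => hs (Subtype.ext h)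
  have hunit := isUnit_subring_iff (h s.2)
  exact ⟨fun hsO => not_not.mpr (hunit.mpr ⟨hs0, hsO⟩), fun hsq => (hunit.mp (not_not.mp hsq)).2⟩

end LocalSubrings

/-! ### Ideals which become principal in a subring of a field -/

section Generators

variable {R L : Type*} [CommRing R] [Field L]

/-- The ideal generated by the image of `I` in the subring `O` of the field `L` is generated by
the nonzero element `e`. It is phrased inside `L`, so that the subring `O` may vary. -/
structure IsGenerator (φ : R →+* L) (I : Ideal R) (O : Subring L) (e : L) : Prop where
  ne_zero : e ≠ 0
  div_mem : ∀ a ∈ I, φ a / e ∈ O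
  mem_span : e ∈ Submodule.span O (φ '' I)

variable {φ : R →+* L} {I : Ideal R} {O : Subring L} {e e' : L}

theorem span_image_span (hφ : ∀ r, φ r ∈ O) (s : Set R) :
    Submodule.span O (φ '' (Ideal.span s : Ideal R)) = Submodule.span O (φ '' s) := by
  refine le_antisymm (Submodule.span_le.mpr ?_)
    (Submodule.span_mono (Set.image_mono Ideal.subset_span))
  rintro _ ⟨a, ha, rfl⟩
  induction ha using Submodule.span_induction with
  | mem x hx => exact Submodule.subset_span (Set.mem_image_of_mem φ hx)
  | zero => simp
  | add x y _ _ hx hy =>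
    rw [map_add]
    exact add_mem hx hy
  | smul c x _ hx =>
    rw [smul_eq_mul, map_mul]
    exact Submodule.smul_mem _ (⟨φ c, hφ c⟩ : O) hx

theorem mem_span_image_span_pair (hφ : ∀ r, φ r ∈ O) {u v : R} {x : L} :
    x ∈ Submodule.span O (φ '' (Ideal.span {u, v} : Ideal R)) ↔
      ∃ a ∈ O, ∃ b ∈ O, x = a * φ u + b * φ v := by
  rw [span_image_span hφ, Set.image_pair, Submodule.mem_span_pair]
  exact ⟨fun ⟨a, b, h⟩ => ⟨a, a.2, b, b.2, h.symm⟩,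
    fun ⟨a, ha, b, hb, h⟩ => ⟨⟨a, ha⟩, ⟨b, hb⟩, h.symm⟩⟩

namespace IsGenerator

theorem div_mem_of_isGenerator (h : IsGenerator φ I O e) (h' : IsGenerator φ I O e') :
    e' / e ∈ O := by
  have hspan : ∀ x ∈ Submodule.span O (φ '' I), x / e ∈ O := by
    intro x hx
    induction hx using Submodule.span_induction with
    | mem x hx =>
      obtain ⟨a, ha, rfl⟩ := hx
      exact h.div_mem a ha
    | zero => simp
    | add x y _ _ hx hy =>
      rw [add_div]
      exact add_mem hx hy
    | smul c x _ hx =>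
      rw [Subring.smul_def, smul_eq_mul, mul_div_assoc]
      exact mul_mem c.2 hx
  exact hspan e' h'.mem_span

theorem of_div_mem (h : IsGenerator φ I O e) (h0 : e' ≠ 0) (hee' : e / e' ∈ O)
    (he'e : e' / e ∈ O) : IsGenerator φ I O e' where
  ne_zero := h0
  div_mem a ha := by
    have := mul_mem (h.div_mem a ha) hee'
    rwa [div_mul_div_cancel₀ h.ne_zero] at this
  mem_span := by
    have := Submodule.smul_mem _ (⟨_, he'e⟩ : O) h.mem_span
    rwa [Subring.smul_def, smul_eq_mul, div_mul_cancel₀ _ h.ne_zero] at this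

theorem div_pow_mem (h : IsGenerator φ I O e) (hφ : ∀ r, φ r ∈ O) (n : ℕ) :
    ∀ a ∈ I ^ n, φ a / e ^ n ∈ O := by
  induction n with
  | zero =>
    intro a _
    simpa only [pow_zero, div_one] using hφ a
  | succ n ih =>
    intro a ha
    rw [pow_succ] at ha
    refine Submodule.mul_induction_on ha (fun x hx y hy => ?_) (fun x y hx hy => ?_)
    · have := mul_mem (ih x hx) (h.div_mem y hy)
      rwa [div_mul_div_comm, ← map_mul, ← pow_succ] at this
    · rw [map_add, add_div]
      exact add_mem hx hy

end IsGenerator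

theorem isGenerator_range {S : Type*} [CommRing S] {j : S →+* L} (hj : Function.Injective j)
    (ψ : R →+* S) {a : S} (ha : a ≠ 0) (h : I.map ψ = Ideal.span {a}) :
    IsGenerator (j.comp ψ) I j.range (j a) where
  ne_zero := (map_ne_zero_iff j hj).mpr ha
  div_mem r hr := by
    have hmem : ψ r ∈ Ideal.span {a} := h ▸ Ideal.mem_map_of_mem ψ hr
    obtain ⟨c, hc⟩ := Ideal.mem_span_singleton.mp hmem
    refine ⟨c, ?_⟩
    rw [RingHom.comp_apply, hc, map_mul, mul_div_cancel_left₀ _ ((map_ne_zero_iff j hj).mpr ha)]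
  mem_span := by
    have hspan : ∀ x ∈ I.map ψ, j x ∈ Submodule.span j.range (j.comp ψ '' I) := by
      intro x hx
      induction hx using Submodule.span_induction with
      | mem x hx =>
        obtain ⟨r, hr, rfl⟩ := hx
        exact Submodule.subset_span ⟨r, hr, rfl⟩
      | zero => simp
      | add x y _ _ hx hy =>
        rw [map_add]
        exact add_mem hx hy
      | smul c x _ hx =>
        rw [smul_eq_mul, map_mul]
        exact Submodule.smul_mem _ (⟨j c, c, rfl⟩ : j.range) hx
    exact hspan a (h ▸ Ideal.mem_span_singleton_self a)

theorem exists_mem_map_of_mem_span (hφ : ∀ r, φ r ∈ O) {x : L}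
    (hx : x ∈ Submodule.span O (φ '' I)) :
    ∃ hx : x ∈ O, (⟨x, hx⟩ : O) ∈ I.map (φ.codRestrict O hφ) := by
  induction hx using Submodule.span_induction with
  | mem x hx =>
    obtain ⟨a, ha, rfl⟩ := hx
    exact ⟨hφ a, Ideal.mem_map_of_mem (φ.codRestrict O hφ) ha⟩
  | zero => exact ⟨zero_mem _, zero_mem _⟩
  | add x y _ _ hx hy =>
    obtain ⟨hx, hx'⟩ := hx
    obtain ⟨hy, hy'⟩ := hy
    exact ⟨add_mem hx hy, add_mem hx' hy'⟩
  | smul c x _ hx =>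
    obtain ⟨hx, hx'⟩ := hx
    exact ⟨mul_mem c.2 hx, Ideal.mul_mem_left _ c hx'⟩

theorem IsGenerator.mem (h : IsGenerator φ I O e) (hφ : ∀ r, φ r ∈ O) : e ∈ O :=
  (exists_mem_map_of_mem_span hφ h.mem_span).1

theorem IsGenerator.map_eq_span (h : IsGenerator φ I O e) (hφ : ∀ r, φ r ∈ O) :
    I.map (φ.codRestrict O hφ) = Ideal.span {(⟨e, h.mem hφ⟩ : O)} := by
  apply le_antisymm
  · rw [Ideal.map_le_iff_le_comap]
    intro a ha
    exact Ideal.mem_span_singleton.mpr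
      ⟨⟨_, h.div_mem a ha⟩, Subtype.ext (mul_div_cancel₀ (φ a) h.ne_zero).symm⟩
  · rw [Ideal.span_singleton_le_iff_mem]
    exact (exists_mem_map_of_mem_span hφ h.mem_span).2

theorem exists_isGenerator_valuationSubring (hφ : Function.Injective φ) (hI : I.FG) (hI0 : I ≠ ⊥)
    (V : ValuationSubring L) (hV : ∀ r, φ r ∈ V.toSubring) :
    ∃ e, IsGenerator φ I V.toSubring e := by
  let ψ : R →+* V := φ.codRestrict V hV
  have hψ : Function.Injective ψ := fun x y hxy => hφ (congrArg Subtype.val hxy)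
  obtain ⟨a, ha⟩ := IsBezout.isPrincipal_of_FG _ (hI.map ψ)
  have ha0 : a ≠ 0 := by
    rintro rfl
    exact hI0 ((Ideal.map_eq_bot_iff_of_injective hψ).mp (by simpa using ha))
  have hrange : V.subtype.range = V.toSubring := by
    ext x
    exact ⟨fun ⟨y, hy⟩ => hy ▸ y.2, fun hx => ⟨⟨x, hx⟩, rfl⟩⟩
  exact ⟨a, hrange ▸ isGenerator_range (j := V.subtype) Subtype.val_injective ψ ha0 ha⟩

end Generators

/-! ### The affine charts of the blowing-up of an ideal generated by a regular sequence -/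

section Chart

open Polynomial

theorem exists_eq_sum_of_mem_span_pair_pow {R : Type*} [CommRing R] {u v : R} {n : ℕ} {a : R}
    (ha : a ∈ Ideal.span {u, v} ^ n) :
    ∃ c : ℕ → R, a = ∑ i ∈ Finset.range (n + 1), c i * (u ^ (n - i) * v ^ i) := by
  induction n generalizing a with
  | zero => exact ⟨fun _ => a, by simp⟩
  | succ n ih =>
    rw [pow_succ, Ideal.span_insert, Ideal.mul_sup, ← Ideal.span_insert] at ha
    obtain ⟨_, hxu, _, hyv, rfl⟩ := Submodule.mem_sup.mp ha
    obtain ⟨x, hx, rfl⟩ := Ideal.mem_mul_span_singleton.mp hxu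
    obtain ⟨y, hy, rfl⟩ := Ideal.mem_mul_span_singleton.mp hyv
    obtain ⟨c, rfl⟩ := ih hx
    obtain ⟨d, rfl⟩ := ih hy
    refine ⟨fun i => (if i ≤ n then c i else 0) + (if i = 0 then 0 else d (i - 1)), ?_⟩
    simp only [add_mul, Finset.sum_add_distrib]
    congr 1
    · rw [Finset.sum_mul, Finset.sum_range_succ _ (n + 1), if_neg (by omega), zero_mul, add_zero]
      refine Finset.sum_congr rfl fun i hi => ?_
      have hin : i ≤ n := Finset.mem_range_succ_iff.mp hi
      rw [if_pos hin, Nat.succ_sub hin, pow_succ]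
      ring
    · rw [Finset.sum_mul, Finset.sum_range_succ' _ (n + 1), if_pos rfl, zero_mul, add_zero]
      refine Finset.sum_congr rfl fun i _ => ?_
      rw [if_neg i.succ_ne_zero, Nat.add_sub_cancel, Nat.add_sub_add_right]
      ring

/-- The ideal `I` is generated by the regular sequence `u, v`. -/
structure IsRegularPair {R : Type*} [CommRing R] (I : Ideal R) (u v : R) : Prop where
  span_eq : I = Ideal.span {u, v}
  isWeaklyRegular : RingTheory.Sequence.IsWeaklyRegular R [u, v]

section IsRegularPair

variable {R : Type*} [CommRing R] {I : Ideal R} {u v : R}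

theorem isWeaklyRegular_pair_iff :
    RingTheory.Sequence.IsWeaklyRegular R [u, v] ↔
      IsSMulRegular R u ∧ ∀ c, u ∣ v * c → u ∣ c := by
  rw [RingTheory.Sequence.isWeaklyRegular_cons_iff, and_congr_right_iff]
  rintro -
  rw [RingTheory.Sequence.isWeaklyRegular_singleton_iff,
    isSMulRegular_quotient_iff_mem_of_smul_mem]
  refine forall_congr' fun c => ?_
  rw [Submodule.mem_smul_pointwise_iff_exists, Submodule.mem_smul_pointwise_iff_exists]
  simp only [Submodule.mem_top, true_and, smul_eq_mul, dvd_def, eq_comm]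

namespace IsRegularPair

theorem left_mem (h : IsRegularPair I u v) : u ∈ I :=
  h.span_eq ▸ Ideal.subset_span (Set.mem_insert _ _)

theorem right_mem (h : IsRegularPair I u v) : v ∈ I :=
  h.span_eq ▸ Ideal.subset_span (Set.mem_insert_of_mem _ rfl)

theorem ne_zero [Nontrivial R] (h : IsRegularPair I u v) : u ≠ 0 := by
  rintro rfl
  exact IsSMulRegular.not_zero (isWeaklyRegular_pair_iff.mp h.isWeaklyRegular).1

theorem map_ne_zero {L : Type*} [Field L] {φ : R →+* L} (h : IsRegularPair I u v)
    (hφ : Function.Injective φ) : φ u ≠ 0 :=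
  have := φ.domain_nontrivial
  (map_ne_zero_iff φ hφ).mpr h.ne_zero

theorem dvd_of_dvd_pow_mul (h : IsRegularPair I u v) {n : ℕ} {c : R} (hc : u ∣ v ^ n * c) :
    u ∣ c := by
  induction n with
  | zero => simpa using hc
  | succ n ih =>
    rw [pow_succ', mul_assoc] at hc
    exact ih ((isWeaklyRegular_pair_iff.mp h.isWeaklyRegular).2 _ hc)

theorem symm [IsLocalRing R] [IsNoetherianRing R] (h : IsRegularPair (maximalIdeal R) u v) :
    IsRegularPair (maximalIdeal R) v u where
  span_eq := h.span_eq.trans (by rw [Set.pair_comm])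
  isWeaklyRegular := by
    refine IsLocalRing.isWeaklyRegular_of_perm_of_subset_maximalIdeal h.isWeaklyRegular
      (List.Perm.swap v u []) fun r hr => ?_
    rcases List.mem_pair.mp hr with rfl | rfl
    exacts [h.left_mem, h.right_mem]

end IsRegularPair

end IsRegularPair

variable {R L : Type*} [CommRing R] [Field L]

/-- The subring `R[v / u]` of the field `L`. -/
noncomputable def chart (φ : R →+* L) (u v : R) : Subring L :=
  (eval₂RingHom φ (φ v / φ u)).range

/-- The presentation of `R[v / u]` as a quotient of a polynomial ring over `R`. -/
noncomputable def chartHom (φ : R →+* L) (u v : R) : R[X] →+* chart φ u v :=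
  (eval₂RingHom φ (φ v / φ u)).rangeRestrict

variable {φ : R →+* L} {u v : R}

theorem coe_chartHom (P : R[X]) : (chartHom φ u v P : L) = P.eval₂ φ (φ v / φ u) := rfl

theorem chartHom_surjective : Function.Surjective (chartHom φ u v) :=
  RingHom.rangeRestrict_surjective _

theorem map_mem_chart (r : R) : φ r ∈ chart φ u v := ⟨C r, by simp⟩

theorem div_mem_chart : φ v / φ u ∈ chart φ u v := ⟨X, by simp⟩

theorem chart_le {O : Subring L} (hφO : ∀ r, φ r ∈ O) (hdiv : φ v / φ u ∈ O) :
    chart φ u v ≤ O := by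
  rintro _ ⟨P, rfl⟩
  rw [coe_eval₂RingHom, eval₂_eq_sum]
  exact sum_mem fun i _ => mul_mem (hφO _) (pow_mem hdiv _)

/-- The ideal generated by `u` in the chart `R[v / u]`. -/
noncomputable def exceptionalIdeal (φ : R →+* L) (u v : R) : Ideal (chart φ u v) :=
  Ideal.span {⟨φ u, map_mem_chart u⟩}

theorem mem_exceptionalIdeal_iff (hu : φ u ≠ 0) {a : chart φ u v} :
    a ∈ exceptionalIdeal φ u v ↔ (a : L) / φ u ∈ chart φ u v := by
  rw [exceptionalIdeal, Ideal.mem_span_singleton]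
  constructor
  · rintro ⟨c, rfl⟩
    rw [Subring.coe_mul, mul_div_cancel_left₀ _ hu]
    exact c.2
  · exact fun h => ⟨⟨_, h⟩, Subtype.ext (mul_div_cancel₀ _ hu).symm⟩

theorem map_sum_mul_pow_mul_pow (hu : φ u ≠ 0) (c : ℕ → R) (n : ℕ) :
    φ (∑ i ∈ Finset.range (n + 1), c i * (u ^ (n - i) * v ^ i)) =
      φ u ^ n * chartHom φ u v (∑ i ∈ Finset.range (n + 1), C (c i) * X ^ i) := by
  rw [coe_chartHom, eval₂_finsetSum, map_sum, Finset.mul_sum]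
  refine Finset.sum_congr rfl fun i hi => ?_
  have hin : i ≤ n := Finset.mem_range_succ_iff.mp hi
  rw [eval₂_mul, eval₂_C, eval₂_X_pow, map_mul, map_mul, map_pow, map_pow, div_pow,
    ← pow_sub_mul_pow (φ u) hin]
  field_simp

theorem isGenerator_of_div_mem {I : Ideal R} (hI : I = Ideal.span {u, v}) (hu : φ u ≠ 0)
    {O : Subring L} (hφO : ∀ r, φ r ∈ O) (hdiv : φ v / φ u ∈ O) : IsGenerator φ I O (φ u) where
  ne_zero := hu
  div_mem a ha := by
    rw [hI] at ha
    obtain ⟨x, y, rfl⟩ := Ideal.mem_span_pair.mp ha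
    have hsum : φ (x * u + y * v) / φ u = φ x + φ y * (φ v / φ u) := by
      rw [map_add, map_mul, map_mul, add_div, mul_div_cancel_right₀ _ hu, mul_div_assoc]
    rw [hsum]
    exact add_mem (hφO x) (mul_mem (hφO y) hdiv)
  mem_span := by
    rw [hI]
    exact Submodule.subset_span ⟨u, Ideal.subset_span (Set.mem_insert _ _), rfl⟩

theorem div_mem_or_div_mem_of_isGenerator {I : Ideal R} (hI : I = Ideal.span {u, v})
    {O : LocalSubring L} (hφO : ∀ r, φ r ∈ O.toSubring) {e : L}
    (he : IsGenerator φ I O.toSubring e) :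
    (φ u ≠ 0 ∧ e / φ u ∈ O.toSubring) ∨ (φ v ≠ 0 ∧ e / φ v ∈ O.toSubring) := by
  subst hI
  have hu := he.div_mem u (Ideal.subset_span (Set.mem_insert _ _))
  have hv := he.div_mem v (Ideal.subset_span (Set.mem_insert_of_mem _ rfl))
  obtain ⟨x, hx, y, hy, hxy⟩ := (mem_span_image_span_pair hφO).mp he.mem_span
  have hsum : (⟨x, hx⟩ * ⟨_, hu⟩ + ⟨y, hy⟩ * ⟨_, hv⟩ : O.toSubring) = 1 := by
    refine Subtype.ext ?_
    change x * (φ u / e) + y * (φ v / e) = 1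
    rw [← mul_div_assoc, ← mul_div_assoc, ← add_div, ← hxy, div_self he.ne_zero]
  have hunit {a : R} (ha : φ a / e ∈ O.toSubring) (h : IsUnit (⟨_, ha⟩ : O.toSubring)) :
      φ a ≠ 0 ∧ e / φ a ∈ O.toSubring := by
    obtain ⟨h0, hinv⟩ := (isUnit_subring_iff ha).mp h
    exact ⟨fun ha0 => h0 (by rw [ha0, zero_div]), inv_div (φ a) e ▸ hinv⟩
  exact (IsLocalRing.isUnit_or_isUnit_of_add_one hsum).imp
    (fun h => hunit hu (isUnit_of_mul_isUnit_right h))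
    (fun h => hunit hv (isUnit_of_mul_isUnit_right h))

theorem eq_ofPrime_of_le {I : Ideal R} (hI : I = Ideal.span {u, v})
    {q : Ideal (chart φ u v)} [q.IsPrime] {O : LocalSubring L} (hφO : ∀ r, φ r ∈ O.toSubring)
    {e : L} (he : IsGenerator φ I O.toSubring e) (hle : O ≤ LocalSubring.ofPrime _ q) :
    O = LocalSubring.ofPrime _ q := by
  obtain ⟨hsub, hinv⟩ := localSubring_le_iff.mp hle
  have hdiv : φ v / φ u ∈ O.toSubring := by
    have hu := he.div_mem u (hI ▸ Ideal.subset_span (Set.mem_insert _ _))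
    have hv := he.div_mem v (hI ▸ Ideal.subset_span (Set.mem_insert_of_mem _ rfl))
    rcases div_mem_or_div_mem_of_isGenerator hI hφO he with ⟨-, h⟩ | ⟨-, h⟩
    · simpa only [div_mul_div_cancel₀ he.ne_zero] using mul_mem hv h
    · have huv := mul_mem hu h
      rw [div_mul_div_cancel₀ he.ne_zero] at huv
      have := hinv _ huv (by
        rw [inv_div]
        exact LocalSubring.le_ofPrime _ q div_mem_chart)
      rwa [inv_div] at this
  have hchart := chart_le hφO hdiv
  refine le_antisymm hle (localSubring_le_iff.mpr ⟨fun x hx => ?_, fun x _ hx => hsub hx⟩)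
  obtain ⟨a, s, hs, rfl⟩ := mem_ofPrime_iff.mp hx
  rw [div_eq_mul_inv]
  exact mul_mem (hchart a.2) (hinv _ (hchart s.2) (inv_mem_ofPrime hs))

namespace IsRegularPair

variable {I : Ideal R}

theorem ker_chartHom_le (hφ : Function.Injective φ) (h : IsRegularPair I u v) :
    RingHom.ker (chartHom φ u v) ≤ Ideal.span {C u * X - C v} := by
  have hu0 := h.map_ne_zero hφ
  suffices H : ∀ n, ∀ P : R[X], P.natDegree ≤ n → chartHom φ u v P = 0 →
      P ∈ Ideal.span {C u * X - C v} from fun P hP => H _ P le_rfl hP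
  intro n
  induction n with
  | zero =>
    intro P hP h0
    obtain ⟨c, rfl⟩ := natDegree_eq_zero.mp (Nat.le_zero.mp hP)
    have hc : φ c = 0 := by
      simpa only [coe_chartHom, eval₂_C, ZeroMemClass.coe_zero] using congrArg Subtype.val h0
    rw [(map_eq_zero_iff φ hφ).mp hc, C_0]
    exact zero_mem _
  | succ n ih =>
    intro P hP h0
    -- Since `u` divides the leading coefficient, a multiple of `u X - v` lowers the degree.
    obtain ⟨c, hc⟩ : u ∣ P.coeff (n + 1) := by
      have hsum := map_sum_mul_pow_mul_pow (v := v) hu0 P.coeff (n + 1)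
      rw [← as_sum_range_C_mul_X_pow' _ (Nat.lt_succ_of_le hP), h0, ZeroMemClass.coe_zero,
        mul_zero, map_eq_zero_iff φ hφ, Finset.sum_range_succ, Nat.sub_self, pow_zero, one_mul,
        mul_comm (P.coeff _)] at hsum
      refine h.dvd_of_dvd_pow_mul (n := n + 1) ((dvd_add_right ?_).mp (hsum ▸ dvd_zero u))
      refine Finset.dvd_sum fun i hi => Dvd.dvd.mul_left (Dvd.dvd.mul_right ?_ _) _
      exact dvd_pow_self u (Nat.sub_ne_zero_of_lt (Finset.mem_range.mp hi))
    have hker : chartHom φ u v (C u * X - C v) = 0 := Subtype.ext <| by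
      simp [coe_chartHom, mul_div_cancel₀ _ hu0]
    have hlower := ih (P - C c * X ^ n * (C u * X - C v)) ?_ (by rw [map_sub, map_mul, hker, h0,
      mul_zero, sub_zero])
    · exact (Submodule.sub_mem_iff_left _ (Ideal.mul_mem_left _ _
        (Ideal.mem_span_singleton_self _))).mp hlower
    · rw [natDegree_le_iff_coeff_eq_zero]
      intro N hN
      rw [show P - C c * X ^ n * (C u * X - C v) =
          P - C (u * c) * X ^ (n + 1) + C (c * v) * X ^ n by simp only [C_mul]; ring,
        coeff_add, coeff_sub, coeff_C_mul_X_pow, coeff_C_mul_X_pow, if_neg hN.ne', add_zero]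
      split_ifs with hNn
      · rw [hNn, hc, sub_self]
      · rw [coeff_eq_zero_of_natDegree_lt (by omega), sub_zero]

theorem ker_chartHom_le_map_C (hφ : Function.Injective φ) (h : IsRegularPair I u v) :
    RingHom.ker (chartHom φ u v) ≤ I.map C := by
  refine (h.ker_chartHom_le hφ).trans ((Ideal.span_singleton_le_iff_mem _).mpr ?_)
  exact sub_mem (Ideal.mul_mem_right _ _ (Ideal.mem_map_of_mem C h.left_mem))
    (Ideal.mem_map_of_mem C h.right_mem)

theorem exceptionalIdeal_eq_map (hφ : Function.Injective φ) (h : IsRegularPair I u v) :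
    exceptionalIdeal φ u v = (I.map C).map (chartHom φ u v) := by
  have hcomp : (chartHom φ u v).comp C = φ.codRestrict _ map_mem_chart :=
    RingHom.ext fun r => Subtype.ext (eval₂_C _ _)
  rw [Ideal.map_map, hcomp, (isGenerator_of_div_mem h.span_eq (h.map_ne_zero hφ) map_mem_chart
    div_mem_chart).map_eq_span]
  rfl

theorem isPrime_exceptionalIdeal [I.IsPrime] (hφ : Function.Injective φ)
    (h : IsRegularPair I u v) : (exceptionalIdeal φ u v).IsPrime := by
  have : (I.map (C : R →+* R[X])).IsPrime := Ideal.isPrime_map_C_of_isPrime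
  rw [h.exceptionalIdeal_eq_map hφ]
  exact Ideal.map_isPrime_of_surjective chartHom_surjective (h.ker_chartHom_le_map_C hφ)

theorem chartHom_mem_exceptionalIdeal_iff (hφ : Function.Injective φ)
    (h : IsRegularPair I u v) {P : R[X]} :
    chartHom φ u v P ∈ exceptionalIdeal φ u v ↔ ∀ i, P.coeff i ∈ I := by
  rw [h.exceptionalIdeal_eq_map hφ, ← Ideal.mem_comap,
    Ideal.comap_map_of_surjective _ chartHom_surjective, ← RingHom.ker_eq_comap_bot,
    sup_eq_left.mpr (h.ker_chartHom_le_map_C hφ), Ideal.mem_map_C_iff]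

theorem div_mem_of_pow_div_mem [I.IsPrime] (hφ : Function.Injective φ)
    (h : IsRegularPair I u v) {q : Ideal (chart φ u v)} [q.IsPrime] {x : L}
    (hx : x ∈ (LocalSubring.ofPrime _ q).toSubring) {n : ℕ}
    (hxn : x ^ n / φ u ∈ (LocalSubring.ofPrime _ q).toSubring) :
    x / φ u ∈ (LocalSubring.ofPrime _ q).toSubring := by
  have hu0 := h.map_ne_zero hφ
  have hprime := h.isPrime_exceptionalIdeal hφ
  obtain ⟨a, s, hs, rfl⟩ := mem_ofPrime_iff.mp hx
  obtain ⟨b, t, ht, hbt⟩ := mem_ofPrime_iff.mp hxn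
  have hs0 := coe_ne_zero_of_notMem hs
  have ht0 := coe_ne_zero_of_notMem ht
  have hmem : a ^ n * t ∈ exceptionalIdeal φ u v := by
    refine Ideal.mem_span_singleton.mpr ⟨b * s ^ n, Subtype.ext ?_⟩
    push_cast
    rw [div_pow] at hbt
    field_simp at hbt
    linear_combination hbt
  rcases hprime.mem_or_mem hmem with ha | htE
  · have hdiv := (mem_exceptionalIdeal_iff hu0).mp (hprime.mem_of_pow_mem _ ha)
    exact mem_ofPrime_iff.mpr ⟨⟨_, hdiv⟩, s, hs, by rw [div_right_comm]⟩
  · have huq : (⟨φ u, map_mem_chart u⟩ : chart φ u v) ∉ q := fun hu =>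
      ht ((Ideal.span_singleton_le_iff_mem _).mpr hu htE)
    rw [div_eq_mul_inv]
    exact mul_mem hx (inv_mem_ofPrime huq)

theorem mem_pow_of_div_pow_mul_mem [I.IsPrime] (hφ : Function.Injective φ)
    (h : IsRegularPair I u v) {n : ℕ} {a : R} {s : chart φ u v}
    (hs : s ∉ exceptionalIdeal φ u v) (ha : φ a / φ u ^ n * s ∈ chart φ u v) : a ∈ I ^ n := by
  have hu0 := h.map_ne_zero hφ
  have hprime := h.isPrime_exceptionalIdeal hφ
  induction n with
  | zero => simp
  | succ n ih =>
    have hdiv : φ a / φ u ^ (n + 1) * s = φ a / φ u ^ n * s / φ u := by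
      rw [pow_succ, ← div_div, div_mul_eq_mul_div]
    rw [hdiv] at ha
    have hmul : φ a / φ u ^ n * s ∈ chart φ u v := by
      simpa only [div_mul_cancel₀ _ hu0] using mul_mem ha (map_mem_chart u)
    have haI := ih hmul
    rw [h.span_eq] at haI
    obtain ⟨c, rfl⟩ := exists_eq_sum_of_mem_span_pair_pow haI
    rw [map_sum_mul_pow_mul_pow hu0, mul_div_cancel_left₀ _ (pow_ne_zero n hu0),
      ← Subring.coe_mul, ← mem_exceptionalIdeal_iff hu0] at ha
    have hcoeff := (h.chartHom_mem_exceptionalIdeal_iff hφ).mp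
      ((hprime.mem_or_mem ha).resolve_right hs)
    refine sum_mem fun i hi => ?_
    have hin : i ≤ n := Finset.mem_range_succ_iff.mp hi
    have hci : c i ∈ I := by
      simpa only [finsetSum_coeff, coeff_C_mul_X_pow, Finset.sum_ite_eq, if_pos hi] using hcoeff i
    rw [pow_succ']
    refine Ideal.mul_mem_mul hci ?_
    rw [← pow_sub_mul_pow I hin]
    exact Ideal.mul_mem_mul (Ideal.pow_mem_pow h.left_mem _) (Ideal.pow_mem_pow h.right_mem _)

theorem exists_chart_ringHom (hφ : Function.Injective φ) (h : IsRegularPair I u v)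
    {S : Type*} [CommRing S] {ε : R →+* S} (hε : I ≤ RingHom.ker ε) (b : S) :
    ∃ χ : chart φ u v →+* S, (∀ r, χ ⟨φ r, map_mem_chart r⟩ = ε r) ∧
      χ ⟨φ v / φ u, div_mem_chart⟩ = b := by
  have hker : RingHom.ker (chartHom φ u v) ≤ RingHom.ker (eval₂RingHom ε b) := by
    refine (h.ker_chartHom_le_map_C hφ).trans (Ideal.map_le_iff_le_comap.mpr fun r hr => ?_)
    rw [Ideal.mem_comap, RingHom.mem_ker, coe_eval₂RingHom, eval₂_C]
    exact hε hr
  obtain ⟨χ, hχ⟩ : ∃ χ : chart φ u v →+* S, ∀ P, χ (chartHom φ u v P) = P.eval₂ ε b :=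
    ⟨_, RingHom.liftOfRightInverse_comp_apply _ _
      (Function.rightInverse_surjInv chartHom_surjective) ⟨eval₂RingHom ε b, hker⟩⟩
  refine ⟨χ, fun r => ?_, ?_⟩
  · rw [show (⟨φ r, _⟩ : chart φ u v) = chartHom φ u v (C r) from Subtype.ext (eval₂_C _ _).symm,
      hχ, eval₂_C]
  · rw [show (⟨φ v / φ u, _⟩ : chart φ u v) = chartHom φ u v X from
      Subtype.ext (eval₂_X _ _).symm, hχ, eval₂_X]

end IsRegularPair

end Chart

/-! ### Dimension -/

section Dimension

theorem height_eq_of_isMaximal_mvPolynomial (k : Type*) [Field k] (d : ℕ)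
    (M : Ideal (MvPolynomial (Fin d) k)) [M.IsMaximal] : M.height = d := by
  induction d with
  | zero =>
    let e := (MvPolynomial.isEmptyAlgEquiv k (Fin 0)).toRingEquiv
    have : (M.map e).IsMaximal := Ideal.map_isMaximal_of_equiv e
    rw [← e.height_map, Ideal.eq_bot_of_prime (M.map e), Ideal.height_bot, Nat.cast_zero]
  | succ d ih =>
    let e := (MvPolynomial.finSuccEquiv k d).toRingEquiv
    have : (M.map e).IsMaximal := Ideal.map_isMaximal_of_equiv e
    have : ((M.map e).comap Polynomial.C).IsMaximal :=
      Polynomial.isMaximal_comap_C_of_isJacobsonRing _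
    have : (M.map e).LiesOver ((M.map e).comap Polynomial.C) := ⟨rfl⟩
    rw [← e.height_map, Polynomial.height_eq_height_add_one ((M.map e).comap Polynomial.C), ih,
      Nat.cast_succ]

theorem exists_height_eq_of_finiteType {k A : Type*} [Field k] [CommRing A] [IsDomain A]
    {f : k →+* A} (hf : f.FiniteType) :
    ∃ d : ℕ, ∀ (M : Ideal A) [M.IsMaximal], M.height = d := by
  algebraize [f]
  obtain ⟨d, g, hg, hgi⟩ := exists_integral_inj_algHom_of_fg k A
  have : IsNoetherianRing A := Algebra.FiniteType.isNoetherianRing k A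
  algebraize [g.toRingHom]
  have : Algebra.IsIntegral (MvPolynomial (Fin d) k) A := ⟨hgi⟩
  have : FaithfulSMul (MvPolynomial (Fin d) k) A :=
    (faithfulSMul_iff_algebraMap_injective _ _).mpr hg
  refine ⟨d, fun M hM => ?_⟩
  have : (M.under (MvPolynomial (Fin d) k)).IsMaximal :=
    Ideal.isMaximal_comap_of_isIntegral_of_isMaximal M
  have hunder := height_eq_of_isMaximal_mvPolynomial k d (M.under (MvPolynomial (Fin d) k))
  apply le_antisymm
  · have hle := Order.height_le_height_apply_of_strictMono
      (PrimeSpectrum.comap (algebraMap (MvPolynomial (Fin d) k) A))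
      (fun I J hIJ => Ideal.IsIntegral.comap_lt_comap (I := I.asIdeal) (J := J.asIdeal) hIJ)
      ⟨M, inferInstance⟩
    rw [← PrimeSpectrum.height_eq_orderHeight, ← PrimeSpectrum.height_eq_orderHeight] at hle
    exact hle.trans hunder.le
  · rw [Ideal.height_eq_height_add_of_liesOver_of_hasGoingDown
      (M.under (MvPolynomial (Fin d) k)) M, hunder]
    exact le_self_add

variable {k : Type u} [Field k] {X : Scheme.{u}} [X.Over (Spec (CommRingCat.of k))] [IsIntegral X]

theorem exists_ringKrullDim_stalk_eq [LocallyOfFiniteType (X ↘ Spec (CommRingCat.of k))]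
    {U : X.Opens} (hU : IsAffineOpen U) :
    ∃ d : ℕ, ∀ x ∈ U, IsClosed {x} → ringKrullDim (X.presheaf.stalk x) = d := by
  rcases isEmpty_or_nonempty U with hempty | hne
  · exact ⟨0, fun x hx => (hempty.false ⟨x, hx⟩).elim⟩
  have hfin := (X ↘ Spec (CommRingCat.of k)).finiteType_appLE
    (isAffineOpen_top (Spec (CommRingCat.of k))) hU le_top
  obtain ⟨d, hd⟩ := exists_height_eq_of_finiteType (hfin.comp (RingHom.FiniteType.of_surjective
    (Scheme.ΓSpecIso (CommRingCat.of k)).inv.hom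
    (ConcreteCategory.bijective_of_isIso (Scheme.ΓSpecIso (CommRingCat.of k)).inv).2))
  refine ⟨d, fun x hx hxc => ?_⟩
  have := hU.isLocalization_stalk ⟨x, hx⟩
  have := hU.primeIdealOf_isMaximal_of_isClosed ⟨x, hx⟩ hxc
  let : Algebra Γ(X, U) (X.presheaf.stalk x) :=
    TopCat.Presheaf.algebra_section_stalk X.presheaf (⟨x, hx⟩ : U)
  rw [IsLocalization.AtPrime.ringKrullDim_eq_height (hU.primeIdealOf ⟨x, hx⟩).asIdeal
    (X.presheaf.stalk x), hd, WithBot.coe_natCast]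

variable (k)

theorem ringKrullDim_stalk_eq_of_isClosed [LocallyOfFiniteType (X ↘ Spec (CommRingCat.of k))]
    {x y : X} (hx : IsClosed {x}) (hy : IsClosed {y}) :
    ringKrullDim (X.presheaf.stalk x) = ringKrullDim (X.presheaf.stalk y) := by
  have : JacobsonSpace X := LocallyOfFiniteType.jacobsonSpace (X ↘ Spec (CommRingCat.of k))
  obtain ⟨U, hU, hxU, -⟩ := exists_isAffineOpen_mem_and_subset (TopologicalSpace.Opens.mem_top x)
  obtain ⟨V, hV, hyV, -⟩ := exists_isAffineOpen_mem_and_subset (TopologicalSpace.Opens.mem_top y)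
  obtain ⟨w, ⟨hwU, hwV⟩, hw⟩ := nonempty_inter_closedPoints (Z := (U ∩ V : Set X))
    (nonempty_preirreducible_inter U.isOpen V.isOpen ⟨x, hxU⟩ ⟨y, hyV⟩)
    (U.isOpen.inter V.isOpen).isLocallyClosed
  obtain ⟨d, hd⟩ := exists_ringKrullDim_stalk_eq (k := k) hU
  obtain ⟨d', hd'⟩ := exists_ringKrullDim_stalk_eq (k := k) hV
  rw [hd x hxU hx, hd' y hyV hy, ← hd w hwU hw, ← hd' w hwV hw]

theorem ringKrullDim_stalk_eq_topologicalKrullDim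
    [LocallyOfFiniteType (X ↘ Spec (CommRingCat.of k))] {p : X} (hp : IsClosed {p}) :
    ringKrullDim (X.presheaf.stalk p) = topologicalKrullDim X := by
  have : JacobsonSpace X := LocallyOfFiniteType.jacobsonSpace (X ↘ Spec (CommRingCat.of k))
  rw [topologicalKrullDim, Order.krullDim_eq_of_orderIso irreducibleSetEquivPoints,
    Order.krullDim_eq_iSup_coheight]
  apply le_antisymm
  · rw [ringKrullDim_stalk_eq_coheight]
    exact le_iSup (fun x : X => ((Order.coheight x : ℕ∞) : WithBot ℕ∞)) p
  · refine iSup_le fun x => ?_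
    obtain ⟨y, hy, hyc⟩ := nonempty_inter_closedPoints (Z := closure {x})
      (closure_nonempty_iff.mpr (Set.singleton_nonempty x)) isClosed_closure.isLocallyClosed
    rw [ringKrullDim_stalk_eq_of_isClosed k hp hyc, ringKrullDim_stalk_eq_coheight]
    exact WithBot.coe_le_coe.mpr (Order.coheight_anti (specializes_iff_mem_closure.mpr hy))

end Dimension

/-! ### Generators of the maximal ideal of a two-dimensional local ring -/

section Parameters

theorem exists_eq_pow_mul_unit {R : Type*} [CommRing R] [IsLocalRing R] [IsNoetherianRing R]
    {v : R} (hv : maximalIdeal R = Ideal.span {v}) {c : R} (hc : c ≠ 0) :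
    ∃ (n : ℕ) (w : Rˣ), c = v ^ n * w := by
  have hfin : FiniteMultiplicity v c := by
    by_contra h
    rw [FiniteMultiplicity.not_iff_forall] at h
    refine hc (Submodule.mem_bot R |>.mp ?_)
    rw [← Ideal.iInf_pow_eq_bot_of_isLocalRing _ (maximalIdeal.isMaximal R).ne_top,
      Submodule.mem_iInf]
    intro n
    rw [hv, Ideal.span_singleton_pow]
    exact Ideal.mem_span_singleton.mpr (h n)
  obtain ⟨w, hcw, hw⟩ := hfin.exists_eq_pow_mul_and_not_dvd
  rw [← Ideal.mem_span_singleton, ← hv, mem_maximalIdeal, mem_nonunits_iff, not_not] at hw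
  exact ⟨_, hw.unit, hcw⟩

theorem isNilpotent_or_isSMulRegular {R : Type*} [CommRing R] [IsLocalRing R]
    [IsNoetherianRing R] {v : R} (hv : maximalIdeal R = Ideal.span {v}) :
    IsNilpotent v ∨ IsSMulRegular R v := by
  rw [or_iff_not_imp_right, isSMulRegular_iff_right_eq_zero_of_smul]
  intro h
  push Not at h
  obtain ⟨c, hvc, hc⟩ := h
  obtain ⟨n, w, rfl⟩ := exists_eq_pow_mul_unit hv hc
  refine ⟨n + 1, ?_⟩
  rwa [smul_eq_mul, ← mul_assoc, ← pow_succ', Units.mul_left_eq_zero] at hvc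

theorem not_le_radical_span_singleton {R : Type*} [CommRing R] [IsLocalRing R]
    [IsNoetherianRing R] (hdim : 1 < ringKrullDim R) {u : R} (hu : u ∈ maximalIdeal R) :
    ¬ maximalIdeal R ≤ (Ideal.span {u}).radical := by
  intro h
  rw [← maximalIdeal_height_eq_ringKrullDim] at hdim
  refine (WithBot.coe_lt_coe.mp hdim).not_ge ?_
  refine Ideal.height_le_one_of_isPrincipal_of_mem_minimalPrimes (Ideal.span {u}) _
    ⟨⟨inferInstance, (Ideal.span_singleton_le_iff_mem _).mpr hu⟩, fun P hP _ => ?_⟩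
  exact h.trans (hP.1.radical_le_iff.mpr hP.2)

theorem isRegularPair_of_span_eq {R : Type*} [CommRing R] [IsDomain R] [IsLocalRing R]
    [IsNoetherianRing R] (hdim : 1 < ringKrullDim R) {u v : R}
    (huv : maximalIdeal R = Ideal.span {u, v}) : IsRegularPair (maximalIdeal R) u v := by
  have hu : u ∈ maximalIdeal R := huv ▸ Ideal.subset_span (Set.mem_insert _ _)
  have hv : v ∈ maximalIdeal R := huv ▸ Ideal.subset_span (Set.mem_insert_of_mem _ rfl)
  have hu0 : u ≠ 0 := by
    rintro rfl
    refine not_le_radical_span_singleton hdim hv (le_trans ?_ Ideal.le_radical)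
    rw [huv, Ideal.span_insert_zero]
  refine ⟨huv, isWeaklyRegular_pair_iff.mpr ⟨IsSMulRegular.of_ne_zero hu0, ?_⟩⟩
  have hutop : Ideal.span {u} ≠ ⊤ := fun h => hu (Ideal.span_singleton_eq_top.mp h)
  have : Nontrivial (R ⧸ Ideal.span {u}) := Ideal.Quotient.nontrivial_iff.mpr hutop
  have : IsLocalRing (R ⧸ Ideal.span {u}) :=
    .of_surjective' (Ideal.Quotient.mk _) Ideal.Quotient.mk_surjective
  have hmax : maximalIdeal (R ⧸ Ideal.span {u}) =
      Ideal.span {Ideal.Quotient.mk (Ideal.span {u}) v} := by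
    rw [← map_maximalIdeal_of_surjective (Ideal.Quotient.mk (Ideal.span {u}))
      Ideal.Quotient.mk_surjective, huv, Ideal.map_span, Set.image_pair,
      Ideal.Quotient.eq_zero_iff_mem.mpr (Ideal.mem_span_singleton_self u),
      Ideal.span_insert_zero]
  rcases isNilpotent_or_isSMulRegular hmax with ⟨n, hn⟩ | hreg
  · rw [← map_pow, Ideal.Quotient.eq_zero_iff_mem] at hn
    refine absurd ?_ (not_le_radical_span_singleton hdim hu)
    rw [huv, Ideal.span_le, Set.pair_subset_iff]
    exact ⟨Ideal.le_radical (Ideal.mem_span_singleton_self u), n, hn⟩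
  · intro c hc
    rw [← Ideal.mem_span_singleton, ← Ideal.Quotient.eq_zero_iff_mem] at hc ⊢
    exact isSMulRegular_iff_right_eq_zero_of_smul.mp hreg _ (by rwa [smul_eq_mul, ← map_mul])

theorem exists_span_eq_of_isRegularLocalRing {R : Type*} [CommRing R] [IsRegularLocalRing R]
    (hdim : ringKrullDim R = 2) : ∃ u v : R, maximalIdeal R = Ideal.span {u, v} := by
  have hrank := IsRegularLocalRing.spanFinrank_maximalIdeal (R := R)
  rw [hdim] at hrank
  have hcard := Submodule.FG.generators_ncard (maximalIdeal R).fg_of_isNoetherianRing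
  rw [show (maximalIdeal R).spanFinrank = 2 by exact_mod_cast hrank] at hcard
  obtain ⟨u, v, -, huv⟩ := Set.ncard_eq_two.mp hcard
  exact ⟨u, v, by rw [← huv]; exact (Submodule.span_generators _).symm⟩

end Parameters

/-! ### Local rings of an integral scheme in its function field -/

section LocalRings

variable {X : Scheme.{u}} [IsIntegral X]

/-- The local ring of `X` at `x`, as a subring of the function field. -/
noncomputable def localRingAt (x : X) : LocalSubring X.functionField :=
  LocalSubring.range (algebraMap (X.presheaf.stalk x) X.functionField)

theorem stalk_injective (x : X) :
    Function.Injective (algebraMap (X.presheaf.stalk x) X.functionField) :=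
  IsFractionRing.injective _ _

theorem isUnit_stalk_iff {x : X} (a : X.presheaf.stalk x) : IsUnit a ↔
    algebraMap (X.presheaf.stalk x) X.functionField a ≠ 0 ∧
      (algebraMap (X.presheaf.stalk x) X.functionField a)⁻¹ ∈ (localRingAt x).toSubring := by
  constructor
  · rintro ⟨a, rfl⟩
    refine ⟨(a.isUnit.map _).ne_zero, (↑a⁻¹ : X.presheaf.stalk x), ?_⟩
    exact eq_inv_of_mul_eq_one_left (by rw [← map_mul, Units.inv_mul, map_one])
  · rintro ⟨h0, b, hb⟩
    refine IsUnit.of_mul_eq_one b (stalk_injective x ?_)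
    rw [map_mul, hb, map_one, mul_inv_cancel₀ h0]

theorem represents_of_germ_eq {U : X.Opens} {a : Γ(X, U)} {g : X.functionField} {x : X}
    (hx : x ∈ U)
    (h : algebraMap (X.presheaf.stalk x) X.functionField (X.presheaf.germ U x hx a) = g) :
    Represents a g := by
  intro y hy
  have : Nonempty U := ⟨⟨x, hx⟩⟩
  rw [← h, Scheme.algebraMap_germ_eq_germToFunctionField,
    Scheme.algebraMap_germ_eq_germToFunctionField]

theorem Represents.eq {U : X.Opens} {a b : Γ(X, U)} {g : X.functionField} (ha : Represents a g)
    (hb : Represents b g) : a = b := by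
  rcases (U : Set X).eq_empty_or_nonempty with hU | ⟨x, hx⟩
  · obtain rfl : U = ⊥ := SetLike.coe_injective hU
    exact Subsingleton.elim _ _
  · exact germ_injective_of_isIntegral X x hx
      (stalk_injective x ((ha x hx).trans (hb x hx).symm))

theorem Represents.res {U V : X.Opens} (i : V ⟶ U) {a : Γ(X, U)} {g : X.functionField}
    (ha : Represents a g) : Represents (X.presheaf.map i.op a) g := by
  intro x hx
  rw [X.presheaf.germ_res_apply i x hx a]
  exact ha x (i.le hx)

theorem isRegularOn_iff {U : X.Opens} {g : X.functionField} :
    IsRegularOn U g ↔ ∀ x ∈ U, g ∈ (localRingAt x).toSubring := by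
  refine ⟨fun ⟨a, ha⟩ x hx => ⟨_, ha x hx⟩, fun h => ?_⟩
  have hlocal : ∀ x : U, ∃ (V : X.Opens) (_ : x.1 ∈ V) (_ : V ≤ U) (a : Γ(X, V)),
      Represents a g := by
    intro x
    obtain ⟨s, hs⟩ := h x.1 x.2
    obtain ⟨V, hxV, a, ha⟩ := X.presheaf.exists_germ_eq s
    refine ⟨V ⊓ U, ⟨hxV, x.2⟩, inf_le_right, X.presheaf.map (homOfLE inf_le_left).op a, ?_⟩
    exact (represents_of_germ_eq hxV (by rw [ha, hs])).res _
  choose V hxV hVU a ha using hlocal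
  obtain ⟨s, hs, -⟩ := X.sheaf.existsUnique_gluing' V U (fun x => homOfLE (hVU x))
    (fun x hx => TopologicalSpace.Opens.mem_iSup.mpr ⟨⟨x, hx⟩, hxV ⟨x, hx⟩⟩) a
    (fun x y => ((ha x).res _).eq ((ha y).res _))
  refine ⟨s, fun x hx => ?_⟩
  rw [← ha ⟨x, hx⟩ x (hxV ⟨x, hx⟩), ← hs ⟨x, hx⟩]
  congr 1
  exact (X.presheaf.germ_res_apply (homOfLE (hVU ⟨x, hx⟩)) x (hxV ⟨x, hx⟩) s).symm

end LocalRings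

/-! ### Vanishing ideals -/

section VanishingIdeals

variable {X : Scheme.{u}}

theorem mem_primeIdealOf_iff {U : X.Opens} (hU : IsAffineOpen U) {x : X} (hx : x ∈ U)
    (a : Γ(X, U)) : a ∈ (hU.primeIdealOf ⟨x, hx⟩).asIdeal ↔
      X.presheaf.germ U x hx a ∈ maximalIdeal (X.presheaf.stalk x) := by
  let : Algebra Γ(X, U) (X.presheaf.stalk x) :=
    TopCat.Presheaf.algebra_section_stalk X.presheaf (⟨x, hx⟩ : U)
  have : IsLocalization.AtPrime (X.presheaf.stalk x) (hU.primeIdealOf ⟨x, hx⟩).asIdeal :=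
    hU.isLocalization_stalk ⟨x, hx⟩
  exact (IsLocalization.AtPrime.to_map_mem_maximal_iff (X.presheaf.stalk x)
    (hU.primeIdealOf ⟨x, hx⟩).asIdeal a).symm

theorem mem_vanishingIdeal_iff (Z : TopologicalSpace.Closeds X) (U : X.affineOpens)
    (a : Γ(X, U.1)) : a ∈ (Scheme.IdealSheafData.vanishingIdeal Z).ideal U ↔
      ∀ (x : X) (hx : x ∈ U.1), x ∈ Z →
        X.presheaf.germ U.1 x hx a ∈ maximalIdeal (X.presheaf.stalk x) := by
  have hU : IsAffineOpen U.1 := U.2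
  refine (PrimeSpectrum.mem_vanishingIdeal _ _).trans ⟨fun h x hx hxZ => ?_, fun h y hy => ?_⟩
  · rw [← mem_primeIdealOf_iff hU hx]
    refine h _ ?_
    change hU.fromSpec (hU.primeIdealOf ⟨x, hx⟩) ∈ Z
    rwa [hU.fromSpec_primeIdealOf]
  · have hyU : hU.fromSpec y ∈ U.1 := hU.range_fromSpec.subset ⟨y, rfl⟩
    have hprime : hU.primeIdealOf ⟨hU.fromSpec y, hyU⟩ = y :=
      hU.fromSpec.isOpenEmbedding.injective (hU.fromSpec_primeIdealOf _)
    rw [← hprime]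
    exact (mem_primeIdealOf_iff hU hyU a).mpr (h _ hyU hy)

theorem map_germ_pointIdeal {p : X} (hp : IsClosed {p}) (U : X.affineOpens) (hpU : p ∈ U.1) :
    ((pointIdeal p hp).ideal U).map (X.presheaf.germ U.1 p hpU).hom =
      maximalIdeal (X.presheaf.stalk p) := by
  have hideal : (pointIdeal p hp).ideal U = (U.2.primeIdealOf ⟨p, hpU⟩).asIdeal := by
    ext a
    rw [mem_primeIdealOf_iff U.2 hpU]
    refine (mem_vanishingIdeal_iff _ U a).trans ⟨fun h => h p hpU rfl, ?_⟩
    rintro h x hx (rfl : x = p)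
    exact h
  let : Algebra Γ(X, U.1) (X.presheaf.stalk p) :=
    TopCat.Presheaf.algebra_section_stalk X.presheaf (⟨p, hpU⟩ : U.1)
  have : IsLocalization.AtPrime (X.presheaf.stalk p) (U.2.primeIdealOf ⟨p, hpU⟩).asIdeal :=
    U.2.isLocalization_stalk ⟨p, hpU⟩
  rw [hideal]
  exact IsLocalization.AtPrime.map_eq_maximalIdeal (U.2.primeIdealOf ⟨p, hpU⟩).asIdeal
    (X.presheaf.stalk p)

theorem map_germ_pointIdeal_of_ne {p x : X} (hp : IsClosed {p}) (hxp : x ≠ p) (U : X.affineOpens)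
    (hxU : x ∈ U.1) :
    ((pointIdeal p hp).ideal U).map (X.presheaf.germ U.1 x hxU).hom = ⊤ := by
  have hsupp : x ∉ (pointIdeal p hp).support := hxp
  rw [Scheme.IdealSheafData.mem_support_iff_of_mem hxU, Scheme.mem_zeroLocus_iff] at hsupp
  push Not at hsupp
  obtain ⟨a, ha, hxa⟩ := hsupp
  exact Ideal.eq_top_of_isUnit_mem _ (Ideal.mem_map_of_mem _ ha)
    ((Scheme.mem_basicOpen _ _ _ hxU).mp hxa)

theorem specMap_fromSpecStalk_appLE {S : CommRingCat.{u}} {x : X} (φ : X.presheaf.stalk x ⟶ S)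
    {U : X.Opens} (hxU : x ∈ U) (hle : ⊤ ≤ (Spec.map φ ≫ X.fromSpecStalk x) ⁻¹ᵁ U) :
    (Spec.map φ ≫ X.fromSpecStalk x).appLE U ⊤ hle =
      X.presheaf.germ U x hxU ≫ φ ≫ (Scheme.ΓSpecIso S).inv := by
  have hle' : (⊤ : (Spec S).Opens) ≤ Spec.map φ ⁻¹ᵁ X.fromSpecStalk x ⁻¹ᵁ U := hle
  have hcomp : (Spec.map φ ≫ X.fromSpecStalk x).appLE U ⊤ hle =
      (X.fromSpecStalk x).app U ≫ (Spec.map φ).appLE _ ⊤ hle' := Scheme.Hom.comp_appLE ..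
  rw [hcomp, Scheme.fromSpecStalk_app hxU, Category.assoc, Category.assoc,
    Scheme.Hom.map_appLE, Scheme.ΓSpecIso_inv_naturality, Scheme.Hom.appTop,
    Scheme.Hom.app_eq_appLE]
  rfl

theorem inverseImageInvertible_specMap (I : X.IdealSheafData) {S : CommRingCat.{u}} {x : X}
    (φ : X.presheaf.stalk x ⟶ S) (U : X.affineOpens) (hxU : x ∈ U.1) {e : S}
    (he : e ∈ nonZeroDivisors S)
    (h : ((I.ideal U).map (X.presheaf.germ U.1 x hxU).hom).map φ.hom = Ideal.span {e}) :
    InverseImageInvertible I (Spec.map φ ≫ X.fromSpecStalk x) := by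
  intro t
  have hle : (⊤ : (Spec S).Opens) ≤ (Spec.map φ ≫ X.fromSpecStalk x) ⁻¹ᵁ U.1 := by
    intro z _
    have hz : (Spec.map φ ≫ X.fromSpecStalk x) z ∈ Set.range (X.fromSpecStalk x) :=
      ⟨Spec.map φ z, by rw [Scheme.Hom.comp_apply]⟩
    rw [Scheme.range_fromSpecStalk] at hz
    exact hz.mem_open U.1.isOpen hxU
  refine ⟨U, ⟨⊤, isAffineOpen_top _⟩, hle, trivial, (Scheme.ΓSpecIso S).inv.hom e, ?_, ?_⟩
  · let f : S ≃+* Γ(Spec S, ⊤) := (Scheme.ΓSpecIso S).symm.commRingCatIsoToRingEquiv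
    exact MulEquivClass.map_nonZeroDivisors f ▸ Submonoid.mem_map_of_mem f he
  · rw [specMap_fromSpecStalk_appLE φ hxU, CommRingCat.hom_comp, CommRingCat.hom_comp,
      ← Ideal.map_map, ← Ideal.map_map, h, Ideal.map_span, Set.image_singleton]

theorem exists_affineOpens_mem (x : X) : ∃ U : X.affineOpens, x ∈ U.1 := by
  obtain ⟨U, hU, hxU, -⟩ := exists_isAffineOpen_mem_and_subset (TopologicalSpace.Opens.mem_top x)
  exact ⟨⟨U, hU⟩, hxU⟩

theorem inverseImageInvertible_of_ne {p x : X} (hp : IsClosed {p}) (hxp : x ≠ p)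
    {S : CommRingCat.{u}} (φ : X.presheaf.stalk x ⟶ S) :
    InverseImageInvertible (pointIdeal p hp) (Spec.map φ ≫ X.fromSpecStalk x) := by
  obtain ⟨U, hxU⟩ := exists_affineOpens_mem x
  refine inverseImageInvertible_specMap _ φ U hxU (one_mem _) ?_
  rw [map_germ_pointIdeal_of_ne hp hxp, Ideal.map_top, Ideal.span_singleton_one]

theorem inverseImageInvertible_of_map_eq_span {p : X} (hp : IsClosed {p}) {S : CommRingCat.{u}}
    (φ : X.presheaf.stalk p ⟶ S) {e : S} (he : e ∈ nonZeroDivisors S)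
    (h : (maximalIdeal (X.presheaf.stalk p)).map φ.hom = Ideal.span {e}) :
    InverseImageInvertible (pointIdeal p hp) (Spec.map φ ≫ X.fromSpecStalk p) := by
  obtain ⟨U, hpU⟩ := exists_affineOpens_mem p
  exact inverseImageInvertible_specMap _ φ U hpU he (by rw [map_germ_pointIdeal, h])

end VanishingIdeals

/-! ### Dominant morphisms and local rings -/

section Dominant

variable {X Y : Scheme.{u}} (π : Y ⟶ X)

/-- The map from the local ring of `X` at `x` to the local ring of `Y` at a point whose image is a
generalization of `x`. -/
noncomputable def stalkMapOfSpecializes {x : X} {y : Y} (h : π y ⤳ x) :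
    X.presheaf.stalk x ⟶ Y.presheaf.stalk y :=
  X.presheaf.stalkSpecializes h ≫ π.stalkMap y

theorem specMap_stalkMapOfSpecializes {x : X} {y : Y} (h : π y ⤳ x) :
    Spec.map (stalkMapOfSpecializes π h) ≫ X.fromSpecStalk x = Y.fromSpecStalk y ≫ π := by
  rw [stalkMapOfSpecializes, Spec.map_comp, Category.assoc,
    Scheme.SpecMap_stalkSpecializes_fromSpecStalk, Scheme.SpecMap_stalkMap_fromSpecStalk]

variable [IsIntegral X] [IsIntegral Y] (hπ : IsDominant π)

theorem algebraMap_stalkMapOfSpecializes {x : X} {y : Y} (h : π y ⤳ x) (a : X.presheaf.stalk x) :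
    algebraMap (Y.presheaf.stalk y) Y.functionField ((stalkMapOfSpecializes π h).hom a) =
      functionFieldMap π hπ (algebraMap (X.presheaf.stalk x) X.functionField a) := by
  have hcomp : stalkMapOfSpecializes π h ≫
      Y.presheaf.stalkSpecializes ((genericPoint_spec Y).specializes trivial) =
      X.presheaf.stalkSpecializes ((genericPoint_spec X).specializes trivial) ≫
      X.presheaf.stalkSpecializes (specializes_genericPoint π hπ) ≫
        π.stalkMap (genericPoint Y) := by
    rw [stalkMapOfSpecializes, Category.assoc, ← Scheme.Hom.stalkSpecializes_stalkMap,
      ← Category.assoc, ← Category.assoc, TopCat.Presheaf.stalkSpecializes_comp,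
      TopCat.Presheaf.stalkSpecializes_comp]
  exact congr($(hcomp).hom a)

theorem algebraMap_stalkMap (y : Y) (a : X.presheaf.stalk (π y)) :
    algebraMap (Y.presheaf.stalk y) Y.functionField ((π.stalkMap y).hom a) =
      functionFieldMap π hπ (algebraMap (X.presheaf.stalk (π y)) X.functionField a) := by
  rw [← algebraMap_stalkMapOfSpecializes π hπ (specializes_refl (π y)) a]
  simp [stalkMapOfSpecializes]

theorem functionFieldMap_mem {y : Y} {g : X.functionField}
    (hg : g ∈ (localRingAt (π y)).toSubring) :
    functionFieldMap π hπ g ∈ (localRingAt y).toSubring := by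
  obtain ⟨a, rfl⟩ := hg
  exact ⟨_, algebraMap_stalkMap π hπ y a⟩

end Dominant

/-! ### The points of a blowing-up -/

section BlowUpPoints

variable {X Y : Scheme.{u}} {π : Y ⟶ X} {p : X} {hp : IsClosed {p}}

theorem IsBlowUpAt.hom_ext (hπ : IsBlowUpAt π p hp) {T : Scheme.{u}} {h h' : T ⟶ Y}
    (hinv : InverseImageInvertible (pointIdeal p hp) (h' ≫ π)) (hh : h ≫ π = h' ≫ π) : h = h' :=
  (hπ.existsUnique_lift T _ hinv).unique hh rfl

theorem isLocalHom_stalkMapOfSpecializes {y : Y} {x : X} (h : π y = x) :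
    IsLocalHom (stalkMapOfSpecializes π (specializes_of_eq h)).hom := by
  subst h
  have : stalkMapOfSpecializes π (specializes_of_eq (rfl : π y = π y)) = π.stalkMap y := by
    simp [stalkMapOfSpecializes]
  rw [this]
  infer_instance

/-- The closed point of the spectrum of a local ring, as a point of the scheme `Spec R` rather than
of the topological space `PrimeSpectrum R`. -/
noncomputable def specClosedPoint (R : CommRingCat.{u}) [IsLocalRing R] : Spec R :=
  closedPoint R

theorem specMap_specClosedPoint {R S : CommRingCat.{u}} [IsLocalRing R] [IsLocalRing S]
    (f : R ⟶ S) [IsLocalHom f.hom] : Spec.map f (specClosedPoint S) = specClosedPoint R :=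
  comap_closedPoint f.hom

theorem fromSpecStalk_specClosedPoint (x : X) :
    X.fromSpecStalk x (specClosedPoint (X.presheaf.stalk x)) = x :=
  Scheme.fromSpecStalk_closedPoint

theorem exists_isLocalHom_specMap_comp_fromSpecStalk_eq {R : CommRingCat.{u}} [IsLocalRing R]
    (h : Spec R ⟶ X) : ∃ f : X.presheaf.stalk (h (specClosedPoint R)) ⟶ R, IsLocalHom f.hom ∧
      Spec.map f ≫ X.fromSpecStalk (h (specClosedPoint R)) = h :=
  ⟨Scheme.stalkClosedPointTo h, Scheme.isLocalHom_stalkClosedPointTo h,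
    Scheme.Spec_stalkClosedPointTo_fromSpecStalk h⟩

theorem IsBlowUpAt.exists_lift_fromSpecStalk (hπ : IsBlowUpAt π p hp) {x : X} (hx : x ≠ p) :
    ∃ h : Spec (X.presheaf.stalk x) ⟶ Y, h ≫ π = X.fromSpecStalk x ∧
      ∀ (y : Y) (hy : π y = x),
        Spec.map (stalkMapOfSpecializes π (specializes_of_eq hy)) ≫ h = Y.fromSpecStalk y := by
  have hinv := inverseImageInvertible_of_ne hp hx (𝟙 (X.presheaf.stalk x))
  rw [Spec.map_id, Category.id_comp] at hinv
  obtain ⟨h, hh, -⟩ := hπ.existsUnique_lift _ _ hinv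
  refine ⟨h, hh, fun y hy => hπ.hom_ext ?_ ?_⟩
  · rw [← specMap_stalkMapOfSpecializes π (specializes_of_eq hy)]
    exact inverseImageInvertible_of_ne hp hx _
  · rw [Category.assoc, hh, specMap_stalkMapOfSpecializes]

theorem IsBlowUpAt.exists_of_ne (hπ : IsBlowUpAt π p hp) {x : X} (hx : x ≠ p) :
    ∃ y : Y, π y = x ∧ (∀ y' : Y, π y' = x → y' = y) ∧
      Function.Surjective (π.stalkMap y).hom := by
  obtain ⟨h, hh, hfac⟩ := hπ.exists_lift_fromSpecStalk hx
  have hπy : π (h (specClosedPoint _)) = x := by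
    rw [← Scheme.Hom.comp_apply, hh, fromSpecStalk_specClosedPoint]
  refine ⟨h (specClosedPoint _), hπy, fun y hy => ?_, fun b => ?_⟩
  · have := isLocalHom_stalkMapOfSpecializes hy
    rw [← fromSpecStalk_specClosedPoint y, ← hfac y hy, Scheme.Hom.comp_apply,
      specMap_specClosedPoint]
  · obtain ⟨f, -, hf⟩ := exists_isLocalHom_specMap_comp_fromSpecStalk_eq h
    have hcomp : f ≫ stalkMapOfSpecializes π (specializes_of_eq hπy) = 𝟙 _ := by
      rw [← Spec.map_inj, ← cancel_mono (Y.fromSpecStalk _), Spec.map_comp, Category.assoc, hf,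
        hfac _ hπy, Spec.map_id, Category.id_comp]
    exact ⟨(X.presheaf.stalkSpecializes (specializes_of_eq hπy)).hom
      (f.hom b), congr($(hcomp).hom b)⟩

theorem IsBlowUpAt.stalkMap_surjective (hπ : IsBlowUpAt π p hp) {y : Y} (hy : π y ≠ p) :
    Function.Surjective (π.stalkMap y).hom := by
  obtain ⟨y', -, huniq, hsurj⟩ := hπ.exists_of_ne hy
  rwa [← huniq y rfl] at hsurj

section LocalEquation

variable {U : X.affineOpens} {W : Y.affineOpens} (hW : W.1 ≤ π ⁻¹ᵁ U.1) {a : Γ(Y, W.1)}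

theorem map_stalkMap_map_germ_pointIdeal
    (ha : ((pointIdeal p hp).ideal U).map (π.appLE U.1 W.1 hW).hom = Ideal.span {a})
    {y : Y} (hy : y ∈ W.1) (hyU : π y ∈ U.1) :
    (((pointIdeal p hp).ideal U).map (X.presheaf.germ U.1 (π y) hyU).hom).map
      (π.stalkMap y).hom = Ideal.span {Y.presheaf.germ W.1 y hy a} := by
  have hcomp : X.presheaf.germ U.1 (π y) hyU ≫ π.stalkMap y =
      π.appLE U.1 W.1 hW ≫ Y.presheaf.germ W.1 y hy := by
    rw [Scheme.Hom.germ_stalkMap, Scheme.Hom.appLE, Category.assoc, TopCat.Presheaf.germ_res]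
  rw [Ideal.map_map, ← CommRingCat.hom_comp, hcomp, CommRingCat.hom_comp, ← Ideal.map_map, ha,
    Ideal.map_span, Set.image_singleton]

theorem isUnit_germ_of_ne
    (ha : ((pointIdeal p hp).ideal U).map (π.appLE U.1 W.1 hW).hom = Ideal.span {a})
    {y : Y} (hy : y ∈ W.1) (hyp : π y ≠ p) :
    IsUnit (Y.presheaf.germ W.1 y hy a) := by
  have hyU : π y ∈ U.1 := hW hy
  have hspan := map_stalkMap_map_germ_pointIdeal hW ha hy hyU
  rw [map_germ_pointIdeal_of_ne hp hyp, Ideal.map_top] at hspan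
  exact Ideal.span_singleton_eq_top.mp hspan.symm

theorem map_maximalIdeal_eq_span_germ
    (ha : ((pointIdeal p hp).ideal U).map (π.appLE U.1 W.1 hW).hom = Ideal.span {a})
    {y : Y} (hy : y ∈ W.1) (hyp : π y = p) :
    (maximalIdeal (X.presheaf.stalk p)).map
      (stalkMapOfSpecializes π (specializes_of_eq hyp)).hom =
        Ideal.span {Y.presheaf.germ W.1 y hy a} := by
  subst hyp
  have hyU : π y ∈ U.1 := hW hy
  rw [← map_stalkMap_map_germ_pointIdeal hW ha hy hyU, map_germ_pointIdeal]
  simp [stalkMapOfSpecializes]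

end LocalEquation

variable [IsIntegral Y]

theorem germ_mem_nonZeroDivisors {W : Y.Opens} {a : Γ(Y, W)} (ha : a ∈ nonZeroDivisors Γ(Y, W))
    {y : Y} (hy : y ∈ W) : Y.presheaf.germ W y hy a ∈ nonZeroDivisors (Y.presheaf.stalk y) := by
  have : Nonempty W := ⟨⟨y, hy⟩⟩
  exact mem_nonZeroDivisors_of_ne_zero <|
    (map_ne_zero_iff _ (germ_injective_of_isIntegral Y y hy)).mpr (nonZeroDivisors.ne_zero ha)

theorem IsBlowUpAt.inverseImageInvertible_fromSpecStalk (hπ : IsBlowUpAt π p hp) {y : Y}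
    (hy : π y = p) : InverseImageInvertible (pointIdeal p hp) (Y.fromSpecStalk y ≫ π) := by
  obtain ⟨U, W, hW, hyW, a, ha0, ha⟩ := hπ.invertible y
  rw [← specMap_stalkMapOfSpecializes π (specializes_of_eq hy)]
  exact inverseImageInvertible_of_map_eq_span hp _ (germ_mem_nonZeroDivisors ha0 hyW)
    (map_maximalIdeal_eq_span_germ hW ha hyW hy)

theorem algebraMap_genericPoint (a : Y.functionField) :
    @algebraMap (Y.presheaf.stalk (genericPoint Y)) Y.functionField _ _
      (stalkFunctionFieldAlgebra Y (genericPoint Y)) a = a := by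
  have h : Y.presheaf.stalkSpecializes ((genericPoint_spec Y).specializes
    (trivial : genericPoint Y ∈ Set.univ)) = 𝟙 _ := Y.presheaf.stalkSpecializes_refl _
  exact congr($(h).hom a)

theorem localRingAt_le_of_specMap_comp_eq {S : LocalSubring Y.functionField}
    (h : Spec (CommRingCat.of S.toSubring) ⟶ Y)
    (hh : Spec.map (CommRingCat.ofHom S.toSubring.subtype) ≫ h =
      Y.fromSpecStalk (genericPoint Y)) :
    localRingAt (h (specClosedPoint (.of S.toSubring))) ≤ S := by
  have : IsLocalRing (CommRingCat.of S.toSubring) := S.isLocalRing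
  obtain ⟨f, hf, hfh⟩ := exists_isLocalHom_specMap_comp_fromSpecStalk_eq h
  generalize h (specClosedPoint (.of S.toSubring)) = y at f hf hfh ⊢
  have hcomp : f ≫ CommRingCat.ofHom S.toSubring.subtype = Y.presheaf.stalkSpecializes
      ((genericPoint_spec Y).specializes (trivial : y ∈ Set.univ)) := by
    rw [← Spec.map_inj, ← cancel_mono (Y.fromSpecStalk _), Spec.map_comp, Category.assoc, hfh, hh,
      Scheme.SpecMap_stalkSpecializes_fromSpecStalk]
  have hcoe : ∀ a, (f.hom a : S.toSubring) = algebraMap (Y.presheaf.stalk y) Y.functionField a :=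
    fun a => congr($(hcomp).hom a)
  refine localSubring_le_iff.mpr ⟨?_, ?_⟩
  · rintro _ ⟨a, rfl⟩
    exact hcoe a ▸ Subtype.property _
  · rintro _ ⟨a, rfl⟩ ha
    by_cases ha0 : algebraMap (Y.presheaf.stalk y) Y.functionField a = 0
    · rw [ha0, inv_zero]
      exact zero_mem _
    · refine ((isUnit_stalk_iff a).mp (isUnit_of_map_unit f.hom a ?_)).2
      exact (isUnit_subring_iff (f.hom a : S.toSubring).2).mpr (hcoe a ▸ ⟨ha0, ha⟩)

theorem exists_isLocalHom_of_localRingAt_le {y y' : Y} (h : localRingAt y ≤ localRingAt y') :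
    ∃ j : Y.presheaf.stalk y ⟶ Y.presheaf.stalk y', IsLocalHom j.hom ∧
      ∀ a, algebraMap (Y.presheaf.stalk y') Y.functionField (j.hom a) =
        algebraMap (Y.presheaf.stalk y) Y.functionField a := by
  obtain ⟨hle, hloc⟩ := h
  let E (z : Y) : Y.presheaf.stalk z ≃+* (localRingAt z).toSubring :=
    RingEquiv.ofBijective (algebraMap (Y.presheaf.stalk z) Y.functionField).rangeRestrict
      ⟨fun a b hab => stalk_injective z (congrArg Subtype.val hab),
        RingHom.rangeRestrict_surjective _⟩
  let j : Y.presheaf.stalk y →+* Y.presheaf.stalk y' :=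
    ((E y').symm : _ →+* _).comp ((Subring.inclusion hle).comp (E y : _ →+* _))
  refine ⟨CommRingCat.ofHom j, ⟨fun a ha => ?_⟩, fun a => ?_⟩
  · have hunit : IsUnit (Subring.inclusion hle (E y a)) :=
      (MulEquiv.isUnit_map (E y').symm).mp ha
    exact (MulEquiv.isUnit_map (E y)).mp (hloc.map_nonunit _ hunit)
  · exact congrArg Subtype.val ((E y').apply_symm_apply (Subring.inclusion hle (E y a)))

variable [IsIntegral X]

variable (π) in
/-- The map from the local ring of `X` at `p` to the function field of `Y`. -/
noncomputable def localToFunctionField (hd : IsDominant π) (p : X) :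
    X.presheaf.stalk p →+* Y.functionField :=
  (functionFieldMap π hd).comp (algebraMap (X.presheaf.stalk p) X.functionField)

theorem localToFunctionField_injective (hd : IsDominant π) (p : X) :
    Function.Injective (localToFunctionField π hd p) :=
  (functionFieldMap π hd).injective.comp (stalk_injective p)

theorem localToFunctionField_mem (hd : IsDominant π) {y : Y} (hy : π y = p)
    (a : X.presheaf.stalk p) :
    localToFunctionField π hd p a ∈ (localRingAt y).toSubring :=
  ⟨_, algebraMap_stalkMapOfSpecializes π hd (specializes_of_eq hy) a⟩

theorem isGenerator_germ (hd : IsDominant π) {U : X.affineOpens} {W : Y.affineOpens}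
    (hW : W.1 ≤ π ⁻¹ᵁ U.1) {a : Γ(Y, W.1)} (ha0 : a ∈ nonZeroDivisors Γ(Y, W.1))
    (ha : ((pointIdeal p hp).ideal U).map (π.appLE U.1 W.1 hW).hom = Ideal.span {a}) {y : Y}
    (hy : y ∈ W.1) (hyp : π y = p) :
    IsGenerator (localToFunctionField π hd p) (maximalIdeal (X.presheaf.stalk p))
      (localRingAt y).toSubring
      (algebraMap (Y.presheaf.stalk y) Y.functionField (Y.presheaf.germ W.1 y hy a)) := by
  have hcomp : (algebraMap (Y.presheaf.stalk y) Y.functionField).comp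
      (stalkMapOfSpecializes π (specializes_of_eq hyp)).hom = localToFunctionField π hd p :=
    RingHom.ext fun a => algebraMap_stalkMapOfSpecializes π hd (specializes_of_eq hyp) a
  rw [← hcomp]
  exact isGenerator_range (stalk_injective y) _
    (nonZeroDivisors.ne_zero (germ_mem_nonZeroDivisors ha0 hy))
    (map_maximalIdeal_eq_span_germ hW ha hy hyp)

theorem IsBlowUpAt.exists_isGenerator (hπ : IsBlowUpAt π p hp) (hd : IsDominant π) {y : Y}
    (hy : π y = p) : ∃ e, IsGenerator (localToFunctionField π hd p)
      (maximalIdeal (X.presheaf.stalk p)) (localRingAt y).toSubring e := by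
  obtain ⟨U, W, hW, hyW, a, ha0, ha⟩ := hπ.invertible y
  exact ⟨_, isGenerator_germ hd hW ha0 ha hyW hy⟩

theorem map_genericPoint (hd : IsDominant π) : π (genericPoint Y) = genericPoint X :=
  (specializes_genericPoint π hd).antisymm (genericPoint_specializes _) |>.eq

theorem IsBlowUpAt.functionFieldMap_surjective (hπ : IsBlowUpAt π p hp) (hd : IsDominant π)
    (hgen : genericPoint X ≠ p) : Function.Surjective (functionFieldMap π hd) := by
  intro b
  obtain ⟨a, rfl⟩ := hπ.stalkMap_surjective (y := genericPoint Y) (by rwa [map_genericPoint hd]) b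
  refine ⟨algebraMap _ _ a, ?_⟩
  exact (algebraMap_stalkMap π hd (genericPoint Y) a).symm.trans (algebraMap_genericPoint _)

theorem IsBlowUpAt.functionFieldMap_mem_iff (hπ : IsBlowUpAt π p hp) (hd : IsDominant π) {y : Y}
    (hy : π y ≠ p) {g : X.functionField} :
    functionFieldMap π hd g ∈ (localRingAt y).toSubring ↔ g ∈ (localRingAt (π y)).toSubring := by
  refine ⟨?_, functionFieldMap_mem π hd⟩
  rintro ⟨b, hb⟩
  obtain ⟨a, rfl⟩ := hπ.stalkMap_surjective hy b
  rw [algebraMap_stalkMap π hd] at hb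
  exact ⟨a, (functionFieldMap π hd).injective hb⟩

theorem IsBlowUpAt.exists_localRingAt_le (hπ : IsBlowUpAt π p hp) (hd : IsDominant π)
    (S : LocalSubring Y.functionField) (hS : ∀ r, localToFunctionField π hd p r ∈ S.toSubring)
    (hm : ∀ r ∈ maximalIdeal (X.presheaf.stalk p), r ≠ 0 →
      (localToFunctionField π hd p r)⁻¹ ∉ S.toSubring)
    {e : Y.functionField}
    (he : IsGenerator (localToFunctionField π hd p) (maximalIdeal (X.presheaf.stalk p))
      S.toSubring e) : ∃ y : Y, π y = p ∧ localRingAt y ≤ S := by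
  let ψ : X.presheaf.stalk p ⟶ CommRingCat.of S.toSubring :=
    CommRingCat.ofHom ((localToFunctionField π hd p).codRestrict S.toSubring hS)
  let j : CommRingCat.of S.toSubring ⟶ Y.presheaf.stalk (genericPoint Y) :=
    CommRingCat.ofHom S.toSubring.subtype
  have : IsLocalRing (CommRingCat.of S.toSubring) := S.isLocalRing
  have : IsLocalHom ψ.hom := ⟨fun r hr => by
    obtain ⟨hr0, hinv⟩ := (isUnit_subring_iff (hS r)).mp hr
    exact by_contra fun h => hm r h (fun h0 => hr0 (by rw [h0, map_zero])) hinv⟩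
  have hspan : (maximalIdeal (X.presheaf.stalk p)).map ψ.hom = Ideal.span {⟨e, he.mem hS⟩} :=
    he.map_eq_span hS
  obtain ⟨h, hh, -⟩ := hπ.existsUnique_lift _ _ <| inverseImageInvertible_of_map_eq_span hp ψ
    (mem_nonZeroDivisors_of_ne_zero fun h0 => he.ne_zero (congrArg Subtype.val h0)) hspan
  have hgenp : π (genericPoint Y) ⤳ p := map_genericPoint hd ▸ genericPoint_specializes p
  have hψj : ψ ≫ j = stalkMapOfSpecializes π hgenp := by
    ext r
    exact (algebraMap_stalkMapOfSpecializes π hd hgenp r).symm.trans (algebraMap_genericPoint _)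
  have hgen : Spec.map j ≫ h = Y.fromSpecStalk (genericPoint Y) := by
    refine hπ.hom_ext ?_ ?_
    · rw [← specMap_stalkMapOfSpecializes π hgenp, ← hψj]
      refine inverseImageInvertible_of_map_eq_span hp (ψ ≫ j) (e := e)
        (mem_nonZeroDivisors_of_ne_zero he.ne_zero) ?_
      rw [CommRingCat.hom_comp, ← Ideal.map_map, hspan, Ideal.map_span, Set.image_singleton]
      rfl
    · rw [Category.assoc, hh, ← specMap_stalkMapOfSpecializes π hgenp, ← hψj, Spec.map_comp,
        Category.assoc]
  refine ⟨h (specClosedPoint (.of S.toSubring)), ?_, localRingAt_le_of_specMap_comp_eq h hgen⟩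
  rw [← Scheme.Hom.comp_apply, hh, Scheme.Hom.comp_apply, specMap_specClosedPoint,
    fromSpecStalk_specClosedPoint]

theorem IsBlowUpAt.eq_of_localRingAt_le (hπ : IsBlowUpAt π p hp) (hd : IsDominant π) {y y' : Y}
    (hy : π y = p) (hy' : π y' = p) (h : localRingAt y ≤ localRingAt y') : y = y' := by
  obtain ⟨j, hj, halg⟩ := exists_isLocalHom_of_localRingAt_le h
  have hψ : stalkMapOfSpecializes π (specializes_of_eq hy) ≫ j =
      stalkMapOfSpecializes π (specializes_of_eq hy') := by
    ext r
    apply stalk_injective y'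
    rw [CommRingCat.comp_apply, halg, algebraMap_stalkMapOfSpecializes π hd,
      algebraMap_stalkMapOfSpecializes π hd]
  have hspec : Spec.map j ≫ Y.fromSpecStalk y = Y.fromSpecStalk y' := by
    refine hπ.hom_ext (hπ.inverseImageInvertible_fromSpecStalk hy') ?_
    rw [Category.assoc, ← specMap_stalkMapOfSpecializes π (specializes_of_eq hy),
      ← specMap_stalkMapOfSpecializes π (specializes_of_eq hy'), ← hψ, Spec.map_comp,
      Category.assoc]
  rw [← fromSpecStalk_specClosedPoint y', ← hspec, Scheme.Hom.comp_apply,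
    specMap_specClosedPoint, fromSpecStalk_specClosedPoint]

end BlowUpPoints

/-! ### The exceptional divisor -/

section Divisibility

theorem mem_radical_span_singleton_of_basicOpen_le {X : Scheme.{u}} {U : X.Opens}
    (hU : IsAffineOpen U) {a b : Γ(X, U)} (h : X.basicOpen b ≤ X.basicOpen a) :
    b ∈ (Ideal.span {a}).radical := by
  rw [← PrimeSpectrum.basicOpen_le_basicOpen_iff, ← hU.fromSpec_preimage_basicOpen,
    ← hU.fromSpec_preimage_basicOpen]
  exact hU.fromSpec.preimage_mono h

variable {X : Scheme.{u}} [IsIntegral X] {U : X.Opens} {a b : Γ(X, U)} {f g : X.functionField}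

theorem exists_represents (a : Γ(X, U)) : ∃ g, Represents a g := by
  rcases (U : Set X).eq_empty_or_nonempty with hU | ⟨x, hx⟩
  · exact ⟨0, fun x hx => (hU.le hx).elim⟩
  · exact ⟨_, represents_of_germ_eq hx rfl⟩

theorem Represents.dvd_iff (ha : Represents a f) (hb : Represents b g) (hg : g ≠ 0) :
    b ∣ a ↔ IsRegularOn U (f / g) := by
  constructor
  · rintro ⟨c, rfl⟩
    refine ⟨c, fun x hx => ?_⟩
    rw [eq_div_iff hg, ← ha x hx, ← hb x hx, ← map_mul, ← map_mul, mul_comm]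
  · rintro ⟨c, hc⟩
    refine ⟨c, ha.eq fun x hx => ?_⟩
    rw [map_mul, map_mul, hb x hx, hc x hx, mul_div_cancel₀ _ hg]

theorem Represents.mem_localRingAt (ha : Represents a f) {x : X} (hx : x ∈ U) :
    f ∈ (localRingAt x).toSubring :=
  ⟨_, ha x hx⟩

theorem Represents.mem_basicOpen_iff (ha : Represents a f) (hf : f ≠ 0) {x : X} (hx : x ∈ U) :
    x ∈ X.basicOpen a ↔ f⁻¹ ∈ (localRingAt x).toSubring := by
  rw [X.mem_basicOpen a x hx, isUnit_stalk_iff, ha x hx]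
  exact and_iff_right hf

end Divisibility

section Exceptional

variable {X Y : Scheme.{u}} [IsIntegral X] [IsIntegral Y] {π : Y ⟶ X} {p : X} {hp : IsClosed {p}}

theorem inv_localToFunctionField_notMem (hd : IsDominant π) {y : Y} (hy : π y = p)
    {r : X.presheaf.stalk p} (hr : r ∈ maximalIdeal (X.presheaf.stalk p)) (hr0 : r ≠ 0) :
    (localToFunctionField π hd p r)⁻¹ ∉ (localRingAt y).toSubring := by
  intro h
  have := isLocalHom_stalkMapOfSpecializes hy
  refine hr (isUnit_of_map_unit (stalkMapOfSpecializes π (specializes_of_eq hy)).hom r ?_)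
  rw [isUnit_stalk_iff, algebraMap_stalkMapOfSpecializes π hd (specializes_of_eq hy) r]
  exact ⟨(map_ne_zero_iff _ (localToFunctionField_injective hd p)).mpr hr0, h⟩

theorem IsBlowUpAt.localRingAt_eq_ofPrime (hπ : IsBlowUpAt π p hp) (hd : IsDominant π)
    {u v : X.presheaf.stalk p} (huv : maximalIdeal (X.presheaf.stalk p) = Ideal.span {u, v})
    (hu : localToFunctionField π hd p u ≠ 0) {y : Y} (hy : π y = p)
    (h : localToFunctionField π hd p v / localToFunctionField π hd p u ∈
      (localRingAt y).toSubring) :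
    ∃ (q : Ideal (chart (localToFunctionField π hd p) u v)) (_ : q.IsPrime),
      localRingAt y = LocalSubring.ofPrime _ q := by
  obtain ⟨q, hq, hle, -⟩ := exists_ofPrime_le (localRingAt y)
    (chart_le (localToFunctionField_mem hd hy) h)
  have hS : ∀ r, localToFunctionField π hd p r ∈ (LocalSubring.ofPrime _ q).toSubring :=
    fun r => LocalSubring.le_ofPrime _ q (map_mem_chart r)
  obtain ⟨y', hy', hle'⟩ := hπ.exists_localRingAt_le hd _ hS
    (fun r hr hr0 hinv => inv_localToFunctionField_notMem hd hy hr hr0 (hle.1 hinv))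
    (isGenerator_of_div_mem huv hu hS (LocalSubring.le_ofPrime _ q div_mem_chart))
  obtain rfl := hπ.eq_of_localRingAt_le hd hy' hy (hle'.trans hle)
  exact ⟨q, hq, le_antisymm hle' hle⟩

theorem IsBlowUpAt.div_mem_of_pow_div_mem [IsNoetherianRing (X.presheaf.stalk p)]
    (hπ : IsBlowUpAt π p hp) (hd : IsDominant π)
    {u v : X.presheaf.stalk p} (h : IsRegularPair (maximalIdeal _) u v) {y : Y} (hy : π y = p)
    {e x : Y.functionField} (he : IsGenerator (localToFunctionField π hd p)
      (maximalIdeal (X.presheaf.stalk p)) (localRingAt y).toSubring e)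
    (hx : x ∈ (localRingAt y).toSubring) {n : ℕ}
    (hxn : x ^ n / e ∈ (localRingAt y).toSubring) : x / e ∈ (localRingAt y).toSubring := by
  have hφ := localToFunctionField_injective hd p
  have hchart : ∀ {u v : X.presheaf.stalk p}, IsRegularPair (maximalIdeal _) u v →
      e / localToFunctionField π hd p u ∈ (localRingAt y).toSubring →
      x / e ∈ (localRingAt y).toSubring := by
    intro u v h heu
    have hu0 := h.map_ne_zero hφ
    have hvu := mul_mem (he.div_mem v h.right_mem) heu
    rw [div_mul_div_cancel₀ he.ne_zero] at hvu
    obtain ⟨q, hq, hO⟩ := hπ.localRingAt_eq_ofPrime hd h.span_eq hu0 hy hvu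
    have hxu : x / localToFunctionField π hd p u ∈ (localRingAt y).toSubring := by
      have hxnu := mul_mem hxn heu
      rw [div_mul_div_cancel₀ he.ne_zero] at hxnu
      rw [hO] at hx hxnu ⊢
      exact h.div_mem_of_pow_div_mem hφ hx hxnu
    simpa only [div_mul_div_cancel₀ hu0] using mul_mem hxu (he.div_mem u h.left_mem)
  rcases div_mem_or_div_mem_of_isGenerator h.span_eq (localToFunctionField_mem hd hy) he with
    ⟨-, heu⟩ | ⟨-, hev⟩
  · exact hchart h heu
  · exact hchart h.symm hev

/-- The rational function `e` is an equation at `y` of the inverse image of `p`: it generates the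
ideal generated by the maximal ideal of `p` if `y` lies above `p`, and is a unit otherwise. -/
structure IsLocalEquation (hd : IsDominant π) (p : X) (y : Y) (e : Y.functionField) : Prop where
  ne_zero : e ≠ 0
  isGenerator : π y = p → IsGenerator (localToFunctionField π hd p)
    (maximalIdeal (X.presheaf.stalk p)) (localRingAt y).toSubring e
  mem : e ∈ (localRingAt y).toSubring
  inv_mem : π y ≠ p → e⁻¹ ∈ (localRingAt y).toSubring

namespace IsLocalEquation

variable {hd : IsDominant π} {y : Y} {e e' : Y.functionField}

theorem div_mem (h : IsLocalEquation hd p y e) (h' : IsLocalEquation hd p y e') :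
    e / e' ∈ (localRingAt y).toSubring := by
  by_cases hy : π y = p
  · exact (h'.isGenerator hy).div_mem_of_isGenerator (h.isGenerator hy)
  · rw [div_eq_mul_inv]
    exact mul_mem h.mem (h'.inv_mem hy)

theorem of_div_mem (h : IsLocalEquation hd p y e) (h0 : e' ≠ 0)
    (hee' : e / e' ∈ (localRingAt y).toSubring) (he'e : e' / e ∈ (localRingAt y).toSubring) :
    IsLocalEquation hd p y e' where
  ne_zero := h0
  isGenerator hy := (h.isGenerator hy).of_div_mem h0 hee' he'e
  mem := by simpa only [div_mul_cancel₀ _ h.ne_zero] using mul_mem he'e h.mem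
  inv_mem hy := by
    simpa only [div_mul_eq_mul_div, mul_inv_cancel₀ h.ne_zero, one_div] using
      mul_mem hee' (h.inv_mem hy)

theorem one (hy : π y ≠ p) : IsLocalEquation hd p y 1 where
  ne_zero := one_ne_zero
  isGenerator h := absurd h hy
  mem := one_mem _
  inv_mem _ := by
    rw [inv_one]
    exact one_mem _

theorem of_isGenerator (hy : π y = p) (he : IsGenerator (localToFunctionField π hd p)
    (maximalIdeal (X.presheaf.stalk p)) (localRingAt y).toSubring e) :
    IsLocalEquation hd p y e where
  ne_zero := he.ne_zero
  isGenerator _ := he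
  mem := he.mem (localToFunctionField_mem hd hy)
  inv_mem h := absurd hy h

theorem inv_mem_iff (h : IsLocalEquation hd p y e) :
    e⁻¹ ∈ (localRingAt y).toSubring ↔ π y ≠ p := by
  refine ⟨fun he hy => ?_, h.inv_mem⟩
  have hφ := localToFunctionField_mem hd hy
  obtain ⟨he', hmem⟩ := exists_mem_map_of_mem_span hφ (h.isGenerator hy).mem_span
  have hle : (maximalIdeal (X.presheaf.stalk p)).map
      ((localToFunctionField π hd p).codRestrict _ hφ) ≤
      maximalIdeal (localRingAt y).toSubring := by
    rw [Ideal.map_le_iff_le_comap]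
    intro r hr hu
    obtain ⟨hr0, hinv⟩ := (isUnit_subring_iff (hφ r)).mp hu
    refine inv_localToFunctionField_notMem hd hy hr (fun h0 => hr0 ?_) hinv
    rw [h0, map_zero]
  exact hle hmem ((isUnit_subring_iff he').mpr ⟨h.ne_zero, he⟩)

end IsLocalEquation

theorem IsBlowUpAt.exists_isLocalEquation (hπ : IsBlowUpAt π p hp) (hd : IsDominant π) (y : Y) :
    ∃ (W : Y.Opens) (_ : y ∈ W) (e : Y.functionField), ∀ y' ∈ W, IsLocalEquation hd p y' e := by
  obtain ⟨U, W, hW, hyW, a, ha0, ha⟩ := hπ.invertible y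
  have hne : Nonempty W.1 := ⟨⟨y, hyW⟩⟩
  obtain ⟨e, he⟩ := exists_represents a
  refine ⟨W.1, hyW, e, fun y' hy' => ⟨?_, fun h => ?_, he.mem_localRingAt hy', fun h => ?_⟩⟩
  · rw [← he y hyW, map_ne_zero_iff _ (stalk_injective y),
      map_ne_zero_iff _ (germ_injective_of_isIntegral Y y hyW)]
    exact nonZeroDivisors.ne_zero ha0
  · rw [← he y' hy']
    exact isGenerator_germ hd hW ha0 ha hy' h
  · rw [← he y' hy']
    exact ((isUnit_stalk_iff _).mp (isUnit_germ_of_ne hW ha hy' h)).2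

theorem IsBlowUpAt.vanishingIdeal_eq_span [IsNoetherianRing (X.presheaf.stalk p)]
    (hπ : IsBlowUpAt π p hp) (hd : IsDominant π)
    {u v : X.presheaf.stalk p} (h : IsRegularPair (maximalIdeal _) u v)
    (W : Y.affineOpens) {a : Γ(Y, W.1)} {e : Y.functionField} (ha : Represents a e) (he0 : e ≠ 0)
    (he : ∀ y ∈ W.1, IsLocalEquation hd p y e) :
    (Scheme.IdealSheafData.vanishingIdeal ⟨π ⁻¹' {p}, hp.preimage π.continuous⟩).ideal W =
      Ideal.span {a} := by
  have hmem : ∀ y ∈ W.1, (y ∈ Y.basicOpen a ↔ π y ≠ p) := fun y hy =>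
    (ha.mem_basicOpen_iff he0 hy).trans (he y hy).inv_mem_iff
  refine le_antisymm (fun b hb => ?_) ?_
  · rw [mem_vanishingIdeal_iff] at hb
    obtain ⟨n, hn⟩ := mem_radical_span_singleton_of_basicOpen_le W.2 (a := a) (b := b)
      fun y hyb => by
        have hy := Y.basicOpen_le b hyb
        exact (hmem y hy).mpr fun hyp => hb y hy hyp ((Y.mem_basicOpen b y hy).mp hyb)
    obtain ⟨g, hg⟩ := exists_represents b
    have hgn : Represents (b ^ n) (g ^ n) := fun y hy => by rw [map_pow, map_pow, hg y hy]
    have hreg := isRegularOn_iff.mp <|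
      (hgn.dvd_iff ha he0).mp (Ideal.mem_span_singleton.mp hn)
    refine Ideal.mem_span_singleton.mpr ((hg.dvd_iff ha he0).mpr ?_)
    rw [isRegularOn_iff]
    intro y hy
    by_cases hyp : π y = p
    · exact hπ.div_mem_of_pow_div_mem hd h hyp ((he y hy).isGenerator hyp)
        (hg.mem_localRingAt hy) (hreg y hy)
    · rw [div_eq_mul_inv]
      exact mul_mem (hg.mem_localRingAt hy) ((he y hy).inv_mem hyp)
  · rw [Ideal.span_singleton_le_iff_mem, mem_vanishingIdeal_iff]
    exact fun y hy hyp hunit => (hmem y hy).mp ((Y.mem_basicOpen a y hy).mpr hunit) hyp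

theorem IsBlowUpAt.exists_isSumOfExceptionalCurves [IsNoetherianRing (X.presheaf.stalk p)]
    (hπ : IsBlowUpAt π p hp) (hd : IsDominant π)
    {u v : X.presheaf.stalk p} (h : IsRegularPair (maximalIdeal _) u v) :
    ∃ E : CartierDivisor Y, IsSumOfExceptionalCurves π p hp E := by
  choose W hW e he using hπ.exists_isLocalEquation hd
  refine ⟨⟨Y, W, e, fun y => ⟨y, hW y⟩, fun y => (he y y (hW y)).ne_zero, fun y z => ?_⟩, ?_⟩
  · rw [isRegularOn_iff]
    exact fun x hx => (he y x hx.1).div_mem (he z x hx.2)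
  · intro y V hV
    obtain ⟨a, ha⟩ : IsRegularOn V.1 (e y) :=
      isRegularOn_iff.mpr fun x hx => (he y x (hV hx)).mem
    exact ⟨a, ha, hπ.vanishingIdeal_eq_span hd h V ha (he y y (hW y)).ne_zero
      fun x hx => he y x (hV hx)⟩

theorem IsBlowUpAt.isLocalEquation [IsNoetherianRing (X.presheaf.stalk p)]
    (hπ : IsBlowUpAt π p hp) (hd : IsDominant π)
    {u v : X.presheaf.stalk p} (h : IsRegularPair (maximalIdeal _) u v)
    {E : CartierDivisor Y} (hE : IsSumOfExceptionalCurves π p hp E) {j : E.ι} {y : Y}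
    (hy : y ∈ E.U j) : IsLocalEquation hd p y (E.f j) := by
  obtain ⟨W, hyW, e, he⟩ := hπ.exists_isLocalEquation hd y
  have he0 := (he y hyW).ne_zero
  obtain ⟨_, ⟨V, hV, rfl⟩, hyV, hVW⟩ :=
    Y.isBasis_affineOpens.exists_subset_of_mem_open (show y ∈ W ⊓ E.U j from ⟨hyW, hy⟩)
      (W ⊓ E.U j).isOpen
  have hVW' : V ≤ W := fun x hx => (hVW hx).1
  obtain ⟨a, ha, haE⟩ := hE j ⟨V, hV⟩ fun x hx => (hVW hx).2
  obtain ⟨b, hb⟩ : IsRegularOn V e := isRegularOn_iff.mpr fun x hx => (he x (hVW' hx)).mem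
  have hspan : Ideal.span {b} = Ideal.span {a} :=
    (hπ.vanishingIdeal_eq_span hd h ⟨V, hV⟩ hb he0 fun x hx => he x (hVW' hx)).symm.trans haE
  have hab : a ∣ b := Ideal.span_singleton_le_span_singleton.mp hspan.le
  have hba : b ∣ a := Ideal.span_singleton_le_span_singleton.mp hspan.ge
  exact (he y hyW).of_div_mem (E.ne_zero j)
    (isRegularOn_iff.mp ((hb.dvd_iff ha (E.ne_zero j)).mp hab) y hyV)
    (isRegularOn_iff.mp ((ha.dvd_iff hb he0).mp hba) y hyV)

end Exceptional

/-! ### Regular functions above a point -/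

theorem isIntegrallyClosedIn_range_algebraMap (A L : Type*) [CommRing A] [Field L] [Algebra A L]
    [IsFractionRing A L] [IsIntegrallyClosed A] :
    IsIntegrallyClosedIn (algebraMap A L).range L := by
  rw [Subring.isIntegrallyClosedIn_iff]
  intro x hx
  let : Algebra A (algebraMap A L).range := (algebraMap A L).rangeRestrict.toAlgebra
  have : IsScalarTower A (algebraMap A L).range L := .of_algebraMap_eq fun _ => rfl
  have : Algebra.IsIntegral A (algebraMap A L).range :=
    ⟨(algebraMap A L).rangeRestrict.isIntegral_of_surjective
      (algebraMap A L).rangeRestrict_surjective⟩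
  exact IsIntegrallyClosed.isIntegral_iff.mp (isIntegral_trans x hx)

section Sections

variable {X Y : Scheme.{u}} [IsIntegral X] [IsIntegral Y] {π : Y ⟶ X} {p : X} {hp : IsClosed {p}}

theorem IsBlowUpAt.isIntegrallyClosedIn_range (hπ : IsBlowUpAt π p hp) (hd : IsDominant π)
    (hgen : genericPoint X ≠ p) [IsIntegrallyClosed (X.presheaf.stalk p)] :
    IsIntegrallyClosedIn (localToFunctionField π hd p).range Y.functionField := by
  algebraize [localToFunctionField π hd p]
  let f : X.functionField →ₐ[X.presheaf.stalk p] Y.functionField :=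
    { functionFieldMap π hd with commutes' := fun _ => rfl }
  have hf : Function.Bijective f :=
    ⟨(functionFieldMap π hd).injective, hπ.functionFieldMap_surjective hd hgen⟩
  have : IsFractionRing (X.presheaf.stalk p) Y.functionField :=
    IsLocalization.isLocalization_of_algEquiv _ (AlgEquiv.ofBijective f hf)
  exact isIntegrallyClosedIn_range_algebraMap _ _

/-- A function which is not regular at `p` is not in some valuation ring dominating the local ring
of `p`, and a valuation ring dominates a local ring of the blowing-up. -/
theorem IsBlowUpAt.mem_localRingAt_of_forall (hπ : IsBlowUpAt π p hp) (hd : IsDominant π)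
    (hgen : genericPoint X ≠ p) [IsNoetherianRing (X.presheaf.stalk p)]
    [IsIntegrallyClosed (X.presheaf.stalk p)] (hm : maximalIdeal (X.presheaf.stalk p) ≠ ⊥)
    {g : X.functionField}
    (h : ∀ y, π y = p → functionFieldMap π hd g ∈ (localRingAt y).toSubring) :
    g ∈ (localRingAt p).toSubring := by
  have hφ := localToFunctionField_injective hd p
  let R := LocalSubring.range (localToFunctionField π hd p)
  have hR : ∀ r, localToFunctionField π hd p r ∈ R.toSubring := fun r => ⟨r, rfl⟩
  have hclosed : IsIntegrallyClosedIn R.toSubring Y.functionField :=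
    hπ.isIntegrallyClosedIn_range hd hgen
  by_contra hg
  have hgR : functionFieldMap π hd g ∉ R.toSubring := by
    rintro ⟨r, hr⟩
    exact hg ⟨r, (functionFieldMap π hd).injective hr⟩
  obtain ⟨V, hV, hgV⟩ := LocalSubring.exists_le_valuationSubring_of_isIntegrallyClosedIn hgR
  obtain ⟨e, he⟩ := exists_isGenerator_valuationSubring hφ
    (maximalIdeal (X.presheaf.stalk p)).fg_of_isNoetherianRing hm V fun r => hV.1 (hR r)
  have hdom : ∀ r ∈ maximalIdeal (X.presheaf.stalk p), r ≠ 0 →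
      (localToFunctionField π hd p r)⁻¹ ∉ V.toLocalSubring.toSubring := by
    intro r hr hr0 hinv
    obtain ⟨s, hs⟩ := (localSubring_le_iff.mp hV).2 _ (hR r) hinv
    refine hr (.of_mul_eq_one s (hφ ?_))
    rw [map_mul, hs, map_one, mul_inv_cancel₀ ((map_ne_zero_iff _ hφ).mpr hr0)]
  obtain ⟨y, hy, hle⟩ :=
    hπ.exists_localRingAt_le hd V.toLocalSubring (fun r => hV.1 (hR r)) hdom he
  exact hgV (hle.1 (h y hy))

theorem IsBlowUpAt.exists_localRingAt_eq_ofPrime (hπ : IsBlowUpAt π p hp) (hd : IsDominant π)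
    {u v : X.presheaf.stalk p} (huv : maximalIdeal (X.presheaf.stalk p) = Ideal.span {u, v})
    (hu : localToFunctionField π hd p u ≠ 0)
    (q : Ideal (chart (localToFunctionField π hd p) u v)) [q.IsPrime]
    (hq : exceptionalIdeal (localToFunctionField π hd p) u v ≤ q) :
    ∃ y, π y = p ∧ localRingAt y = .ofPrime _ q := by
  have hle := LocalSubring.le_ofPrime _ q
  have hS := fun r => hle (map_mem_chart (φ := localToFunctionField π hd p) r)
  have hdom : ∀ r ∈ maximalIdeal (X.presheaf.stalk p), r ≠ 0 →
      (localToFunctionField π hd p r)⁻¹ ∉ (LocalSubring.ofPrime _ q).toSubring := by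
    intro r hr hr0 hinv
    have hr0' := (map_ne_zero_iff _ (localToFunctionField_injective hd p)).mpr hr0
    refine (inv_mem_ofPrime_iff (a := ⟨_, map_mem_chart r⟩)
      fun h0 => hr0' (congrArg Subtype.val h0)).mp hinv (hq ((mem_exceptionalIdeal_iff hu).mpr ?_))
    exact (isGenerator_of_div_mem huv hu map_mem_chart div_mem_chart).div_mem r hr
  obtain ⟨y, hy, hyq⟩ := hπ.exists_localRingAt_le hd _ hS hdom
    (isGenerator_of_div_mem huv hu hS (hle div_mem_chart))
  obtain ⟨e, he⟩ := hπ.exists_isGenerator hd hy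
  exact ⟨y, hy, eq_ofPrime_of_le huv (localToFunctionField_mem hd hy) he hyq⟩

theorem IsBlowUpAt.vanishesToOrder_iff (hπ : IsBlowUpAt π p hp) (hd : IsDominant π)
    (hgen : genericPoint X ≠ p) [IsNoetherianRing (X.presheaf.stalk p)]
    [IsIntegrallyClosed (X.presheaf.stalk p)]
    {u v : X.presheaf.stalk p} (h : IsRegularPair (maximalIdeal _) u v) {n : ℕ}
    {g : X.functionField} :
    VanishesToOrder p n g ↔ ∀ y, π y = p → ∀ e, IsGenerator (localToFunctionField π hd p)
      (maximalIdeal (X.presheaf.stalk p)) (localRingAt y).toSubring e →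
        functionFieldMap π hd g / e ^ n ∈ (localRingAt y).toSubring := by
  have hφ := localToFunctionField_injective hd p
  constructor
  · rintro ⟨a, ha, rfl⟩ y hy e he
    exact he.div_pow_mem (localToFunctionField_mem hd hy) n a ha
  · intro hdiv
    have hm : maximalIdeal (X.presheaf.stalk p) ≠ ⊥ :=
      (Submodule.ne_bot_iff _).mpr ⟨u, h.left_mem, h.ne_zero⟩
    obtain ⟨a, rfl⟩ := hπ.mem_localRingAt_of_forall hd hgen hm (g := g) fun y hy => by
      obtain ⟨e, he⟩ := hπ.exists_isGenerator hd hy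
      simpa only [div_mul_cancel₀ _ (pow_ne_zero n he.ne_zero)] using
        mul_mem (hdiv y hy e he) (pow_mem (he.mem (localToFunctionField_mem hd hy)) n)
    refine ⟨a, ?_, rfl⟩
    have hprime := h.isPrime_exceptionalIdeal hφ
    obtain ⟨y, hy, hyq⟩ := hπ.exists_localRingAt_eq_ofPrime hd h.span_eq (h.map_ne_zero hφ) _ le_rfl
    obtain ⟨e, he⟩ := hπ.exists_isGenerator hd hy
    have hgenu := isGenerator_of_div_mem h.span_eq (h.map_ne_zero hφ)
      (localToFunctionField_mem hd hy) (hyq ▸ LocalSubring.le_ofPrime _ _ div_mem_chart)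
    have hmem := mul_mem (hdiv y hy e he) (pow_mem (hgenu.div_mem_of_isGenerator he) n)
    rw [hyq, div_pow, div_mul_div_cancel₀ (pow_ne_zero n he.ne_zero)] at hmem
    obtain ⟨x, s, hs, hxs⟩ := mem_ofPrime_iff.mp hmem
    refine h.mem_pow_of_div_pow_mul_mem hφ hs ?_
    have hxs' : localToFunctionField π hd p a / localToFunctionField π hd p u ^ n = x / s := hxs
    rw [hxs', div_mul_cancel₀ _ (coe_ne_zero_of_notMem hs)]
    exact x.2

end Sections

/-! ### Values at points -/

section Values

variable {k : Type u} [Field k] {X : Scheme.{u}} [X.Over (Spec (CommRingCat.of k))] {x : X}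
  {c d : k}

theorem residue_eq_algebraMap_iff (a : X.presheaf.stalk x) :
    (X.residue x).hom a = algebraMap k (X.residueField x) c ↔
      a - algebraMap k (X.presheaf.stalk x) c ∈ maximalIdeal (X.presheaf.stalk x) := by
  rw [← residue_eq_zero_iff, map_sub, sub_eq_zero]
  rfl

theorem bijective_algebraMap_residueField_iff :
    Function.Bijective (algebraMap k (X.residueField x)) ↔ ∀ a : X.presheaf.stalk x,
      ∃ c : k, a - algebraMap k (X.presheaf.stalk x) c ∈ maximalIdeal (X.presheaf.stalk x) := by
  simp only [← residue_eq_algebraMap_iff]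
  refine ⟨fun h a => (h.2 _).imp fun _ => Eq.symm,
    fun h => ⟨(algebraMap k _).injective, fun b => ?_⟩⟩
  obtain ⟨a, rfl⟩ := residue_surjective b
  exact (h a).imp fun _ => Eq.symm

theorem degree_eq_one_iff :
    degree k X x = 1 ↔ Function.Bijective (algebraMap k (X.residueField x)) := by
  refine ⟨fun h => ⟨(algebraMap k _).injective, Algebra.surjective_algebraMap_iff.mpr
    (Subalgebra.bot_eq_top_of_finrank_eq_one h).symm⟩, fun h => ?_⟩
  exact (LinearEquiv.ofBijective (Algebra.linearMap k _) h).finrank_eq.symm.trans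
    (Module.finrank_self k)

variable [IsIntegral X] {g h f f' : X.functionField}

theorem hasValueAt_algebraMap_stalk_iff (a : X.presheaf.stalk x) :
    HasValueAt k x (algebraMap _ X.functionField a) c ↔
      a - algebraMap k (X.presheaf.stalk x) c ∈ maximalIdeal (X.presheaf.stalk x) := by
  rw [← residue_eq_algebraMap_iff]
  refine ⟨?_, fun ha => ⟨a, rfl, ha⟩⟩
  rintro ⟨b, hb, hbc⟩
  rwa [← stalk_injective x hb]

theorem HasValueAt.mem (hg : HasValueAt k x g c) : g ∈ (localRingAt x).toSubring :=
  hg.imp fun _ h => h.1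

theorem HasValueAt.eq (hg : HasValueAt k x g c) (hg' : HasValueAt k x g d) : c = d := by
  obtain ⟨a, ha, ha'⟩ := hg
  obtain ⟨b, hb, hb'⟩ := hg'
  obtain rfl := stalk_injective x (ha.trans hb.symm)
  exact (algebraMap k (X.residueField x)).injective (ha'.symm.trans hb')

theorem HasValueAt.mul (hg : HasValueAt k x g c) (hh : HasValueAt k x h d) :
    HasValueAt k x (g * h) (c * d) := by
  obtain ⟨a, ha, ha'⟩ := hg
  obtain ⟨b, hb, hb'⟩ := hh
  exact ⟨a * b, by rw [map_mul, ha, hb], by rw [map_mul, map_mul, ha', hb']⟩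

variable (x c) in
theorem hasValueAt_algebraMap : HasValueAt k x (algebraMap k X.functionField c) c :=
  ⟨algebraMap k _ c, algebraMap_stalk_functionField x c, rfl⟩

variable (k x) in
theorem hasValueAt_one : HasValueAt k x (1 : X.functionField) 1 := by
  simpa only [map_one] using hasValueAt_algebraMap x (1 : k)

theorem HasValueAt.pow (hg : HasValueAt k x g c) (n : ℕ) : HasValueAt k x (g ^ n) (c ^ n) := by
  induction n with
  | zero => simpa only [pow_zero] using hasValueAt_one k x
  | succ n ih => simpa only [pow_succ] using ih.mul hg

theorem HasValueAt.aeval {σ : Type*} {a : σ → X.functionField} {w : σ → k}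
    (ha : ∀ i, HasValueAt k x (a i) (w i)) (F : MvPolynomial σ k) :
    HasValueAt k x (MvPolynomial.aeval a F) (MvPolynomial.eval w F) := by
  induction F using MvPolynomial.induction_on with
  | C c =>
    rw [MvPolynomial.aeval_C, MvPolynomial.eval_C]
    exact hasValueAt_algebraMap x c
  | add F G hF hG =>
    rw [map_add, map_add]
    exact hF.add hG
  | mul_X F i hF =>
    rw [map_mul, map_mul, MvPolynomial.aeval_X, MvPolynomial.eval_X]
    exact hF.mul (ha i)

theorem hasValueAt_zero_iff : HasValueAt k x g 0 ↔
    g ∈ (localRingAt x).toSubring ∧ (g ≠ 0 → g⁻¹ ∉ (localRingAt x).toSubring) := by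
  have hstalk (a : X.presheaf.stalk x) : HasValueAt k x (algebraMap _ X.functionField a) 0 ↔
      (algebraMap _ X.functionField a ≠ 0 →
        (algebraMap _ X.functionField a)⁻¹ ∉ (localRingAt x).toSubring) := by
    rw [hasValueAt_algebraMap_stalk_iff, map_zero, sub_zero, IsLocalRing.mem_maximalIdeal,
      mem_nonunits_iff, isUnit_stalk_iff, not_and]
  constructor
  · intro h
    obtain ⟨a, rfl⟩ := h.mem
    exact ⟨⟨a, rfl⟩, (hstalk a).mp h⟩
  · rintro ⟨⟨a, rfl⟩, h⟩
    exact (hstalk a).mpr h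

theorem HasValueAt.ne_zero (hg : HasValueAt k x g c) (hc : c ≠ 0) : g ≠ 0 := by
  rintro rfl
  exact hc (hg.eq (hasValueAt_zero k x))

theorem HasValueAt.inv (hg : HasValueAt k x g c) (hc : c ≠ 0) : HasValueAt k x g⁻¹ c⁻¹ := by
  have hmem : g⁻¹ ∈ (localRingAt x).toSubring := by
    by_contra hinv
    exact hc (hg.eq (hasValueAt_zero_iff.mpr ⟨hg.mem, fun _ => hinv⟩))
  obtain ⟨a, rfl, ha⟩ := hg
  obtain ⟨b, hb⟩ := hmem
  have hab : a * b = 1 := stalk_injective x <| by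
    rw [map_mul, map_one]
    exact hb ▸ mul_inv_cancel₀ (HasValueAt.ne_zero ⟨a, rfl, ha⟩ hc)
  refine ⟨b, hb, ?_⟩
  rw [map_inv₀, ← ha]
  exact eq_inv_of_mul_eq_one_right (by rw [← map_mul, hab, map_one])

theorem HasValueAt.mul_iff_of_div (hf : HasValueAt k x (f / f') d) (hf' : f' ≠ 0) (hd : d ≠ 0) :
    HasValueAt k x (g * f) (d * c) ↔ HasValueAt k x (g * f') c := by
  constructor <;> intro hg
  · have := hg.mul (hf.inv hd)
    rwa [inv_div, mul_assoc, mul_div_cancel₀ _ (fun h0 => hf.ne_zero hd (by rw [h0, zero_div])),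
      mul_comm d, mul_inv_cancel_right₀ hd] at this
  · have := hg.mul hf
    rwa [mul_assoc, mul_div_cancel₀ _ hf', mul_comm c] at this

theorem HasValueAt.mul_mem (hg : HasValueAt k x g 0) (hh : h ∈ (localRingAt x).toSubring) :
    HasValueAt k x (h * g) 0 := by
  obtain ⟨a, rfl⟩ := hg.mem
  obtain ⟨b, rfl⟩ := hh
  refine (map_mul (algebraMap _ X.functionField) b a) ▸ ?_
  rw [hasValueAt_algebraMap_stalk_iff, map_zero, sub_zero] at hg ⊢
  exact Ideal.mul_mem_left _ _ hg

theorem exists_hasValueAt (hx : Function.Bijective (algebraMap k (X.residueField x)))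
    (hg : g ∈ (localRingAt x).toSubring) : ∃ c : k, HasValueAt k x g c := by
  obtain ⟨a, rfl⟩ := hg
  exact (bijective_algebraMap_residueField_iff.mp hx a).imp fun _ =>
    (hasValueAt_algebraMap_stalk_iff a).mpr

theorem exists_units_hasValueAt (hx : Function.Bijective (algebraMap k (X.residueField x)))
    (h0 : g ≠ 0) (hg : g ∈ (localRingAt x).toSubring) (hg' : g⁻¹ ∈ (localRingAt x).toSubring) :
    ∃ a : kˣ, HasValueAt k x g a := by
  obtain ⟨c, hc⟩ := exists_hasValueAt hx hg
  refine ⟨Units.mk0 c ?_, hc⟩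
  rintro rfl
  exact (hasValueAt_zero_iff.mp hc).2 h0 hg'

end Values

section Pullback

variable {k : Type u} [Field k] {X Y : Scheme.{u}} [X.Over (Spec (CommRingCat.of k))]
  [Y.Over (Spec (CommRingCat.of k))] (π : Y ⟶ X) [π.IsOver (Spec (CommRingCat.of k))]

theorem stalkMap_algebraMap (y : Y) (c : k) :
    (π.stalkMap y).hom (algebraMap k (X.presheaf.stalk (π y)) c) =
      algebraMap k (Y.presheaf.stalk y) c := by
  have h : (X ↘ Spec (CommRingCat.of k)).appTop ≫ X.presheaf.germ ⊤ (π y) trivial ≫ π.stalkMap y =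
      (Y ↘ Spec (CommRingCat.of k)).appTop ≫ Y.presheaf.germ ⊤ y trivial := by
    have hgerm : X.presheaf.germ ⊤ (π y) trivial ≫ π.stalkMap y =
        π.appTop ≫ Y.presheaf.germ ⊤ y trivial := Scheme.Hom.germ_stalkMap π ⊤ y trivial
    rw [hgerm, ← comp_over π (Spec (CommRingCat.of k)), Scheme.Hom.comp_appTop, Category.assoc]
  exact congr($(h).hom ((Scheme.ΓSpecIso (CommRingCat.of k)).inv.hom c))

theorem stalkMap_sub_algebraMap_mem_iff (y : Y) (a : X.presheaf.stalk (π y)) (c : k) :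
    (π.stalkMap y).hom a - algebraMap k (Y.presheaf.stalk y) c ∈
        maximalIdeal (Y.presheaf.stalk y) ↔
      a - algebraMap k (X.presheaf.stalk (π y)) c ∈ maximalIdeal (X.presheaf.stalk (π y)) := by
  rw [← stalkMap_algebraMap π, ← map_sub]
  exact map_mem_nonunits_iff (π.stalkMap y).hom _

theorem bijective_algebraMap_residueField_map {y : Y}
    (h : Function.Bijective (algebraMap k (Y.residueField y))) :
    Function.Bijective (algebraMap k (X.residueField (π y))) := by
  rw [bijective_algebraMap_residueField_iff] at h ⊢
  exact fun a => (h ((π.stalkMap y).hom a)).imp fun c =>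
    (stalkMap_sub_algebraMap_mem_iff π y a c).mp

variable {π} {p : X} {hp : IsClosed {p}}

theorem IsBlowUpAt.eq_of_map_eq (hπ : IsBlowUpAt π p hp) {y y' : Y} (hy : π y ≠ p)
    (h : π y = π y') : y = y' := by
  obtain ⟨z, -, hz, -⟩ := hπ.exists_of_ne hy
  rw [hz y rfl, hz y' h.symm]

theorem IsBlowUpAt.exists_rationalPoint (hπ : IsBlowUpAt π p hp) (x : RationalPoint k X)
    (hx : x.1 ≠ p) : ∃ y : RationalPoint k Y, π y.1 = x.1 := by
  obtain ⟨x, hxk⟩ := x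
  obtain ⟨y, rfl, -⟩ := hπ.exists_of_ne hx
  refine ⟨⟨y, ?_⟩, rfl⟩
  rw [bijective_algebraMap_residueField_iff] at hxk ⊢
  intro b
  obtain ⟨a, rfl⟩ := hπ.stalkMap_surjective hx b
  exact (hxk a).imp fun c => (stalkMap_sub_algebraMap_mem_iff π y a c).mpr

variable [IsIntegral X] [IsIntegral Y]

theorem functionFieldMap_algebraMap (hd : IsDominant π) (c : k) :
    functionFieldMap π hd (algebraMap k X.functionField c) = algebraMap k Y.functionField c := by
  rw [← algebraMap_stalk_functionField (π (genericPoint Y)), ← algebraMap_stalkMap π hd,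
    stalkMap_algebraMap, algebraMap_stalk_functionField]

theorem hasValueAt_functionFieldMap_iff (hd : IsDominant π) {y : Y}
    {g : X.functionField} (hg : g ∈ (localRingAt (π y)).toSubring) {c : k} :
    HasValueAt k y (functionFieldMap π hd g) c ↔ HasValueAt k (π y) g c := by
  obtain ⟨a, rfl⟩ := hg
  refine ((algebraMap_stalkMap π hd y a) ▸ hasValueAt_algebraMap_stalk_iff _).trans ?_
  exact (stalkMap_sub_algebraMap_mem_iff π y a c).trans (hasValueAt_algebraMap_stalk_iff a).symm

theorem IsBlowUpAt.hasValueAt_iff (hπ : IsBlowUpAt π p hp) (hd : IsDominant π) {y : Y}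
    (hy : π y ≠ p) {g : X.functionField} {c : k} :
    HasValueAt k y (functionFieldMap π hd g) c ↔ HasValueAt k (π y) g c :=
  ⟨fun h => (hasValueAt_functionFieldMap_iff hd
      ((hπ.functionFieldMap_mem_iff hd hy).mp h.mem)).mp h,
    fun h => (hasValueAt_functionFieldMap_iff hd h.mem).mpr h⟩

end Pullback

/-! ### Global sections -/

section GlobalSections

variable {k : Type u} [Field k] {X Y : Scheme.{u}} [Y.Over (Spec (CommRingCat.of k))]
  [IsIntegral X] [IsIntegral Y] {π : Y ⟶ X}

theorem mem_globalSections_iff {D : CartierDivisor Y} {s : Y.functionField} :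
    s ∈ globalSections k D ↔ ∀ i, ∀ y ∈ D.U i, s * D.f i ∈ (localRingAt y).toSubring :=
  forall_congr' fun _ => isRegularOn_iff

theorem mem_globalSections_pullback_sub_nsmul_iff (hd : IsDominant π) (D : CartierDivisor X)
    (E : CartierDivisor Y) (n : ℕ) {s : X.functionField} :
    functionFieldMap π hd s ∈ globalSections k (D.pullback π hd - n • E) ↔
      ∀ i j y, π y ∈ D.U i → y ∈ E.U j →
        functionFieldMap π hd (s * D.f i) / E.f j ^ n ∈ (localRingAt y).toSubring := by
  have hmul (i j) : functionFieldMap π hd s * (functionFieldMap π hd (D.f i) / E.f j ^ n) =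
      functionFieldMap π hd (s * D.f i) / E.f j ^ n := by rw [map_mul, mul_div_assoc]
  simp only [← hmul]
  rw [mem_globalSections_iff]
  exact ⟨fun h i j y hi hj => h (i, j) y ⟨hi, hj⟩, fun h ij y hy => h ij.1 ij.2 y hy.1 hy.2⟩

variable {p : X} {hp : IsClosed {p}} [X.Over (Spec (CommRingCat.of k))]

theorem IsBlowUpAt.mem_globalSections_pullback_iff (hπ : IsBlowUpAt π p hp) (hd : IsDominant π)
    (hgen : genericPoint X ≠ p) [IsNoetherianRing (X.presheaf.stalk p)]
    [IsIntegrallyClosed (X.presheaf.stalk p)] (hm : maximalIdeal (X.presheaf.stalk p) ≠ ⊥)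
    (D : CartierDivisor X) {s : X.functionField} :
    functionFieldMap π hd s ∈ globalSections k (D.pullback π hd) ↔ s ∈ globalSections k D := by
  refine ⟨fun h => mem_globalSections_iff.mpr fun i x hx => ?_,
    fun h i => (map_mul (functionFieldMap π hd) _ _) ▸ (h i).comp π hd⟩
  have hreg : ∀ y, π y = x → functionFieldMap π hd (s * D.f i) ∈ (localRingAt y).toSubring := by
    rintro y rfl
    rw [map_mul]
    exact mem_globalSections_iff.mp h i y hx
  by_cases hxp : x = p
  · subst hxp
    exact hπ.mem_localRingAt_of_forall hd hgen hm hreg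
  · obtain ⟨y, rfl, -⟩ := hπ.exists_of_ne hxp
    exact (hπ.functionFieldMap_mem_iff hd hxp).mp (hreg y rfl)

theorem IsBlowUpAt.mem_globalSections_pullback_sub_iff (hπ : IsBlowUpAt π p hp)
    (hd : IsDominant π) (hgen : genericPoint X ≠ p) [IsNoetherianRing (X.presheaf.stalk p)]
    [IsIntegrallyClosed (X.presheaf.stalk p)] {u v : X.presheaf.stalk p}
    (h : IsRegularPair (maximalIdeal _) u v) (D : CartierDivisor X)
    {E : CartierDivisor Y} (hE : IsSumOfExceptionalCurves π p hp E) (n : ℕ)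
    {s : X.functionField} :
    functionFieldMap π hd s ∈ globalSections k (D.pullback π hd - n • E) ↔
      s ∈ sectionsOfMultiplicity k D p n := by
  have hloc {j y} (hj : y ∈ E.U j) : IsLocalEquation hd p y (E.f j) :=
    hπ.isLocalEquation hd h hE hj
  rw [mem_globalSections_pullback_sub_nsmul_iff]
  constructor
  · intro hs
    have hvan (i) (hi : p ∈ D.U i) : VanishesToOrder p n (s * D.f i) := by
      refine (hπ.vanishesToOrder_iff hd hgen h).mpr fun y hy e he => ?_
      obtain ⟨j, hj⟩ := E.cover y
      have hmem := mul_mem (hs i j y (hy ▸ hi) hj)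
        (pow_mem (he.div_mem_of_isGenerator ((hloc hj).isGenerator hy)) n)
      rwa [div_pow, div_mul_div_cancel₀ (pow_ne_zero n (E.ne_zero j))] at hmem
    refine ⟨mem_globalSections_iff.mpr fun i x hx => ?_, hvan⟩
    by_cases hxp : x = p
    · subst hxp
      exact (hvan i hx).imp fun a ha => ha.2
    · obtain ⟨y, rfl, -⟩ := hπ.exists_of_ne hxp
      obtain ⟨j, hj⟩ := E.cover y
      have hmem := mul_mem (hs i j y hx hj) (pow_mem (hloc hj).mem n)
      rw [div_mul_cancel₀ _ (pow_ne_zero n (E.ne_zero j))] at hmem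
      exact (hπ.functionFieldMap_mem_iff hd hxp).mp hmem
  · rintro ⟨hs, hvan⟩ i j y hi hj
    by_cases hyp : π y = p
    · exact (hπ.vanishesToOrder_iff hd hgen h).mp (hvan i (hyp ▸ hi)) y hyp _
        ((hloc hj).isGenerator hyp)
    · rw [div_eq_mul_inv, ← inv_pow]
      exact mul_mem ((hπ.functionFieldMap_mem_iff hd hyp).mpr
        (mem_globalSections_iff.mp hs i _ hi)) (pow_mem ((hloc hj).inv_mem hyp) n)

end GlobalSections

/-! ### Homogeneous components -/

section Homogeneous

theorem aeval_smul_of_isHomogeneous {σ R A : Type*} [CommSemiring R] [CommSemiring A]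
    [Algebra R A] {F : MvPolynomial σ R} {n : ℕ} (hF : F.IsHomogeneous n) (c : A) (a : σ → A) :
    MvPolynomial.aeval (c • a) F = c ^ n * MvPolynomial.aeval a F := by
  rw [MvPolynomial.aeval_def, MvPolynomial.aeval_def, MvPolynomial.eval₂_eq,
    MvPolynomial.eval₂_eq, Finset.mul_sum]
  refine Finset.sum_congr rfl fun d hd => ?_
  have hdeg : ∑ i ∈ d.support, d i = n := by
    rw [← Finsupp.degree_apply, Finsupp.degree_eq_weight_one]
    exact hF (MvPolynomial.mem_support_iff.mp hd)
  simp only [Pi.smul_apply, smul_eq_mul, mul_pow]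
  rw [Finset.prod_mul_distrib, Finset.prod_pow_eq_pow_sum, hdeg, mul_left_comm]

variable {k : Type u} [Field k] {X : Scheme.{u}} [X.Over (Spec (CommRingCat.of k))] {p : X}
  {u v : X.presheaf.stalk p}

theorem exists_isHomogeneousComponent [IsIntegral X]
    (hk : Function.Bijective (algebraMap k (X.residueField p)))
    (huv : maximalIdeal (X.presheaf.stalk p) = Ideal.span {u, v}) {n : ℕ} {g : X.functionField}
    (hg : VanishesToOrder p n g) : ∃ F, IsHomogeneousComponent k p u v n g F := by
  obtain ⟨a, ha, rfl⟩ := hg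
  obtain ⟨b, rfl⟩ := exists_eq_sum_of_mem_span_pair_pow (huv ▸ ha)
  choose c hc using fun i => bijective_algebraMap_residueField_iff.mp hk (b i)
  refine ⟨∑ i ∈ Finset.range (n + 1), MvPolynomial.C (c i) *
    (MvPolynomial.X 0 ^ (n - i) * MvPolynomial.X 1 ^ i), ?_, _, rfl, ?_⟩
  · refine .sum _ _ _ fun i hi => ?_
    have h := (MvPolynomial.isHomogeneous_C (Fin 2) (c i)).mul
      ((MvPolynomial.isHomogeneous_X_pow (0 : Fin 2) (n - i)).mul
        (MvPolynomial.isHomogeneous_X_pow (1 : Fin 2) i))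
    rwa [zero_add, Nat.sub_add_cancel (Finset.mem_range_succ_iff.mp hi)] at h
  · rw [map_sum, ← Finset.sum_sub_distrib]
    refine sum_mem fun i hi => ?_
    have hmon : u ^ (n - i) * v ^ i ∈ maximalIdeal (X.presheaf.stalk p) ^ n := by
      have hum : u ∈ maximalIdeal (X.presheaf.stalk p) :=
        huv ▸ Ideal.subset_span (Set.mem_insert _ _)
      have hvm : v ∈ maximalIdeal (X.presheaf.stalk p) :=
        huv ▸ Ideal.subset_span (Set.mem_insert_of_mem _ rfl)
      rw [← Nat.sub_add_cancel (Finset.mem_range_succ_iff.mp hi), pow_add, Nat.add_sub_cancel]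
      exact Ideal.mul_mem_mul (Ideal.pow_mem_pow hum _) (Ideal.pow_mem_pow hvm _)
    have heval : MvPolynomial.aeval ![u, v] (MvPolynomial.C (c i) *
        (MvPolynomial.X 0 ^ (n - i) * MvPolynomial.X 1 ^ i)) =
          algebraMap k _ (c i) * (u ^ (n - i) * v ^ i) := by
      simp
    rw [heval, ← sub_mul, pow_succ']
    exact Ideal.mul_mem_mul (hc i) hmon

end Homogeneous

/-! ### The points above a rational point -/

section ChartEvaluation

variable {k : Type u} [Field k] {X Y : Scheme.{u}} [X.Over (Spec (CommRingCat.of k))]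
  [IsIntegral X] [IsIntegral Y] {π : Y ⟶ X} {hd : IsDominant π}
  {p : X} {u v : X.presheaf.stalk p} {b : k}

variable (hd) in
/-- The ring homomorphism `χ` from the chart `R[v/u]`, where `R` is the local ring at `p`, to `k`
evaluates the elements of `R` at `p`, and `v/u` as `b`. -/
structure IsChartEvaluation (u v : X.presheaf.stalk p)
    (χ : chart (localToFunctionField π hd p) u v →+* k) (b : k) : Prop where
  map_algebraMap : ∀ r c, r - algebraMap k (X.presheaf.stalk p) c ∈ maximalIdeal _ →
    χ ⟨_, map_mem_chart r⟩ = c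
  map_div : χ ⟨_, div_mem_chart⟩ = b

theorem exists_isChartEvaluation (hd : IsDominant π)
    (hk : Function.Bijective (algebraMap k (X.residueField p)))
    (h : IsRegularPair (maximalIdeal _) u v) (b : k) : ∃ χ, IsChartEvaluation hd u v χ b := by
  let κ := RingEquiv.ofBijective (algebraMap k (X.residueField p)) hk
  let ε : X.presheaf.stalk p →+* k := (κ.symm : _ →+* k).comp (X.residue p).hom
  have hε (a c) (hac : a - algebraMap k (X.presheaf.stalk p) c ∈ maximalIdeal _) : ε a = c :=
    κ.symm_apply_eq.mpr ((residue_eq_algebraMap_iff a).mpr hac)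
  obtain ⟨χ, hχ, hb⟩ := h.exists_chart_ringHom (localToFunctionField_injective hd p) (ε := ε)
    (fun r hr => hε r 0 (by rwa [map_zero, sub_zero])) b
  exact ⟨χ, fun r c hrc => (hχ r).trans (hε r c hrc), hb⟩

theorem IsChartEvaluation.exceptionalIdeal_le_ker
    {χ : chart (localToFunctionField π hd p) u v →+* k} (hχ : IsChartEvaluation hd u v χ b)
    (hu : u ∈ maximalIdeal (X.presheaf.stalk p)) :
    exceptionalIdeal (localToFunctionField π hd p) u v ≤ RingHom.ker χ :=
  (Ideal.span_singleton_le_iff_mem _).mpr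
    (hχ.map_algebraMap u 0 (by rwa [map_zero, sub_zero]))

end ChartEvaluation

section Directions

variable {k : Type u} [Field k] {X Y : Scheme.{u}} [Y.Over (Spec (CommRingCat.of k))]
  [IsIntegral X] [IsIntegral Y] {π : Y ⟶ X} {hd : IsDominant π}
  {p : X} {hp : IsClosed {p}} {u v : X.presheaf.stalk p} {y y' : Y} {w w' : Fin 2 → k}

/-- The point `y` above `p` lies in the direction `w` with respect to the coordinates `u, v`: to
the first order these are `w 0 * e` and `w 1 * e` at `y`, for some local equation `e` of the
inverse image of `p`. -/
def HasDirection (hd : IsDominant π) (u v : X.presheaf.stalk p) (y : Y) (w : Fin 2 → k) : Prop :=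
  ∃ e, IsGenerator (localToFunctionField π hd p) (maximalIdeal (X.presheaf.stalk p))
    (localRingAt y).toSubring e ∧ HasValueAt k y (localToFunctionField π hd p u / e) (w 0) ∧
    HasValueAt k y (localToFunctionField π hd p v / e) (w 1)

namespace HasDirection

theorem symm (h : HasDirection hd u v y w) : HasDirection hd v u y ![w 1, w 0] := by
  obtain ⟨e, he, hu, hv⟩ := h
  exact ⟨e, he, hv, hu⟩

theorem smul (h : HasDirection hd u v y w) {c : k} (hc : c ≠ 0) :
    HasDirection hd u v y (c • w) := by
  obtain ⟨e, he, hu, hv⟩ := h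
  have hc0 : algebraMap k Y.functionField c ≠ 0 := (map_ne_zero _).mpr hc
  have hdiv (z) : z / (e / algebraMap k Y.functionField c) = c • (z / e) := by
    rw [Algebra.smul_def, div_div_eq_mul_div, mul_comm, mul_div_assoc]
  refine ⟨e / algebraMap k Y.functionField c, he.of_div_mem (div_ne_zero he.ne_zero hc0) ?_ ?_,
    hdiv _ ▸ hu.smul c, hdiv _ ▸ hv.smul c⟩
  · rw [div_div_cancel₀ he.ne_zero]
    exact (hasValueAt_algebraMap y c).mem
  · rw [div_div, mul_comm, ← div_div, div_self he.ne_zero, one_div, ← map_inv₀]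
    exact (hasValueAt_algebraMap y c⁻¹).mem

theorem hasValueAt_div (h : HasDirection hd u v y w) (hw : w 0 ≠ 0) :
    HasValueAt k y (localToFunctionField π hd p v / localToFunctionField π hd p u)
      (w 1 / w 0) := by
  obtain ⟨e, he, hu, hv⟩ := h
  have := hv.mul (hu.inv hw)
  rwa [inv_div, div_mul_div_cancel₀ he.ne_zero, ← div_eq_mul_inv] at this

theorem exists_smul_eq (hy : Function.Bijective (algebraMap k (Y.residueField y)))
    (h : HasDirection hd u v y w) (h' : HasDirection hd u v y w') : ∃ a : kˣ, a • w = w' := by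
  obtain ⟨e, he, hu, hv⟩ := h
  obtain ⟨e', he', hu', hv'⟩ := h'
  obtain ⟨a, ha⟩ := exists_units_hasValueAt hy (div_ne_zero he.ne_zero he'.ne_zero)
    (he'.div_mem_of_isGenerator he) (inv_div e e' ▸ he.div_mem_of_isGenerator he')
  have hmul {z c c'} (hz : HasValueAt k y (z / e) c) (hz' : HasValueAt k y (z / e') c') :
      (a : k) * c = c' := by
    have := hz.mul ha
    rw [div_mul_div_cancel₀ he.ne_zero] at this
    exact (mul_comm _ _).trans (this.eq hz')
  exact ⟨a, funext (Fin.forall_fin_two.mpr ⟨hmul hu hu', hmul hv hv'⟩)⟩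

end HasDirection

theorem IsBlowUpAt.exists_hasDirection (hπ : IsBlowUpAt π p hp) (hd : IsDominant π)
    (huv : maximalIdeal (X.presheaf.stalk p) = Ideal.span {u, v}) (hyp : π y = p)
    (hy : Function.Bijective (algebraMap k (Y.residueField y))) :
    ∃ w : Fin 2 → k, w ≠ 0 ∧ HasDirection hd u v y w := by
  obtain ⟨e, he⟩ := hπ.exists_isGenerator hd hyp
  obtain ⟨a, ha⟩ := exists_hasValueAt hy
    (he.div_mem u (huv ▸ Ideal.subset_span (Set.mem_insert _ _)))
  obtain ⟨b, hb⟩ := exists_hasValueAt hy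
    (he.div_mem v (huv ▸ Ideal.subset_span (Set.mem_insert_of_mem _ rfl)))
  refine ⟨![a, b], fun h0 => ?_, e, he, ha, hb⟩
  obtain rfl : a = 0 := congrFun h0 0
  obtain rfl : b = 0 := congrFun h0 1
  rcases div_mem_or_div_mem_of_isGenerator huv (localToFunctionField_mem hd hyp) he with
    ⟨hu, hmem⟩ | ⟨hv, hmem⟩
  · exact (hasValueAt_zero_iff.mp ha).2 (div_ne_zero hu he.ne_zero) ((inv_div _ e).symm ▸ hmem)
  · exact (hasValueAt_zero_iff.mp hb).2 (div_ne_zero hv he.ne_zero) ((inv_div _ e).symm ▸ hmem)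

theorem hasValueAt_zero_iff_mem_of_localRingAt_eq {A : Subring Y.functionField} {q : Ideal A}
    [q.IsPrime] (h : localRingAt y = .ofPrime A q) (a : A) :
    HasValueAt k y (a : Y.functionField) 0 ↔ a ∈ q := by
  rw [hasValueAt_zero_iff, h, and_iff_right (LocalSubring.le_ofPrime A q a.2)]
  by_cases ha : a = 0
  · simp [ha]
  · rw [inv_mem_ofPrime_iff ha, not_not]
    exact ⟨fun hq => hq (by simpa using ha), fun hq _ => hq⟩

variable [X.Over (Spec (CommRingCat.of k))] [π.IsOver (Spec (CommRingCat.of k))]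

theorem hasValueAt_localToFunctionField (hd : IsDominant π) (hy : π y = p)
    {a : X.presheaf.stalk p} {c : k}
    (h : a - algebraMap k (X.presheaf.stalk p) c ∈ maximalIdeal (X.presheaf.stalk p)) :
    HasValueAt k y (localToFunctionField π hd p a) c := by
  subst hy
  exact (hasValueAt_functionFieldMap_iff hd ⟨a, rfl⟩).mpr
    ((hasValueAt_algebraMap_stalk_iff a).mpr h)

namespace IsChartEvaluation

attribute [local instance] RingHom.ker_isPrime

variable {χ : chart (localToFunctionField π hd p) u v →+* k} {b : k}

theorem hasValueAt (hχ : IsChartEvaluation hd u v χ b)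
    (hk : Function.Bijective (algebraMap k (X.residueField p))) (hy : π y = p)
    (h : HasValueAt k y (localToFunctionField π hd p v / localToFunctionField π hd p u) b)
    (z : chart (localToFunctionField π hd p) u v) : HasValueAt k y (z : Y.functionField) (χ z) := by
  obtain ⟨P, rfl⟩ := chartHom_surjective z
  induction P using Polynomial.induction_on' with
  | add P Q hP hQ =>
    rw [map_add, map_add, Subring.coe_add]
    exact hP.add hQ
  | monomial n a =>
    obtain ⟨c, hc⟩ := bijective_algebraMap_residueField_iff.mp hk a
    have hmonomial : chartHom (localToFunctionField π hd p) u v (Polynomial.monomial n a) =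
        ⟨_, map_mem_chart a⟩ * ⟨_, div_mem_chart⟩ ^ n :=
      Subtype.ext ((coe_chartHom _).trans (Polynomial.eval₂_monomial _ _))
    rw [hmonomial, map_mul, map_pow, hχ.map_algebraMap a c hc, hχ.map_div]
    exact (hasValueAt_localToFunctionField hd hy hc).mul (h.pow n)

theorem hasValueAt_of_localRingAt_eq (hχ : IsChartEvaluation hd u v χ b) (hy : π y = p)
    (h : localRingAt y = .ofPrime _ (RingHom.ker χ))
    (z : chart (localToFunctionField π hd p) u v) : HasValueAt k y (z : Y.functionField) (χ z) := by
  let c : chart (localToFunctionField π hd p) u v := ⟨_, map_mem_chart (algebraMap k _ (χ z))⟩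
  have hsub (r : X.presheaf.stalk p) : r - r ∈ maximalIdeal (X.presheaf.stalk p) :=
    (sub_self r).symm ▸ zero_mem _
  have hc : χ c = χ z := hχ.map_algebraMap _ _ (hsub _)
  have hzc : HasValueAt k y ((z - c : chart _ u v) : Y.functionField) 0 :=
    (hasValueAt_zero_iff_mem_of_localRingAt_eq h _).mpr
      (RingHom.mem_ker.mpr (by rw [map_sub, hc, sub_self]))
  have := hzc.add (hasValueAt_localToFunctionField hd hy (hsub (algebraMap k _ (χ z))))
  rwa [zero_add, AddSubgroupClass.coe_sub, sub_add_cancel] at this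

theorem localRingAt_eq (hχ : IsChartEvaluation hd u v χ b) (hπ : IsBlowUpAt π p hp)
    (hk : Function.Bijective (algebraMap k (X.residueField p)))
    (huv : maximalIdeal (X.presheaf.stalk p) = Ideal.span {u, v})
    (hu : localToFunctionField π hd p u ≠ 0) (hy : π y = p)
    (h : HasValueAt k y (localToFunctionField π hd p v / localToFunctionField π hd p u) b) :
    localRingAt y = .ofPrime _ (RingHom.ker χ) := by
  obtain ⟨q, _, hq⟩ := hπ.localRingAt_eq_ofPrime hd huv hu hy h.mem
  obtain rfl : q = RingHom.ker χ := by
    ext z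
    rw [← hasValueAt_zero_iff_mem_of_localRingAt_eq (k := k) hq z, RingHom.mem_ker]
    have hz := hχ.hasValueAt hk hy h z
    exact ⟨hz.eq, fun h0 => h0 ▸ hz⟩
  exact hq

theorem bijective_algebraMap_residueField (hχ : IsChartEvaluation hd u v χ b) (hy : π y = p)
    (h : localRingAt y = .ofPrime _ (RingHom.ker χ)) :
    Function.Bijective (algebraMap k (Y.residueField y)) := by
  refine bijective_algebraMap_residueField_iff.mpr fun a => ?_
  have hmem : algebraMap _ Y.functionField a ∈ (localRingAt y).toSubring := ⟨a, rfl⟩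
  rw [h, mem_ofPrime_iff] at hmem
  obtain ⟨z, s, hs, ha⟩ := hmem
  refine ⟨χ z * (χ s)⁻¹, (hasValueAt_algebraMap_stalk_iff a).mp ?_⟩
  rw [ha, div_eq_mul_inv]
  exact (hχ.hasValueAt_of_localRingAt_eq hy h z).mul
    ((hχ.hasValueAt_of_localRingAt_eq hy h s).inv hs)

end IsChartEvaluation

theorem IsBlowUpAt.eq_of_hasValueAt (hπ : IsBlowUpAt π p hp) (hd : IsDominant π)
    (hk : Function.Bijective (algebraMap k (X.residueField p)))
    (huv : IsRegularPair (maximalIdeal _) u v) (hy : π y = p) (hy' : π y' = p) {b : k}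
    (h : HasValueAt k y (localToFunctionField π hd p v / localToFunctionField π hd p u) b)
    (h' : HasValueAt k y' (localToFunctionField π hd p v / localToFunctionField π hd p u) b) :
    y = y' := by
  obtain ⟨χ, hχ⟩ := exists_isChartEvaluation hd hk huv b
  have hu := huv.map_ne_zero (localToFunctionField_injective hd p)
  exact hπ.eq_of_localRingAt_le hd hy hy' ((hχ.localRingAt_eq hπ hk huv.span_eq hu hy h).trans
    (hχ.localRingAt_eq hπ hk huv.span_eq hu hy' h').symm).le

theorem IsBlowUpAt.eq_of_hasDirection [IsNoetherianRing (X.presheaf.stalk p)]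
    (hπ : IsBlowUpAt π p hp) (hd : IsDominant π)
    (hk : Function.Bijective (algebraMap k (X.residueField p)))
    (huv : IsRegularPair (maximalIdeal _) u v) (hy : π y = p) (hy' : π y' = p) (hw : w ≠ 0)
    (h : HasDirection hd u v y w) (h' : HasDirection hd u v y' w) : y = y' := by
  by_cases hw0 : w 0 = 0
  · have hw1 : w 1 ≠ 0 := fun hw1 => hw (funext (Fin.forall_fin_two.mpr ⟨hw0, hw1⟩))
    exact hπ.eq_of_hasValueAt hd hk huv.symm hy hy' (h.symm.hasValueAt_div hw1)
      (h'.symm.hasValueAt_div hw1)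
  · exact hπ.eq_of_hasValueAt hd hk huv hy hy' (h.hasValueAt_div hw0) (h'.hasValueAt_div hw0)

theorem IsBlowUpAt.exists_rationalPoint_hasDirection_one (hπ : IsBlowUpAt π p hp)
    (hd : IsDominant π) (hk : Function.Bijective (algebraMap k (X.residueField p)))
    (huv : IsRegularPair (maximalIdeal _) u v) (b : k) :
    ∃ y : RationalPoint k Y, π y.1 = p ∧ HasDirection hd u v y.1 ![1, b] := by
  have hφ := localToFunctionField_injective hd p
  have hu := huv.map_ne_zero hφ
  obtain ⟨χ, hχ⟩ := exists_isChartEvaluation hd hk huv b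
  have := RingHom.ker_isPrime χ
  obtain ⟨y, hy, heq⟩ := hπ.exists_localRingAt_eq_ofPrime hd huv.span_eq hu (RingHom.ker χ)
    (hχ.exceptionalIdeal_le_ker huv.left_mem)
  have hdiv := hχ.hasValueAt_of_localRingAt_eq hy heq ⟨_, div_mem_chart⟩
  rw [hχ.map_div] at hdiv
  refine ⟨⟨y, hχ.bijective_algebraMap_residueField hy heq⟩, hy, localToFunctionField π hd p u,
    isGenerator_of_div_mem huv.span_eq hu (localToFunctionField_mem hd hy) hdiv.mem, ?_, hdiv⟩
  rw [div_self hu]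
  exact hasValueAt_one k y

theorem IsBlowUpAt.exists_rationalPoint_hasDirection [IsNoetherianRing (X.presheaf.stalk p)]
    (hπ : IsBlowUpAt π p hp) (hd : IsDominant π)
    (hk : Function.Bijective (algebraMap k (X.residueField p)))
    (huv : IsRegularPair (maximalIdeal _) u v) (hw : w ≠ 0) :
    ∃ y : RationalPoint k Y, π y.1 = p ∧ HasDirection hd u v y.1 w := by
  by_cases hw0 : w 0 = 0
  · have hw1 : w 1 ≠ 0 := fun hw1 => hw (funext (Fin.forall_fin_two.mpr ⟨hw0, hw1⟩))
    obtain ⟨y, hy, h⟩ := hπ.exists_rationalPoint_hasDirection_one hd hk huv.symm 0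
    have hsmul : ![(w 1 • ![1, (0 : k)]) 1, (w 1 • ![1, (0 : k)]) 0] = w :=
      funext (Fin.forall_fin_two.mpr ⟨by simp [hw0], by simp⟩)
    exact ⟨y, hy, hsmul ▸ (h.smul hw1).symm⟩
  · obtain ⟨y, hy, h⟩ := hπ.exists_rationalPoint_hasDirection_one hd hk huv (w 1 / w 0)
    have hsmul : w 0 • ![1, w 1 / w 0] = w :=
      funext (Fin.forall_fin_two.mpr ⟨by simp, by simp [mul_div_cancel₀, hw0]⟩)
    exact ⟨y, hy, hsmul ▸ h.smul hw0⟩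

theorem localToFunctionField_aeval (hd : IsDominant π) (F : MvPolynomial (Fin 2) k) :
    localToFunctionField π hd p (MvPolynomial.aeval ![u, v] F) =
      MvPolynomial.aeval ![localToFunctionField π hd p u, localToFunctionField π hd p v] F := by
  let φ : X.presheaf.stalk p →ₐ[k] Y.functionField :=
    { localToFunctionField π hd p with
      commutes' := fun c => (congrArg _ (algebraMap_stalk_functionField p c)).trans
        (functionFieldMap_algebraMap hd c) }
  refine (MvPolynomial.comp_aeval_apply ![u, v] φ F).trans ?_
  exact congrArg (MvPolynomial.aeval · F) (funext (Fin.forall_fin_two.mpr ⟨rfl, rfl⟩))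

/-- `F(u, v) / e ^ n = F(u / e, v / e)` by homogeneity, and the remainder, which lies in
`e ^ (n + 1) O`, vanishes at `y` even after division by `e ^ n`. -/
theorem IsHomogeneousComponent.hasValueAt (hd : IsDominant π) {n : ℕ} {g : X.functionField}
    {F : MvPolynomial (Fin 2) k} (hF : IsHomogeneousComponent k p u v n g F)
    (hy : π y = p) {e : Y.functionField}
    (he : IsGenerator (localToFunctionField π hd p) (maximalIdeal (X.presheaf.stalk p))
      (localRingAt y).toSubring e)
    (hu : HasValueAt k y (localToFunctionField π hd p u / e) (w 0))
    (hv : HasValueAt k y (localToFunctionField π hd p v / e) (w 1)) :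
    HasValueAt k y (functionFieldMap π hd g / e ^ n) (MvPolynomial.eval w F) := by
  obtain ⟨hF, a, rfl, ha⟩ := hF
  have he0 : HasValueAt k y e 0 :=
    have hloc := IsLocalEquation.of_isGenerator hy he
    hasValueAt_zero_iff.mpr ⟨hloc.mem, fun _ h => hloc.inv_mem_iff.mp h hy⟩
  have hmain : HasValueAt k y (localToFunctionField π hd p (MvPolynomial.aeval ![u, v] F) / e ^ n)
      (MvPolynomial.eval w F) := by
    rw [localToFunctionField_aeval, div_eq_inv_mul, ← inv_pow, ← aeval_smul_of_isHomogeneous hF]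
    rw [div_eq_inv_mul] at hu hv
    exact HasValueAt.aeval (Fin.forall_fin_two.mpr ⟨hu, hv⟩) F
  have hrest := he0.mul_mem (he.div_pow_mem (localToFunctionField_mem hd hy) (n + 1) _ ha)
  have := hmain.add hrest
  rwa [add_zero, map_sub, pow_succ, div_mul_eq_mul_div, mul_div_mul_right _ _ he.ne_zero,
    ← add_div, add_sub_cancel] at this

end Directions

/-! ### Equivalence of codes -/

section LocalEquations

variable {k : Type u} [Field k] {X Y : Scheme.{u}} [Y.Over (Spec (CommRingCat.of k))]
  [IsIntegral X] [IsIntegral Y] {π : Y ⟶ X} {p : X} {hp : IsClosed {p}} {u v : X.presheaf.stalk p}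

theorem CartierDivisor.div_mem (D : CartierDivisor X) {x : X} {i j : D.ι} (hi : x ∈ D.U i)
    (hj : x ∈ D.U j) : D.f i / D.f j ∈ (localRingAt x).toSubring :=
  isRegularOn_iff.mp (D.compat i j) x ⟨hi, hj⟩

theorem CartierDivisor.exists_hasValueAt_div_map (D : CartierDivisor X) (hd : IsDominant π)
    (y : RationalPoint k Y) {i j : D.ι} (hi : π y.1 ∈ D.U i) (hj : π y.1 ∈ D.U j) :
    ∃ a : kˣ, HasValueAt k y.1
      (functionFieldMap π hd (D.f i) / functionFieldMap π hd (D.f j)) a := by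
  have hmem {i j} (hi : π y.1 ∈ D.U i) (hj : π y.1 ∈ D.U j) :
      functionFieldMap π hd (D.f i) / functionFieldMap π hd (D.f j) ∈
        (localRingAt y.1).toSubring :=
    map_div₀ (functionFieldMap π hd) _ _ ▸ functionFieldMap_mem π hd (D.div_mem hi hj)
  have hne (i) : functionFieldMap π hd (D.f i) ≠ 0 := (map_ne_zero _).mpr (D.ne_zero i)
  exact exists_units_hasValueAt y.2 (div_ne_zero (hne i) (hne j)) (hmem hi hj)
    (by rw [inv_div]; exact hmem hj hi)

theorem IsLocalEquation.exists_hasValueAt_div {hd : IsDominant π} {y : RationalPoint k Y}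
    {e e' : Y.functionField} (he : IsLocalEquation hd p y.1 e) (he' : IsLocalEquation hd p y.1 e') :
    ∃ a : kˣ, HasValueAt k y.1 (e / e') a :=
  exists_units_hasValueAt y.2 (div_ne_zero he.ne_zero he'.ne_zero) (he.div_mem he')
    (inv_div e e' ▸ he'.div_mem he)

theorem IsBlowUpAt.exists_hasValueAt_pullback_sub [IsNoetherianRing (X.presheaf.stalk p)]
    (hπ : IsBlowUpAt π p hp) (hd : IsDominant π) (huv : IsRegularPair (maximalIdeal _) u v)
    (D : CartierDivisor X) {E : CartierDivisor Y} (hE : IsSumOfExceptionalCurves π p hp E) (n : ℕ)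
    (y : RationalPoint k Y) {i : D.ι} (hi : π y.1 ∈ D.U i) {e : Y.functionField}
    (he : IsLocalEquation hd p y.1 e) :
    ∃ a : kˣ, HasValueAt k y.1 ((D.pullback π hd - n • E).f
      ((D.pullback π hd - n • E).index y.1) / (functionFieldMap π hd (D.f i) / e ^ n)) a := by
  obtain ⟨i', j, hi', hj, hij⟩ : ∃ i' j, π y.1 ∈ D.U i' ∧ y.1 ∈ E.U j ∧
      (D.pullback π hd - n • E).f ((D.pullback π hd - n • E).index y.1) =
        functionFieldMap π hd (D.f i') / E.f j ^ n :=
    ⟨_, _, ((D.pullback π hd - n • E).mem_index y.1).1,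
      ((D.pullback π hd - n • E).mem_index y.1).2, rfl⟩
  obtain ⟨a, ha⟩ := D.exists_hasValueAt_div_map hd y hi' hi
  obtain ⟨b, hb⟩ := he.exists_hasValueAt_div (hπ.isLocalEquation hd huv hE hj)
  refine ⟨a * b ^ n, ?_⟩
  have := ha.mul (hb.pow n)
  rwa [div_pow, div_mul_div_comm, mul_comm _ (E.f j ^ n), ← div_div_div_eq, ← hij] at this

end LocalEquations

section RationalPoints

variable {k : Type u} [Field k] {X Y : Scheme.{u}} [X.Over (Spec (CommRingCat.of k))]
  [Y.Over (Spec (CommRingCat.of k))] {π : Y ⟶ X} {p : X} {hp : IsClosed {p}}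

theorem injective_sumElim_of_hasDirection [IsIntegral X] [IsIntegral Y]
    {u v : X.presheaf.stalk p} {hd : IsDominant π}
    {f : {x : RationalPoint k X // x.1 ≠ p} → RationalPoint k Y} (hf : ∀ x, π (f x).1 = x.1.1)
    {f' : Projectivization k (Fin 2 → k) → RationalPoint k Y} (hf' : ∀ t, π (f' t).1 = p)
    (hdir : ∀ t, HasDirection hd u v (f' t).1 t.rep) : Function.Injective (Sum.elim f f') := by
  refine Function.Injective.sumElim (fun x x' h => ?_) (fun t t' h => ?_) fun x t h => ?_
  · exact Subtype.ext (Subtype.ext ((hf x).symm.trans (h ▸ hf x')))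
  · obtain ⟨a, ha⟩ := (hdir t').exists_smul_eq (f' t').2 (h ▸ hdir t)
    rw [← t.mk_rep, ← t'.mk_rep]
    exact (Projectivization.mk_eq_mk_iff k _ _ _ _).mpr ⟨a, ha⟩
  · exact x.2 ((hf x).symm.trans (h ▸ hf' t))

variable [π.IsOver (Spec (CommRingCat.of k))]

variable (π) in
/-- The map on rational points induced by a morphism of `k`-schemes. -/
def RationalPoint.map (y : RationalPoint k Y) : RationalPoint k X :=
  ⟨π y.1, bijective_algebraMap_residueField_map π y.2⟩

theorem IsBlowUpAt.bijective_rationalPointMap (hπ : IsBlowUpAt π p hp)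
    (hne : ∀ x : RationalPoint k X, x.1 ≠ p) :
    Function.Bijective (RationalPoint.map (k := k) π) := by
  refine ⟨fun y y' h => ?_, fun x => ?_⟩
  · exact Subtype.ext (hπ.eq_of_map_eq (hne (y.map π)) (congrArg Subtype.val h))
  · obtain ⟨y, hy⟩ := hπ.exists_rationalPoint x (hne x)
    exact ⟨y, Subtype.ext hy⟩

variable [IsIntegral X] [IsIntegral Y] {u v : X.presheaf.stalk p}

theorem IsBlowUpAt.surjective_sumElim_of_hasDirection [IsNoetherianRing (X.presheaf.stalk p)]
    (hπ : IsBlowUpAt π p hp) {hd : IsDominant π}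
    (hk : Function.Bijective (algebraMap k (X.residueField p)))
    (huv : IsRegularPair (maximalIdeal _) u v)
    {f : {x : RationalPoint k X // x.1 ≠ p} → RationalPoint k Y} (hf : ∀ x, π (f x).1 = x.1.1)
    {f' : Projectivization k (Fin 2 → k) → RationalPoint k Y} (hf' : ∀ t, π (f' t).1 = p)
    (hdir : ∀ t, HasDirection hd u v (f' t).1 t.rep) : Function.Surjective (Sum.elim f f') := by
  intro y
  by_cases hy : π y.1 = p
  · obtain ⟨w, hw, hyw⟩ := hπ.exists_hasDirection hd huv.span_eq hy y.2
    obtain ⟨a, ha⟩ := Projectivization.exists_smul_eq_mk_rep k w hw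
    have hrep : HasDirection hd u v y.1 (Projectivization.mk k w hw).rep :=
      ha ▸ hyw.smul a.ne_zero
    exact ⟨Sum.inr (.mk k w hw), Subtype.ext (hπ.eq_of_hasDirection hd hk huv (hf' _) hy
      (Projectivization.rep_nonzero _) (hdir _) hrep)⟩
  · have hyf := hf ⟨y.map π, hy⟩
    exact ⟨Sum.inl ⟨y.map π, hy⟩,
      Subtype.ext (hπ.eq_of_map_eq (fun h => hy (hyf.symm.trans h)) hyf)⟩

theorem IsBlowUpAt.exists_rationalPoint_equiv_sum [IsNoetherianRing (X.presheaf.stalk p)]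
    (hπ : IsBlowUpAt π p hp) (hd : IsDominant π)
    (hk : Function.Bijective (algebraMap k (X.residueField p)))
    (huv : IsRegularPair (maximalIdeal _) u v) :
    ∃ e : RationalPoint k Y ≃
        {x : RationalPoint k X // x.1 ≠ p} ⊕ Projectivization k (Fin 2 → k),
      (∀ x, π (e.symm (Sum.inl x)).1 = x.1.1) ∧ (∀ t, π (e.symm (Sum.inr t)).1 = p) ∧
      ∀ t, HasDirection hd u v (e.symm (Sum.inr t)).1 t.rep := by
  choose f hf using fun x : {x : RationalPoint k X // x.1 ≠ p} =>
    hπ.exists_rationalPoint x.1 x.2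
  choose f' hf' hdir using fun t : Projectivization k (Fin 2 → k) =>
    hπ.exists_rationalPoint_hasDirection hd hk huv t.rep_nonzero
  exact ⟨(Equiv.ofBijective _ ⟨injective_sumElim_of_hasDirection hf hf' hdir,
    hπ.surjective_sumElim_of_hasDirection hk huv hf hf' hdir⟩).symm, hf, hf', hdir⟩

end RationalPoints

section Codes

variable {k : Type u} [Field k] {X Y : Scheme.{u}} [X.Over (Spec (CommRingCat.of k))]
  [Y.Over (Spec (CommRingCat.of k))] [IsIntegral X] [IsIntegral Y] {π : Y ⟶ X}
  {p : X} {hp : IsClosed {p}} {u v : X.presheaf.stalk p}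

theorem equivalentVia_codeOfSections {hd : IsDominant π}
    (hsurj : Function.Surjective (functionFieldMap π hd)) {D : CartierDivisor X}
    {D' : CartierDivisor Y} {V : Submodule k X.functionField}
    (hV : ∀ s, functionFieldMap π hd s ∈ globalSections k D' ↔ s ∈ V)
    {e : RationalPoint k Y ≃ RationalPoint k X}
    (hvalue : ∀ y, ∃ a : kˣ, ∀ s c,
      HasValueAt k y.1 (functionFieldMap π hd s * D'.f (D'.index y.1)) (a * c) ↔
        HasValueAt k (e y).1 (s * D.f (D.index (e y).1)) c) :
    EquivalentVia e (evaluationCode k D' id) (codeOfSections k D id V) := by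
  choose a ha using hvalue
  refine ⟨a, fun w => ⟨?_, ?_⟩⟩
  · rintro ⟨s, hs, hw⟩
    exact ⟨_, (hV s).mpr hs, fun y => (ha y s _).mpr (hw (e y))⟩
  · rintro ⟨t, ht, hw⟩
    obtain ⟨s, rfl⟩ := hsurj t
    exact ⟨s, (hV s).mp ht, e.surjective.forall.mpr fun y => (ha y s _).mp (hw y)⟩

variable [π.IsOver (Spec (CommRingCat.of k))]

theorem IsBlowUpAt.hasValueAt_mul_iff (hπ : IsBlowUpAt π p hp) (hd : IsDominant π)
    {y : Y} (hy : π y ≠ p) {s f : X.functionField} (hf : f ≠ 0)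
    {f' : Y.functionField} {a : kˣ} (ha : HasValueAt k y (f' / functionFieldMap π hd f) a)
    {c : k} : HasValueAt k y (functionFieldMap π hd s * f') (a * c) ↔
      HasValueAt k (π y) (s * f) c := by
  rw [ha.mul_iff_of_div ((map_ne_zero _).mpr hf) a.ne_zero, ← map_mul, hπ.hasValueAt_iff hd hy]

theorem IsBlowUpAt.exists_hasValueAt_pullback_iff (hπ : IsBlowUpAt π p hp) (hd : IsDominant π)
    (D : CartierDivisor X) {y : RationalPoint k Y} (hy : π y.1 ≠ p) :
    ∃ a : kˣ, ∀ s c, HasValueAt k y.1 (functionFieldMap π hd s *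
        (D.pullback π hd).f ((D.pullback π hd).index y.1)) (a * c) ↔
      HasValueAt k (π y.1) (s * D.f (D.index (π y.1))) c := by
  obtain ⟨a, ha⟩ := D.exists_hasValueAt_div_map hd y ((D.pullback π hd).mem_index y.1)
    (D.mem_index _)
  exact ⟨a, fun s c => hπ.hasValueAt_mul_iff hd hy (D.ne_zero _) ha⟩

theorem IsBlowUpAt.exists_hasValueAt_pullback_sub_iff [IsNoetherianRing (X.presheaf.stalk p)]
    (hπ : IsBlowUpAt π p hp) (hd : IsDominant π) (huv : IsRegularPair (maximalIdeal _) u v)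
    (D : CartierDivisor X) {E : CartierDivisor Y} (hE : IsSumOfExceptionalCurves π p hp E) (n : ℕ)
    {y : RationalPoint k Y} (hy : π y.1 ≠ p) :
    ∃ a : kˣ, ∀ s c, HasValueAt k y.1 (functionFieldMap π hd s *
        (D.pullback π hd - n • E).f ((D.pullback π hd - n • E).index y.1)) (a * c) ↔
      HasValueAt k (π y.1) (s * D.f (D.index (π y.1))) c := by
  obtain ⟨a, ha⟩ := hπ.exists_hasValueAt_pullback_sub hd huv D hE n y (D.mem_index _)
    (IsLocalEquation.one hy)
  rw [one_pow, div_one] at ha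
  exact ⟨a, fun s c => hπ.hasValueAt_mul_iff hd hy (D.ne_zero _) ha⟩

theorem IsBlowUpAt.exists_hasValueAt_pullback_sub_iff_eq_eval
    [IsNoetherianRing (X.presheaf.stalk p)]
    (hπ : IsBlowUpAt π p hp) (hd : IsDominant π) (huv : IsRegularPair (maximalIdeal _) u v)
    (D : CartierDivisor X) {E : CartierDivisor Y} (hE : IsSumOfExceptionalCurves π p hp E) (n : ℕ)
    {y : RationalPoint k Y} (hy : π y.1 = p) {w : Fin 2 → k}
    (hw : HasDirection hd u v y.1 w) :
    ∃ a : kˣ, ∀ s F, IsHomogeneousComponent k p u v n (s * D.f (D.index p)) F → ∀ c,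
      HasValueAt k y.1 (functionFieldMap π hd s *
        (D.pullback π hd - n • E).f ((D.pullback π hd - n • E).index y.1)) (a * c) ↔
      c = MvPolynomial.eval w F := by
  obtain ⟨e, he, hu, hv⟩ := hw
  obtain ⟨a, ha⟩ := hπ.exists_hasValueAt_pullback_sub hd huv D hE n y (i := D.index p)
    (hy ▸ D.mem_index p) (IsLocalEquation.of_isGenerator hy he)
  refine ⟨a, fun s F hF c => ?_⟩
  have hvalue := hF.hasValueAt hd hy he hu hv
  rw [map_mul, mul_div_assoc] at hvalue
  rw [ha.mul_iff_of_div (div_ne_zero ((map_ne_zero _).mpr (D.ne_zero _))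
    (pow_ne_zero n he.ne_zero)) a.ne_zero]
  exact ⟨fun hc => hc.eq hvalue, fun hc => hc ▸ hvalue⟩

theorem IsBlowUpAt.equivalentVia_pullback [IsNoetherianRing (X.presheaf.stalk p)]
    [IsIntegrallyClosed (X.presheaf.stalk p)] (hπ : IsBlowUpAt π p hp) (hd : IsDominant π)
    (hgen : genericPoint X ≠ p) (hm : maximalIdeal (X.presheaf.stalk p) ≠ ⊥)
    (D : CartierDivisor X) {e : RationalPoint k Y ≃ RationalPoint k X}
    (he : ∀ y, π y.1 = (e y).1) (hne : ∀ x : RationalPoint k X, x.1 ≠ p) :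
    EquivalentVia e (evaluationCode k (D.pullback π hd) id) (evaluationCode k D id) :=
  equivalentVia_codeOfSections (hπ.functionFieldMap_surjective hd hgen)
    (fun _ => hπ.mem_globalSections_pullback_iff hd hgen hm D)
    fun y => he y ▸ hπ.exists_hasValueAt_pullback_iff hd D (he y ▸ hne (e y))

theorem IsBlowUpAt.equivalentVia_pullback_sub [IsNoetherianRing (X.presheaf.stalk p)]
    [IsIntegrallyClosed (X.presheaf.stalk p)] (hπ : IsBlowUpAt π p hp) (hd : IsDominant π)
    (hgen : genericPoint X ≠ p) (huv : IsRegularPair (maximalIdeal _) u v)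
    (D : CartierDivisor X) {E : CartierDivisor Y} (hE : IsSumOfExceptionalCurves π p hp E) (n : ℕ)
    {e : RationalPoint k Y ≃ RationalPoint k X}
    (he : ∀ y, π y.1 = (e y).1) (hne : ∀ x : RationalPoint k X, x.1 ≠ p) :
    EquivalentVia e (evaluationCode k (D.pullback π hd - n • E) id)
      (codeOfSections k D id (sectionsOfMultiplicity k D p n)) :=
  equivalentVia_codeOfSections (hπ.functionFieldMap_surjective hd hgen)
    (fun _ => hπ.mem_globalSections_pullback_sub_iff hd hgen huv D hE n)
    fun y => he y ▸ hπ.exists_hasValueAt_pullback_sub_iff hd huv D hE n (he y ▸ hne (e y))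

theorem IsBlowUpAt.equivalentVia_extendedCode [IsNoetherianRing (X.presheaf.stalk p)]
    [IsIntegrallyClosed (X.presheaf.stalk p)] (hπ : IsBlowUpAt π p hp) (hd : IsDominant π)
    (hgen : genericPoint X ≠ p) (hk : Function.Bijective (algebraMap k (X.residueField p)))
    (huv : IsRegularPair (maximalIdeal _) u v) (D : CartierDivisor X)
    {E : CartierDivisor Y} (hE : IsSumOfExceptionalCurves π p hp E) (n : ℕ)
    {e : RationalPoint k Y ≃
      {x : RationalPoint k X // x.1 ≠ p} ⊕ Projectivization k (Fin 2 → k)}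
    (he : ∀ x, π (e.symm (Sum.inl x)).1 = x.1.1) (he' : ∀ t, π (e.symm (Sum.inr t)).1 = p)
    (hdir : ∀ t, HasDirection hd u v (e.symm (Sum.inr t)).1 t.rep) :
    EquivalentVia e (evaluationCode k (D.pullback π hd - n • E) id)
      (extendedCode k D p u v n) := by
  have hV (s) := hπ.mem_globalSections_pullback_sub_iff (k := k) hd hgen huv D hE n (s := s)
  choose a ha using fun x => he x ▸
    hπ.exists_hasValueAt_pullback_sub_iff hd huv D hE n ((he x).symm ▸ x.2)
  choose b hb using fun t =>
    hπ.exists_hasValueAt_pullback_sub_iff_eq_eval hd huv D hE n (he' t) (hdir t)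
  refine ⟨fun y => Sum.elim a b (e y), fun w => ⟨?_, ?_⟩⟩
  · rintro ⟨s, hs, hw, F, hF, hwF⟩
    refine ⟨_, (hV s).mpr hs, e.symm.surjective.forall.mpr (Sum.forall.mpr ⟨fun x => ?_,
      fun t => ?_⟩)⟩
    · simpa only [id, Equiv.apply_symm_apply, Sum.elim_inl] using (ha x s _).mpr (hw x)
    · simpa only [id, Equiv.apply_symm_apply, Sum.elim_inr] using (hb t s F hF _).mpr (hwF t)
  · rintro ⟨t, ht, hw⟩
    obtain ⟨s, rfl⟩ := hπ.functionFieldMap_surjective hd hgen t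
    have hs := (hV s).mp ht
    obtain ⟨F, hF⟩ := exists_isHomogeneousComponent hk huv.span_eq (hs.2 _ (D.mem_index p))
    have hw' (j) := hw (e.symm j)
    simp only [id, Equiv.apply_symm_apply] at hw'
    exact ⟨s, hs, fun x => (ha x s _).mp (hw' (Sum.inl x)), F, hF,
      fun t => (hb t s F hF _).mp (hw' (Sum.inr t))⟩

end Codes

theorem maximalIdeal_ne_bot_of_ringKrullDim_ne_zero {R : Type*} [CommRing R] [IsLocalRing R]
    (hdim : ringKrullDim R ≠ 0) : maximalIdeal R ≠ ⊥ := fun h =>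
  hdim (ringKrullDim_eq_zero_of_isField (isField_iff_maximalIdeal_eq.mpr h))

theorem genericPoint_ne_of_maximalIdeal_ne_bot {X : Scheme.{u}} [IsIntegral X] {p : X}
    (hm : maximalIdeal (X.presheaf.stalk p) ≠ ⊥) :
    genericPoint X ≠ p := by
  rintro rfl
  exact hm (isField_iff_maximalIdeal_eq.mp (Field.toIsField X.functionField))

end BlowUpCode

theorem mainTheorem10_general {k : Type u} [Field k] {X Y : Scheme.{u}}
    [X.Over (Spec (CommRingCat.of k))] [Y.Over (Spec (CommRingCat.of k))]
    [IsIntegral X] [IsIntegral Y] {π : Y ⟶ X} [π.IsOver (Spec (CommRingCat.of k))]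
    {p : X} {hp : IsClosed {p}} [IsNoetherianRing (X.presheaf.stalk p)]
    [IsIntegrallyClosed (X.presheaf.stalk p)] (hdim : ringKrullDim (X.presheaf.stalk p) = 2)
    (hπ : IsBlowUpAt π p hp) (hd : IsDominant π) (D : CartierDivisor X) :
    (1 < degree k X p →
      ∃ e : RationalPoint k Y ≃ RationalPoint k X, (∀ y, π y.1 = (e y).1) ∧
        EquivalentVia e (evaluationCode k (D.pullback π hd) id) (evaluationCode k D id) ∧
        (IsRegularLocalRing (X.presheaf.stalk p) →
          ∀ E : CartierDivisor Y, IsSumOfExceptionalCurves π p hp E → ∀ n : ℕ,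
            EquivalentVia e (evaluationCode k (D.pullback π hd - n • E) id)
              (codeOfSections k D id (sectionsOfMultiplicity k D p n)))) ∧
    (degree k X p = 1 →
      ∀ u v : X.presheaf.stalk p,
        IsLocalRing.maximalIdeal (X.presheaf.stalk p) = Ideal.span {u, v} →
        ∃ e : RationalPoint k Y ≃
            {x : RationalPoint k X // x.1 ≠ p} ⊕ Projectivization k (Fin 2 → k),
          (∀ x, π (e.symm (Sum.inl x)).1 = x.1.1) ∧ (∀ t, π (e.symm (Sum.inr t)).1 = p) ∧
          ∀ E : CartierDivisor Y, IsSumOfExceptionalCurves π p hp E → ∀ n : ℕ,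
            EquivalentVia e (evaluationCode k (D.pullback π hd - n • E) id)
              (extendedCode k D p u v n)) ∧
    (IsRegularLocalRing (X.presheaf.stalk p) →
      ∃ E : CartierDivisor Y, IsSumOfExceptionalCurves π p hp E) := by
  have hm : IsLocalRing.maximalIdeal (X.presheaf.stalk p) ≠ ⊥ :=
    maximalIdeal_ne_bot_of_ringKrullDim_ne_zero (hdim ▸ two_ne_zero)
  have hgen : genericPoint X ≠ p := genericPoint_ne_of_maximalIdeal_ne_bot hm
  have hpair {u v} : IsLocalRing.maximalIdeal (X.presheaf.stalk p) = Ideal.span {u, v} →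
      IsRegularPair (IsLocalRing.maximalIdeal _) u v :=
    isRegularPair_of_span_eq (hdim ▸ by decide)
  refine ⟨fun hdeg => ?_, fun hdeg u v huv => ?_, fun _ => ?_⟩
  · have hne (x : RationalPoint k X) : x.1 ≠ p := fun hx =>
      hdeg.ne' (degree_eq_one_iff.mpr (hx ▸ x.2))
    refine ⟨.ofBijective _ (hπ.bijective_rationalPointMap hne), fun _ => rfl,
      hπ.equivalentVia_pullback hd hgen hm D (fun _ => rfl) hne, fun _ E hE n => ?_⟩
    obtain ⟨u, v, huv⟩ := exists_span_eq_of_isRegularLocalRing hdim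
    exact hπ.equivalentVia_pullback_sub hd hgen (hpair huv) D hE n (fun _ => rfl) hne
  · have hk := degree_eq_one_iff.mp hdeg
    obtain ⟨e, he, he', hdir⟩ := hπ.exists_rationalPoint_equiv_sum hd hk (hpair huv)
    exact ⟨e, he, he', fun E hE n =>
      hπ.equivalentVia_extendedCode hd hgen hk (hpair huv) D hE n he he' hdir⟩
  · obtain ⟨u, v, huv⟩ := exists_span_eq_of_isRegularLocalRing hdim
    exact hπ.exists_isSumOfExceptionalCurves hd (hpair huv)

theorem mainTheorem10 {k : Type u} [Field k] [Finite k] {X Y : Scheme.{u}}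
    [X.Over (Spec (CommRingCat.of k))] [Y.Over (Spec (CommRingCat.of k))]
    [IsIntegral X] [IsIntegral Y] (hX : IsNormalSurface k X)
    (p : X) (hp : IsClosed {p}) (π : Y ⟶ X) [π.IsOver (Spec (CommRingCat.of k))]
    (hπ : IsBlowUpAt π p hp) (D : CartierDivisor X) :
    (1 < degree k X p →
      ∃ e : RationalPoint k Y ≃ RationalPoint k X, (∀ y, π y.1 = (e y).1) ∧
        EquivalentVia e
          (evaluationCode k (D.pullback π (hπ.isDominant hX.dim_eq_two)) id)
          (evaluationCode k D id) ∧
        (IsRegularLocalRing (X.presheaf.stalk p) →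
          ∀ E : CartierDivisor Y, IsSumOfExceptionalCurves π p hp E → ∀ n : ℕ,
            EquivalentVia e
              (evaluationCode k (D.pullback π (hπ.isDominant hX.dim_eq_two) - n • E) id)
              (codeOfSections k D id (sectionsOfMultiplicity k D p n)))) ∧
    (degree k X p = 1 → IsRegularLocalRing (X.presheaf.stalk p) →
      ∀ u v : X.presheaf.stalk p,
        IsLocalRing.maximalIdeal (X.presheaf.stalk p) = Ideal.span {u, v} →
        ∃ e : RationalPoint k Y ≃
            {x : RationalPoint k X // x.1 ≠ p} ⊕ Projectivization k (Fin 2 → k),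
          (∀ x, π (e.symm (Sum.inl x)).1 = x.1.1) ∧ (∀ t, π (e.symm (Sum.inr t)).1 = p) ∧
          ∀ E : CartierDivisor Y, IsSumOfExceptionalCurves π p hp E → ∀ n : ℕ,
            EquivalentVia e
              (evaluationCode k (D.pullback π (hπ.isDominant hX.dim_eq_two) - n • E) id)
              (extendedCode k D p u v n)) ∧
    (IsRegularLocalRing (X.presheaf.stalk p) →
      ∃ E : CartierDivisor Y, IsSumOfExceptionalCurves π p hp E) := by
  have := hX.locallyOfFiniteType
  have := hX.normal p
  have := LocallyOfFiniteType.isLocallyNoetherian (X ↘ Spec (CommRingCat.of k))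
  have hdim := (ringKrullDim_stalk_eq_topologicalKrullDim (k := k) hp).trans hX.dim_eq_two
  exact (mainTheorem10_general hdim hπ _ D).imp_right (And.imp_left fun h hdeg _ => h hdeg)
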